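/- Let $N\ge 1$, $p\ge 1$, and let $K\subset\mathbb R^N$ be a bounded, convex, symmetric set with $0$ in its interior. Put $\|x\|_K=\inf\{\lambda>0: x/\lambda\in K\}$ and $|z|_p=(|\Re z|^p+|\Im z|^p)^{1/p}$ for $z\in\mathbb C$; for $v\in\mathbb C^N$ put $$\|v\|_{Z_p^*K}=\Big(\frac{N+p}{p}\int_K|v\cdot x|_p^p\,dx\Big)^{1/p},$$ and for $v\in\mathbb R^N$ let $\|v\|_{Z_1^*K^*}=\sup\{\langle v,w\rangle: w\in\mathbb R^N,\ \|w\|_{Z_1^*K}\le1\}$. Let $A:\mathbb R^N\to\mathbb R^N$ be Lipschitz. Let $W^{1,p}_{A,K}(\mathbb R^N)$ be the space of $u\in L^p(\mathbb R^N,\mathbb C)$ with weak gradient $\nabla u\in L^1_{\rm loc}$ such that $\int_{\mathbb R^N}\|\nabla u-iA(x)u\|_{Z_p^*K}^p\,dx<\infty$. Let $|Du|_{A,K}=C_1+C_2$, where $$C_1=\sup_\varphi\int_{\mathbb R^N}\big(\Re u\,\mathrm{div}\,\varphi-A\cdot\varphi\,\Im u\big)\,dx,\qquad C_2=\sup_\varphi\int_{\mathbb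 R^N}\big(\Im u\,\mathrm{div}\,\varphi+A\cdot\varphi\,\Re u\big)\,dx,$$ the suprema being over $\varphi\in C^1_c(\mathbb R^N,\mathbb R^N)$ with $\|\varphi(x)\|_{Z_1^*K^*}\le1$ for all $x$, and let $BV_{A,K}(\mathbb R^N)=\{u\in L^1(\mathbb R^N,\mathbb C):|Du|_{A,K}<\infty\}$. Put $\Psi_u(x,y)=e^{i(x-y)\cdot A((x+y)/2)}u(y)$. Let $\rho_n:(0,\infty)\to[0,\infty)$, $n\in\mathbb N$, be measurable with $$\lim_{n\to\infty}\int_\delta^\infty\rho_n(r)r^{N-1-p}\,dr=0\ \text{ for all }\delta>0,\qquad \int_0^1\rho_n(r)r^{N-1}\,dr=1\ \text{ for all } n.\qquad(*)$$ (i) For every $u\in W^{1,p}_{A,K}(\mathbb R^N)$, $$\lim_{n\to\infty}\iint_{\mathbb R^{2N}}\frac{|\Psi_u(x,y)-\Psi_u(x,x)|_p^p}{\|x-y\|_K^p}\,\rho_n(\|x-y\|_K)\,dx\,dy=p\int_{\mathbb R^N}\|\nabla u-iA(x)u\|^p_{Z_p^*K}\,dx.$$ (ii) If $p=1$ and $u\in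 BV_{A,K}(\mathbb R^N)$, then the same limit exists and equals $|Du|_{A,K}$. (iii) If $0<s_n<1$ and $s_n\to1$, then $\rho_n(r)=p(1-s_n)r^{p-N-ps_n}$ satisfies $(*)$. Consequently (Ludwig's formula), for every real-valued $u\in W^{1,p}(\mathbb R^N)$, $$\lim_{s\nearrow1}(1-s)\iint_{\mathbb R^{2N}}\frac{|u(x)-u(y)|^p}{\|x-y\|_K^{N+ps}}\,dx\,dy=\int_{\mathbb R^N}\|\nabla u\|_{Z_p^*K}^p\,dx,$$ and for $p=1$ and real-valued $u\in BV(\mathbb R^N)$ the same limit equals $|Du|_{0,K}$. -/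

import Mathlib

open MeasureTheory Set Filter Topology
open scoped ENNReal

noncomputable section

namespace AnisotropicBBM

/-- The Euclidean space `ℝ^N`. -/
abbrev RN (N : ℕ) : Type := EuclideanSpace ℝ (Fin N)

/-- The complex space `ℂ^N`. -/
abbrev CN (N : ℕ) : Type := EuclideanSpace ℂ (Fin N)

/-- `|z|_p = (|Re z|^p + |Im z|^p)^(1/p)` for a complex number `z`. -/
def absP (p : ℝ) (z : ℂ) : ℝ := (|z.re| ^ p + |z.im| ^ p) ^ (1 / p)

/-- The complex number `v · x = ∑ v_j x_j`, for `v ∈ ℂ^N` and `x ∈ ℝ^N`. -/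
def cdot {N : ℕ} (v : CN N) (x : RN N) : ℂ := ∑ j, v j * (x j : ℂ)

/-- The inclusion of `ℝ^N` into `ℂ^N`. -/
def toCN {N : ℕ} (x : RN N) : CN N := WithLp.toLp 2 (fun j => (x j : ℂ))

/-- The norm of the complex polar `L_p`-moment body of `K`,
`‖v‖ = ((N + p) / p * ∫_K |v · x|_p^p dx)^(1/p)` for `v ∈ ℂ^N`. -/
def polarMomentNorm {N : ℕ} (p : ℝ) (K : Set (RN N)) (v : CN N) : ℝ :=
  (((N : ℝ) + p) / p * ∫ x in K, absP p (cdot v x) ^ p) ^ (1 / p)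

/-- The dual, on `ℝ^N`, of the restriction to `ℝ^N` of the norm `polarMomentNorm 1 K`. -/
def dualMomentNorm {N : ℕ} (K : Set (RN N)) (v : RN N) : ℝ :=
  sSup {t : ℝ | ∃ w : RN N, polarMomentNorm 1 K (toCN w) ≤ 1 ∧ t = inner ℝ v w}

/-- `g` is the weak (distributional) gradient of `u : ℝ^N → ℂ`: both are locally integrable and
`∫ u ∂_j φ = - ∫ φ g_j` for all real test functions `φ` and all `j`. -/
def IsWeakGradient {N : ℕ} (u : RN N → ℂ) (g : RN N → CN N) : Prop :=
  LocallyIntegrable u volume ∧ LocallyIntegrable g volume ∧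
    ∀ φ : RN N → ℝ, ContDiff ℝ ((⊤ : ℕ∞) : WithTop ℕ∞) φ → HasCompactSupport φ → ∀ j : Fin N,
      ∫ x, (fderiv ℝ φ x (EuclideanSpace.single j (1 : ℝ)) : ℂ) * u x
        = - ∫ x, (φ x : ℂ) * g x j

/-- `∫ ‖g - i A u‖^p dx` in the norm of the polar `L_p`-moment body of `K`; for `g = ∇u` this is
the `p`-th power of the magnetic Sobolev seminorm. -/
def magEnergy {N : ℕ} (p : ℝ) (K : Set (RN N)) (A : RN N → RN N) (u : RN N → ℂ)
    (g : RN N → CN N) : ℝ≥0∞ :=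
  ∫⁻ x, ENNReal.ofReal
    (polarMomentNorm p K (g x - (Complex.I * u x) • toCN (A x)) ^ p)

/-- The anisotropic magnetic Sobolev space `W^{1,p}_{A,K}(ℝ^N)`. -/
def MemMagSobolev {N : ℕ} (p : ℝ) (K : Set (RN N)) (A : RN N → RN N) (u : RN N → ℂ) : Prop :=
  MemLp u (ENNReal.ofReal p) volume ∧
    ∃ g : RN N → CN N, IsWeakGradient u g ∧ magEnergy p K A u g < ⊤

/-- The divergence of a vector field. -/
def divergence {N : ℕ} (φ : RN N → RN N) (x : RN N) : ℝ :=
  ∑ j, (fderiv ℝ φ x (EuclideanSpace.single j (1 : ℝ))) j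

/-- The admissible fields: `φ ∈ C^1_c(ℝ^N, ℝ^N)` with values in the unit ball of the dual norm. -/
def IsAdmissible {N : ℕ} (K : Set (RN N)) (φ : RN N → RN N) : Prop :=
  ContDiff ℝ 1 φ ∧ HasCompactSupport φ ∧ ∀ x, dualMomentNorm K (φ x) ≤ 1

/-- `sup_φ ∫ Re u div φ - (A · φ) Im u`. As `φ = 0` is admissible the supremum is nonnegative, so
truncating negative values by `ENNReal.ofReal` does not change it. -/
def variationRe {N : ℕ} (K : Set (RN N)) (A : RN N → RN N) (u : RN N → ℂ) : ℝ≥0∞ :=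
  ⨆ (φ : RN N → RN N) (_ : IsAdmissible K φ),
    ENNReal.ofReal (∫ x, ((u x).re * divergence φ x - inner ℝ (A x) (φ x) * (u x).im))

/-- `sup_φ ∫ Im u div φ + (A · φ) Re u`. -/
def variationIm {N : ℕ} (K : Set (RN N)) (A : RN N → RN N) (u : RN N → ℂ) : ℝ≥0∞ :=
  ⨆ (φ : RN N → RN N) (_ : IsAdmissible K φ),
    ENNReal.ofReal (∫ x, ((u x).im * divergence φ x + inner ℝ (A x) (φ x) * (u x).re))

/-- The anisotropic magnetic total variation `|Du|_{A,K}`. -/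
def magVariation {N : ℕ} (K : Set (RN N)) (A : RN N → RN N) (u : RN N → ℂ) : ℝ≥0∞ :=
  variationRe K A u + variationIm K A u

/-- The anisotropic magnetic space `BV_{A,K}(ℝ^N)`. -/
def MemMagBV {N : ℕ} (K : Set (RN N)) (A : RN N → RN N) (u : RN N → ℂ) : Prop :=
  MemLp u 1 volume ∧ magVariation K A u < ⊤

/-- `Ψ_u(x,y) = exp(i (x - y) · A((x + y) / 2)) u(y)`. -/
def Psi {N : ℕ} (A : RN N → RN N) (u : RN N → ℂ) (x y : RN N) : ℂ :=
  Complex.exp (Complex.I * ((inner ℝ (x - y) (A ((2 : ℝ)⁻¹ • (x + y))) : ℝ) : ℂ)) * u y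

/-- The nonlocal functional
`∬ |Ψ_u(x,y) - Ψ_u(x,x)|_p^p / ‖x - y‖_K^p * ρ(‖x - y‖_K) dx dy`,
where `‖·‖_K` is the Minkowski functional `gauge K`. -/
def nonlocalEnergy {N : ℕ} (p : ℝ) (K : Set (RN N)) (A : RN N → RN N) (ρ : ℝ → ℝ)
    (u : RN N → ℂ) : ℝ≥0∞ :=
  ∫⁻ z : RN N × RN N, ENNReal.ofReal
    (absP p (Psi A u z.1 z.2 - Psi A u z.1 z.1) ^ p / gauge K (z.1 - z.2) ^ p
      * ρ (gauge K (z.1 - z.2)))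

/-- A sequence of radial profiles `ρ_n : (0,∞) → [0,∞)` with
`∫_δ^∞ ρ_n(r) r^(N-1-p) dr → 0` for every `δ > 0` and `∫_0^1 ρ_n(r) r^(N-1) dr = 1`. -/
structure IsMollifierSeq (N : ℕ) (p : ℝ) (ρ : ℕ → ℝ → ℝ) : Prop where
  aemeasurable : ∀ n, AEMeasurable (ρ n) (volume.restrict (Ioi 0))
  nonneg : ∀ n, ∀ r : ℝ, 0 < r → 0 ≤ ρ n r
  tail : ∀ δ : ℝ, 0 < δ →
    Tendsto (fun n => ∫⁻ r in Ioi δ, ENNReal.ofReal (ρ n r * r ^ ((N : ℝ) - 1 - p)))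
      atTop (𝓝 0)
  mass : ∀ n, ∫⁻ r in Ioo (0 : ℝ) 1, ENNReal.ofReal (ρ n r * r ^ ((N : ℝ) - 1)) = 1

/-- `∬ |u(x) - u(y)|^p / ‖x - y‖_K^(N + p s) dx dy` for real-valued `u`. -/
def fractionalEnergy {N : ℕ} (p s : ℝ) (K : Set (RN N)) (u : RN N → ℝ) : ℝ≥0∞ :=
  ∫⁻ z : RN N × RN N, ENNReal.ofReal
    (|u z.1 - u z.2| ^ p / gauge K (z.1 - z.2) ^ ((N : ℝ) + p * s))

end AnisotropicBBM

end

/-!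
Substituting `y = x + h`, the nonlocal energy is `∫ F(h) ρ_n(‖h‖_K) / ‖h‖_K^p dh`, where `F(h)` is
the integral over `x` of `|Ψ_u(x, x + h) - u(x)|_p^p`. In polar coordinates with respect to the
gauge, the conditions on `ρ_n` send a function `f` that is homogeneous of degree `p` to
`(N + p) ∫_K f`, and an error that is `o(|h|^p)` at `0` and bounded to `0`. So it suffices to
compare `F` near `0` with a homogeneous function.

For Sobolev `u` this function is `h ↦ ∫ |G(x) · h|_p^p dx` with `G = ∇u - i A u`, by integrating
the derivative of `t ↦ Ψ_u(x, x + t h)` after mollification; integrated over `K` it gives the energy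
of `G` in the norm of the polar moment body, by Tonelli.

For `u` of bounded variation, let `G_k = ∇(φ_k * u) - i φ_k * (A u)` be the mollified gradients. For
fixed `k`, mollification does not increase `F` up to `O(k⁻¹ |h|)`, so that
`∫ |G_k · h|_1 ≤ F(h) + O(k⁻¹ |h|) + o(|h|)`; conversely `F(h) ≤ liminf_k ∫ |G_k · h|_1 + o(|h|)`.
It remains to see that the energies of `G_k` converge to `|Du|_{A,K}`. They are at most
`|Du|_{A,K}` because a field that almost attains the dual norm pairs with `G_k` as its mollification
pairs with `u`, and their limit is at least `|Du|_{A,K}` by testing on compact sets.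
-/

noncomputable section

namespace AnisotropicBBM

section PolarIntegration

open Module (finrank)

variable {E : Type*} [NormedAddCommGroup E] [NormedSpace ℝ E]

/-- A function on `E` with values in `[0, ∞]` is positively homogeneous of degree `q`. -/
def IsPosHomogeneous (q : ℝ) (f : E → ℝ≥0∞) : Prop :=
  ∀ t : ℝ, 0 < t → ∀ h, f (t • h) = ENNReal.ofReal (t ^ q) * f h

namespace IsPosHomogeneous

variable {q : ℝ} {f g : E → ℝ≥0∞}

theorem add (hf : IsPosHomogeneous q f) (hg : IsPosHomogeneous q g) :
    IsPosHomogeneous q fun h => f h + g h := fun t ht h => by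
  beta_reduce
  rw [hf t ht, hg t ht, mul_add]

theorem sub (hf : IsPosHomogeneous q f) (hg : IsPosHomogeneous q g) :
    IsPosHomogeneous q fun h => f h - g h := fun t ht h => by
  beta_reduce
  rw [hf t ht, hg t ht, ENNReal.mul_sub fun _ _ => ENNReal.ofReal_ne_top]

theorem const_mul (a : ℝ≥0∞) (hf : IsPosHomogeneous q f) :
    IsPosHomogeneous q fun h => a * f h := fun t ht h => by
  beta_reduce
  rw [hf t ht, mul_left_comm]

theorem one : IsPosHomogeneous (E := E) 0 fun _ => 1 := fun t _ h => by
  simp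

theorem enorm_rpow (hq : 0 ≤ q) : IsPosHomogeneous (E := E) q fun h => ‖h‖ₑ ^ q := fun t ht h => by
  beta_reduce
  rw [enorm_smul, Real.enorm_of_nonneg ht.le, ENNReal.mul_rpow_of_nonneg _ _ hq,
    ENNReal.ofReal_rpow_of_pos ht]

end IsPosHomogeneous

theorem gauge_pos_iff_ne_zero {K : Set E} (hKb : Bornology.IsBounded K) (hK0 : K ∈ 𝓝 0) {x : E} :
    0 < gauge K x ↔ x ≠ 0 :=
  gauge_pos (absorbent_nhds_zero hK0) ((NormedSpace.isVonNBounded_iff ℝ).2 hKb)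

theorem exists_gauge_le_imp_of_eventually {K : Set E} (hKb : Bornology.IsBounded K)
    (hK0 : K ∈ 𝓝 0) {P : E → Prop} (hP : ∀ᶠ h in 𝓝 0, P h) :
    ∃ δ : ℝ, 0 < δ ∧ δ < 1 ∧ ∀ h, gauge K h ≤ δ → P h := by
  rw [← comap_gauge_nhds_zero ((NormedSpace.isVonNBounded_iff ℝ).2 hKb) hK0,
    (Metric.nhds_basis_ball.comap _).eventually_iff] at hP
  obtain ⟨ε, hε, hball⟩ := hP
  refine ⟨min (1 / 2) (ε / 2), by positivity, (min_le_left _ _).trans_lt one_half_lt_one,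
    fun h hh => hball ?_⟩
  rw [mem_preimage, mem_ball_zero_iff, Real.norm_of_nonneg (gauge_nonneg h)]
  exact (hh.trans (min_le_right _ _)).trans_lt (half_lt_self hε)

theorem setLIntegral_Ioi_comp_mul_right {c : ℝ} (hc : 0 < c) {f : ℝ → ℝ≥0∞} (hf : Measurable f) :
    ∫⁻ r in Ioi (0 : ℝ), f (r * c) = ENNReal.ofReal c⁻¹ * ∫⁻ r in Ioi (0 : ℝ), f r := by
  have hind : ∀ r, (Ioi (0 : ℝ)).indicator (fun r => f (r * c)) r
      = (Ioi (0 : ℝ)).indicator f (r * c) := fun r => by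
    simp only [indicator, mem_Ioi, mul_pos_iff_of_pos_right hc]
  rw [← lintegral_indicator measurableSet_Ioi, ← lintegral_indicator measurableSet_Ioi,
    lintegral_congr hind, ← lintegral_map (hf.indicator measurableSet_Ioi) (measurable_mul_const c),
    Real.map_volume_mul_right hc.ne', lintegral_smul_measure, abs_of_pos (inv_pos.2 hc),
    smul_eq_mul]

theorem setLIntegral_Ioo_rpow {a : ℝ} (ha : -1 < a) {δ : ℝ} (hδ : 0 < δ) :
    ∫⁻ r in Ioo (0 : ℝ) δ, ENNReal.ofReal (r ^ a) = ENNReal.ofReal (δ ^ (a + 1) / (a + 1)) := by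
  rw [← ofReal_integral_eq_lintegral_ofReal ((intervalIntegral.integrableOn_Ioo_rpow_iff hδ).2 ha)]
  · rw [← integral_Ioc_eq_integral_Ioo, ← intervalIntegral.integral_of_le hδ.le,
      integral_rpow (Or.inl ha), Real.zero_rpow (by linarith), sub_zero]
  · filter_upwards [ae_restrict_mem measurableSet_Ioo] with r hr
    exact Real.rpow_nonneg hr.1.le _

theorem setLIntegral_Ioi_ray_mul_comp_gauge {K : Set E} {d q : ℝ} {f : E → ℝ≥0∞}
    (hom : IsPosHomogeneous q f) {ρ : ℝ → ℝ≥0∞} (hρ : Measurable ρ) {x : E}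
    (hx : 0 < gauge K x) :
    ∫⁻ r in Ioi (0 : ℝ), ENNReal.ofReal (r ^ (d - 1)) * (f (r • x) * ρ (gauge K (r • x)))
      = f x * ENNReal.ofReal (gauge K x ^ (-(d + q))) *
        ∫⁻ r in Ioi (0 : ℝ), ρ r * ENNReal.ofReal (r ^ (d - 1 + q)) := by
  set g := gauge K x
  have hray : ∀ r ∈ Ioi (0 : ℝ),
      ENNReal.ofReal (r ^ (d - 1)) * (f (r • x) * ρ (gauge K (r • x)))
        = f x * ENNReal.ofReal (g ^ (-(d - 1 + q))) *
          (ρ (r * g) * ENNReal.ofReal ((r * g) ^ (d - 1 + q))) := by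
    intro r (hr : 0 < r)
    have hpow : r ^ (d - 1) * r ^ q = g ^ (-(d - 1 + q)) * (r * g) ^ (d - 1 + q) := by
      rw [Real.mul_rpow hr.le hx.le, mul_left_comm, ← Real.rpow_add hx, ← Real.rpow_add hr,
        neg_add_cancel, Real.rpow_zero, mul_one]
    have hpow' : ENNReal.ofReal (r ^ (d - 1)) * ENNReal.ofReal (r ^ q)
        = ENNReal.ofReal (g ^ (-(d - 1 + q))) * ENNReal.ofReal ((r * g) ^ (d - 1 + q)) := by
      rw [← ENNReal.ofReal_mul (by positivity), hpow, ENNReal.ofReal_mul (by positivity)]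
    rw [hom r hr, gauge_smul_of_nonneg hr.le, smul_eq_mul]
    calc _ = f x * ρ (r * g) * (ENNReal.ofReal (r ^ (d - 1)) * ENNReal.ofReal (r ^ q)) := by ring
      _ = _ := by rw [hpow']; ring
  have hm : Measurable fun r => ρ r * ENNReal.ofReal (r ^ (d - 1 + q)) := by fun_prop
  rw [setLIntegral_congr_fun measurableSet_Ioi hray, lintegral_const_mul _ (by fun_prop),
    setLIntegral_Ioi_comp_mul_right hx hm, ← mul_assoc, mul_assoc (f x),
    ← ENNReal.ofReal_mul (by positivity), ← Real.rpow_neg_one, ← Real.rpow_add hx]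
  congr 4
  ring

variable [MeasurableSpace E] {μ : Measure E} {K : Set E}

/-- `(dim E + q) ∫_K f`. For `f` homogeneous of degree `q`, this is the factor of `f` when
integrating `f` against functions of the gauge of `K` in polar coordinates; it plays the role of
the integral of `f` over the unit sphere. -/
def coneMass (μ : Measure E) (K : Set E) (q : ℝ) (f : E → ℝ≥0∞) : ℝ≥0∞ :=
  ENNReal.ofReal (finrank ℝ E + q) * ∫⁻ h in K, f h ∂μ

theorem coneMass_add (q : ℝ) {f : E → ℝ≥0∞} (hf : Measurable f) (g : E → ℝ≥0∞) :
    coneMass μ K q (fun h => f h + g h) = coneMass μ K q f + coneMass μ K q g := by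
  rw [coneMass, lintegral_add_left hf, mul_add, coneMass, coneMass]

theorem coneMass_const_mul (q : ℝ) (a : ℝ≥0∞) {f : E → ℝ≥0∞} (hf : Measurable f) :
    coneMass μ K q (fun h => a * f h) = a * coneMass μ K q f := by
  rw [coneMass, lintegral_const_mul a hf, mul_left_comm, coneMass]

theorem coneMass_mono (q : ℝ) {f g : E → ℝ≥0∞} (hfg : ∀ h, f h ≤ g h) :
    coneMass μ K q f ≤ coneMass μ K q g := by
  unfold coneMass
  gcongr
  exact hfg _

variable [FiniteDimensional ℝ E] [μ.IsAddHaarMeasure]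

theorem coneMass_enorm_rpow_lt_top (hKb : Bornology.IsBounded K) {q : ℝ} (hq : 0 ≤ q) :
    coneMass μ K q (fun h => ‖h‖ₑ ^ q) < ⊤ := by
  obtain ⟨R, hR⟩ := hKb.subset_closedBall (0 : E)
  refine ENNReal.mul_lt_top ENNReal.ofReal_lt_top ?_
  calc ∫⁻ h in K, ‖h‖ₑ ^ q ∂μ ≤ ∫⁻ h in Metric.closedBall (0 : E) R, ‖h‖ₑ ^ q ∂μ :=
        lintegral_mono_set hR
    _ ≤ ∫⁻ _ in Metric.closedBall (0 : E) R, ENNReal.ofReal R ^ q ∂μ := by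
        refine setLIntegral_mono measurable_const fun h hh => ?_
        gcongr
        rw [← ofReal_norm]
        exact ENNReal.ofReal_le_ofReal (mem_closedBall_zero_iff.1 hh)
    _ < ⊤ := by
        rw [setLIntegral_const]
        exact ENNReal.mul_lt_top (ENNReal.rpow_lt_top_of_nonneg hq ENNReal.ofReal_ne_top)
          measure_closedBall_lt_top

variable [BorelSpace E]

theorem lintegral_eq_lintegral_toSphere [Nontrivial E] {f : E → ℝ≥0∞} (hf : Measurable f) :
    ∫⁻ x, f x ∂μ = ∫⁻ θ : Metric.sphere (0 : E) 1, ∫⁻ r in Ioi (0 : ℝ),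
      ENNReal.ofReal (r ^ (finrank ℝ E - 1)) * f (r • (θ : E)) ∂volume ∂μ.toSphere := by
  have hg : Measurable fun z : Metric.sphere (0 : E) 1 × Ioi (0 : ℝ) =>
      f ((z.2 : ℝ) • (z.1 : E)) := hf.comp (by fun_prop)
  have hpolar : ∀ x : ({(0 : E)}ᶜ : Set E), f (((homeomorphUnitSphereProd E x).2 : ℝ) •
      ((homeomorphUnitSphereProd E x).1 : E)) = f x := fun x => by
    simp [homeomorphUnitSphereProd, smul_smul, norm_ne_zero_iff.2 x.2]
  calc ∫⁻ x, f x ∂μ = ∫⁻ x : ({(0 : E)}ᶜ : Set E), f x ∂(μ.comap Subtype.val) := by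
        rw [lintegral_subtype_comap (measurableSet_singleton _).compl, restrict_compl_singleton]
    _ = ∫⁻ z : Metric.sphere (0 : E) 1 × Ioi (0 : ℝ), f ((z.2 : ℝ) • (z.1 : E))
          ∂μ.toSphere.prod (.volumeIoiPow (finrank ℝ E - 1)) := by
        simp only [← μ.measurePreserving_homeomorphUnitSphereProd.lintegral_comp hg, hpolar]
    _ = _ := by
        rw [lintegral_prod _ hg.aemeasurable]
        refine lintegral_congr fun θ => ?_
        rw [Measure.volumeIoiPow,
          lintegral_withDensity_eq_lintegral_mul _ (by fun_prop) (by fun_prop)]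
        exact lintegral_subtype_comap (μ := volume) measurableSet_Ioi
          fun r : ℝ => ENNReal.ofReal (r ^ (finrank ℝ E - 1)) * f (r • (θ : E))

theorem ae_eq_setOf_gauge_lt_one (hKc : Convex ℝ K) (hK0 : K ∈ 𝓝 0) :
    K =ᵐ[μ] {x | gauge K x < 1} := by
  rw [setOfPred_gauge_lt_one_eq_interior hKc hK0]
  exact (interior_ae_eq_of_null_frontier (hKc.addHaar_frontier μ)).symm

section Radial

variable [Nontrivial E]

theorem exists_lintegral_mul_comp_gauge_eq (hKc : Convex ℝ K) (hKb : Bornology.IsBounded K)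
    (hK0 : K ∈ 𝓝 0) {q : ℝ} {f : E → ℝ≥0∞} (hf : Measurable f) (hom : IsPosHomogeneous q f) :
    ∃ c : ℝ≥0∞, ∀ ρ : ℝ → ℝ≥0∞, Measurable ρ → ∫⁻ h, f h * ρ (gauge K h) ∂μ
      = c * ∫⁻ r in Ioi (0 : ℝ), ρ r * ENNReal.ofReal (r ^ ((finrank ℝ E : ℝ) - 1 + q)) := by
  have : Continuous (gauge K) := continuous_gauge hKc hK0
  refine ⟨∫⁻ θ : Metric.sphere (0 : E) 1, f θ *
    ENNReal.ofReal (gauge K (θ : E) ^ (-((finrank ℝ E : ℝ) + q))) ∂μ.toSphere, fun ρ hρ => ?_⟩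
  rw [lintegral_eq_lintegral_toSphere (by fun_prop), ← lintegral_mul_const _ (by fun_prop)]
  refine lintegral_congr fun θ => ?_
  have hθ : 0 < gauge K (θ : E) :=
    (gauge_pos_iff_ne_zero hKb hK0).2 (ne_zero_of_mem_unit_sphere θ)
  rw [← setLIntegral_Ioi_ray_mul_comp_gauge hom hρ hθ]
  refine lintegral_congr fun r => ?_
  rw [← Real.rpow_natCast, Nat.cast_sub Module.finrank_pos, Nat.cast_one]

theorem lintegral_mul_comp_gauge_of_measurable (hKc : Convex ℝ K) (hKb : Bornology.IsBounded K)
    (hK0 : K ∈ 𝓝 0) {q : ℝ} (hq : 0 ≤ q) {f : E → ℝ≥0∞} (hf : Measurable f)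
    (hom : IsPosHomogeneous q f) {ρ : ℝ → ℝ≥0∞} (hρ : Measurable ρ) :
    ∫⁻ h, f h * ρ (gauge K h) ∂μ = coneMass μ K q f *
      ∫⁻ r in Ioi (0 : ℝ), ρ r * ENNReal.ofReal (r ^ ((finrank ℝ E : ℝ) - 1 + q)) := by
  have hd : (1 : ℝ) ≤ finrank ℝ E := by exact_mod_cast Module.finrank_pos (R := ℝ) (M := E)
  obtain ⟨c, hc⟩ := exists_lintegral_mul_comp_gauge_eq (μ := μ) hKc hKb hK0 hf hom
  -- The constant is found by testing against the indicator function of `K`.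
  have hK : ∫⁻ h, f h * (Iio (1 : ℝ)).indicator 1 (gauge K h) ∂μ = ∫⁻ h in K, f h ∂μ := by
    rw [setLIntegral_congr (ae_eq_setOf_gauge_lt_one hKc hK0), ← lintegral_indicator
      (measurableSet_lt (continuous_gauge hKc hK0).measurable measurable_const)]
    refine lintegral_congr fun h => ?_
    by_cases hh : gauge K h < 1 <;> simp [indicator, hh]
  have hrad : ∫⁻ r in Ioi (0 : ℝ), (Iio (1 : ℝ)).indicator 1 r *
      ENNReal.ofReal (r ^ ((finrank ℝ E : ℝ) - 1 + q))
        = ENNReal.ofReal ((finrank ℝ E : ℝ) + q)⁻¹ := by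
    have hind : ∀ r : ℝ, (Iio (1 : ℝ)).indicator 1 r * ENNReal.ofReal
        (r ^ ((finrank ℝ E : ℝ) - 1 + q)) = (Iio (1 : ℝ)).indicator
          (fun r => ENNReal.ofReal (r ^ ((finrank ℝ E : ℝ) - 1 + q))) r := fun r => by
      by_cases hr : r < 1 <;> simp [indicator, hr]
    rw [lintegral_congr hind, setLIntegral_indicator measurableSet_Iio, inter_comm, Ioi_inter_Iio,
      setLIntegral_Ioo_rpow (by linarith) one_pos, Real.one_rpow, one_div]
    ring_nf
  have hone := hc ((Iio 1).indicator 1) (measurable_one.indicator measurableSet_Iio)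
  rw [hK, hrad] at hone
  rw [hc ρ hρ, coneMass, hone, mul_left_comm, ← ENNReal.ofReal_mul (by positivity),
    mul_inv_cancel₀ (by positivity), ENNReal.ofReal_one, mul_one]

theorem quasiMeasurePreserving_gauge (hKc : Convex ℝ K) (hKb : Bornology.IsBounded K)
    (hK0 : K ∈ 𝓝 0) : Measure.QuasiMeasurePreserving (gauge K) μ (volume.restrict (Ioi 0)) := by
  have hgm := (continuous_gauge hKc hK0).measurable
  refine ⟨hgm, Measure.AbsolutelyContinuous.mk fun B hB hB0 => ?_⟩
  rw [Measure.map_apply hgm hB]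
  have hrad : ∫⁻ r in Ioi (0 : ℝ), B.indicator 1 r *
      ENNReal.ofReal (r ^ ((finrank ℝ E : ℝ) - 1 + 0)) = 0 := by
    refine lintegral_eq_zero_of_ae_eq_zero ?_
    filter_upwards [measure_eq_zero_iff_ae_notMem.1 hB0] with r hr
    simp [hr]
  calc μ (gauge K ⁻¹' B) = ∫⁻ h, 1 * B.indicator 1 (gauge K h) ∂μ := by
        rw [← lintegral_indicator_one (hgm hB)]
        simp only [one_mul, indicator, Pi.one_apply]
        rfl
    _ = 0 := by
        rw [lintegral_mul_comp_gauge_of_measurable hKc hKb hK0 le_rfl measurable_const .one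
          (measurable_one.indicator hB), hrad, mul_zero]

theorem lintegral_mul_comp_gauge (hKc : Convex ℝ K) (hKb : Bornology.IsBounded K)
    (hK0 : K ∈ 𝓝 0) {q : ℝ} (hq : 0 ≤ q) {f : E → ℝ≥0∞} (hf : Measurable f)
    (hom : IsPosHomogeneous q f) {ρ : ℝ → ℝ≥0∞} (hρ : AEMeasurable ρ (volume.restrict (Ioi 0))) :
    ∫⁻ h, f h * ρ (gauge K h) ∂μ = coneMass μ K q f *
      ∫⁻ r in Ioi (0 : ℝ), ρ r * ENNReal.ofReal (r ^ ((finrank ℝ E : ℝ) - 1 + q)) := by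
  calc ∫⁻ h, f h * ρ (gauge K h) ∂μ = ∫⁻ h, f h * hρ.mk ρ (gauge K h) ∂μ := by
        refine lintegral_congr_ae ?_
        filter_upwards [(quasiMeasurePreserving_gauge hKc hKb hK0).ae hρ.ae_eq_mk] with h hh
        rw [hh]
    _ = coneMass μ K q f * ∫⁻ r in Ioi (0 : ℝ),
          hρ.mk ρ r * ENNReal.ofReal (r ^ ((finrank ℝ E : ℝ) - 1 + q)) :=
        lintegral_mul_comp_gauge_of_measurable hKc hKb hK0 hq hf hom hρ.measurable_mk
    _ = _ := by
        congr 1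
        refine lintegral_congr_ae ?_
        filter_upwards [hρ.ae_eq_mk] with r hr
        rw [hr]

theorem setLIntegral_mul_comp_gauge (hKc : Convex ℝ K) (hKb : Bornology.IsBounded K)
    (hK0 : K ∈ 𝓝 0) {q : ℝ} (hq : 0 ≤ q) {f : E → ℝ≥0∞} (hf : Measurable f)
    (hom : IsPosHomogeneous q f) {ρ : ℝ → ℝ≥0∞} (hρ : AEMeasurable ρ (volume.restrict (Ioi 0)))
    {s : Set ℝ} (hs : MeasurableSet s) :
    ∫⁻ h in gauge K ⁻¹' s, f h * ρ (gauge K h) ∂μ = coneMass μ K q f *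
      ∫⁻ r in s ∩ Ioi 0, ρ r * ENNReal.ofReal (r ^ ((finrank ℝ E : ℝ) - 1 + q)) := by
  rw [← lintegral_indicator ((continuous_gauge hKc hK0).measurable hs), ← setLIntegral_indicator hs]
  simp only [indicator_mul_left]
  rw [← lintegral_mul_comp_gauge hKc hKb hK0 hq hf hom (hρ.indicator hs)]
  refine lintegral_congr fun h => ?_
  by_cases hh : gauge K h ∈ s <;> simp [indicator, hh]

end Radial

end PolarIntegration

section RadialLimits

open Module (finrank)

/-- The radial weight `ρ(r) / r^p` of the nonlocal functional. -/
def radialKernel (p : ℝ) (ρ : ℝ → ℝ) (r : ℝ) : ℝ≥0∞ := ENNReal.ofReal (ρ r / r ^ p)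

namespace IsMollifierSeq

variable {N : ℕ} {p : ℝ} {ρ : ℕ → ℝ → ℝ}

theorem aemeasurable_radialKernel (hρ : IsMollifierSeq N p ρ) (n : ℕ) :
    AEMeasurable (radialKernel p (ρ n)) (volume.restrict (Ioi 0)) :=
  ((hρ.aemeasurable n).div (by fun_prop)).ennreal_ofReal

theorem radialKernel_mul_rpow (hρ : IsMollifierSeq N p ρ) (n : ℕ) {r : ℝ} (hr : 0 < r) (a : ℝ) :
    radialKernel p (ρ n) r * ENNReal.ofReal (r ^ a) = ENNReal.ofReal (ρ n r * r ^ (a - p)) := by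
  have := hρ.nonneg n r hr
  rw [radialKernel, ← ENNReal.ofReal_mul (by positivity), Real.rpow_sub hr, div_mul_eq_mul_div,
    mul_div_assoc]

theorem mass_Ioc_le_one (hρ : IsMollifierSeq N p ρ) {δ : ℝ} (hδ : δ < 1) (n : ℕ) :
    ∫⁻ r in Ioc (0 : ℝ) δ, ENNReal.ofReal (ρ n r * r ^ ((N : ℝ) - 1)) ≤ 1 := by
  rw [← hρ.mass n]
  exact lintegral_mono_set fun r hr => ⟨hr.1, hr.2.trans_lt hδ⟩

theorem one_le_mass_Ioc_add (hρ : IsMollifierSeq N p ρ) (hp : 0 ≤ p) {δ : ℝ} (h0 : 0 < δ)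
    (hδ : δ < 1) (n : ℕ) :
    1 ≤ (∫⁻ r in Ioc (0 : ℝ) δ, ENNReal.ofReal (ρ n r * r ^ ((N : ℝ) - 1))) +
      ∫⁻ r in Ioi δ, ENNReal.ofReal (ρ n r * r ^ ((N : ℝ) - 1 - p)) := by
  rw [← hρ.mass n, ← Ioc_union_Ioo_eq_Ioo h0.le hδ]
  refine (lintegral_union_le _ _ _).trans (add_le_add_right ?_ _)
  refine (setLIntegral_mono' measurableSet_Ioo fun r hr => ?_).trans
    (lintegral_mono_set Ioo_subset_Ioi_self)
  have hr0 : 0 < r := h0.trans hr.1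
  exact ENNReal.ofReal_le_ofReal (mul_le_mul_of_nonneg_left
    (Real.rpow_le_rpow_of_exponent_ge hr0 hr.2.le (by linarith)) (hρ.nonneg n r hr0))

theorem tendsto_mass_Ioc (hρ : IsMollifierSeq N p ρ) (hp : 0 ≤ p) {δ : ℝ} (h0 : 0 < δ)
    (hδ : δ < 1) :
    Tendsto (fun n => ∫⁻ r in Ioc (0 : ℝ) δ, ENNReal.ofReal (ρ n r * r ^ ((N : ℝ) - 1)))
      atTop (𝓝 1) := by
  have hlow : Tendsto
      (fun n => 1 - ∫⁻ r in Ioi δ, ENNReal.ofReal (ρ n r * r ^ ((N : ℝ) - 1 - p)))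
      atTop (𝓝 1) := by
    simpa using ENNReal.Tendsto.sub (tendsto_const_nhds (x := (1 : ℝ≥0∞))) (hρ.tail δ h0)
      (Or.inl ENNReal.one_ne_top)
  exact tendsto_of_tendsto_of_tendsto_of_le_of_le hlow tendsto_const_nhds
    (fun n => tsub_le_iff_right.2 (hρ.one_le_mass_Ioc_add hp h0 hδ n)) (hρ.mass_Ioc_le_one hδ)

end IsMollifierSeq

variable {E : Type*} [NormedAddCommGroup E] [NormedSpace ℝ E] [FiniteDimensional ℝ E]
  [Nontrivial E] [MeasurableSpace E] [BorelSpace E] {μ : Measure E} [μ.IsAddHaarMeasure]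
  {K : Set E} {p : ℝ} {ρ : ℕ → ℝ → ℝ}

theorem setLIntegral_inner_mul_radialKernel (hKc : Convex ℝ K) (hKb : Bornology.IsBounded K)
    (hK0 : K ∈ 𝓝 0) (hρ : IsMollifierSeq (finrank ℝ E) p ρ) (hp : 0 ≤ p) {f : E → ℝ≥0∞}
    (hf : Measurable f) (hom : IsPosHomogeneous p f) (δ : ℝ) (n : ℕ) :
    ∫⁻ h in gauge K ⁻¹' Iic δ, f h * radialKernel p (ρ n) (gauge K h) ∂μ = coneMass μ K p f *
      ∫⁻ r in Ioc (0 : ℝ) δ, ENNReal.ofReal (ρ n r * r ^ ((finrank ℝ E : ℝ) - 1)) := by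
  rw [setLIntegral_mul_comp_gauge hKc hKb hK0 hp hf hom (hρ.aemeasurable_radialKernel n)
    measurableSet_Iic, inter_comm, Ioi_inter_Iic]
  congr 1
  refine setLIntegral_congr_fun measurableSet_Ioc fun r hr => ?_
  rw [hρ.radialKernel_mul_rpow n hr.1, add_sub_cancel_right]

theorem setLIntegral_outer_radialKernel (hKc : Convex ℝ K) (hKb : Bornology.IsBounded K)
    (hK0 : K ∈ 𝓝 0) (hρ : IsMollifierSeq (finrank ℝ E) p ρ) {δ : ℝ} (hδ : 0 ≤ δ) (n : ℕ) :
    ∫⁻ h in gauge K ⁻¹' Ioi δ, radialKernel p (ρ n) (gauge K h) ∂μ = coneMass μ K 0 (fun _ => 1) *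
      ∫⁻ r in Ioi δ, ENNReal.ofReal (ρ n r * r ^ ((finrank ℝ E : ℝ) - 1 - p)) := by
  have hpolar := setLIntegral_mul_comp_gauge (μ := μ) hKc hKb hK0 le_rfl measurable_const .one
    (hρ.aemeasurable_radialKernel n) (measurableSet_Ioi (a := δ))
  simp only [one_mul, add_zero] at hpolar
  rw [hpolar, inter_eq_left.2 (Ioi_subset_Ioi hδ)]
  congr 1
  exact setLIntegral_congr_fun measurableSet_Ioi fun r hr =>
    hρ.radialKernel_mul_rpow n (hδ.trans_lt hr) _

theorem lintegral_mul_radialKernel_le (hKc : Convex ℝ K) (hKb : Bornology.IsBounded K)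
    (hK0 : K ∈ 𝓝 0) (hρ : IsMollifierSeq (finrank ℝ E) p ρ) (hp : 0 ≤ p) {D F : E → ℝ≥0∞}
    (hF : Measurable F) (hom : IsPosHomogeneous p F) {C : ℝ≥0∞} (hC : C ≠ ⊤) (hDC : ∀ h, D h ≤ C)
    {δ : ℝ} (h0 : 0 < δ) (h1 : δ < 1) (hDF : ∀ h, gauge K h ≤ δ → D h ≤ F h) (n : ℕ) :
    ∫⁻ h, D h * radialKernel p (ρ n) (gauge K h) ∂μ ≤ coneMass μ K p F +
      C * (coneMass μ K 0 (fun _ => 1) *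
        ∫⁻ r in Ioi δ, ENNReal.ofReal (ρ n r * r ^ ((finrank ℝ E : ℝ) - 1 - p))) := by
  have hms : MeasurableSet (gauge K ⁻¹' Iic δ) :=
    (continuous_gauge hKc hK0).measurable measurableSet_Iic
  rw [← lintegral_add_compl _ hms, ← preimage_compl, compl_Iic]
  gcongr
  · calc ∫⁻ h in gauge K ⁻¹' Iic δ, D h * radialKernel p (ρ n) (gauge K h) ∂μ
        ≤ ∫⁻ h in gauge K ⁻¹' Iic δ, F h * radialKernel p (ρ n) (gauge K h) ∂μ :=
          setLIntegral_mono' hms fun h hh => mul_le_mul_left (hDF h hh) _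
      _ ≤ coneMass μ K p F * 1 := by
          rw [setLIntegral_inner_mul_radialKernel hKc hKb hK0 hρ hp hF hom]
          gcongr
          exact hρ.mass_Ioc_le_one h1 n
      _ = coneMass μ K p F := mul_one _
  · calc ∫⁻ h in gauge K ⁻¹' Ioi δ, D h * radialKernel p (ρ n) (gauge K h) ∂μ
        ≤ ∫⁻ h in gauge K ⁻¹' Ioi δ, C * radialKernel p (ρ n) (gauge K h) ∂μ := by
          gcongr
          exact hDC _
      _ = _ := by
          rw [lintegral_const_mul' _ _ hC, setLIntegral_outer_radialKernel hKc hKb hK0 hρ h0.le]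

theorem limsup_lintegral_mul_radialKernel_le (hKc : Convex ℝ K) (hKb : Bornology.IsBounded K)
    (hK0 : K ∈ 𝓝 0) (hρ : IsMollifierSeq (finrank ℝ E) p ρ) (hp : 0 ≤ p) {D F : E → ℝ≥0∞}
    (hF : Measurable F) (hom : IsPosHomogeneous p F) {C : ℝ≥0∞} (hC : C ≠ ⊤) (hDC : ∀ h, D h ≤ C)
    (hDF : ∀ᶠ h in 𝓝 0, D h ≤ F h) :
    limsup (fun n => ∫⁻ h, D h * radialKernel p (ρ n) (gauge K h) ∂μ) atTop ≤ coneMass μ K p F := by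
  obtain ⟨δ, h0, h1, hδ⟩ := exists_gauge_le_imp_of_eventually hKb hK0 hDF
  have hcone : coneMass μ K 0 (fun _ => 1) ≠ ⊤ := by
    simpa using (coneMass_enorm_rpow_lt_top (μ := μ) hKb le_rfl).ne
  have hlim := (ENNReal.Tendsto.const_mul (ENNReal.Tendsto.const_mul (hρ.tail δ h0)
    (Or.inr hcone)) (Or.inr hC)).const_add (coneMass μ K p F)
  rw [mul_zero, mul_zero, add_zero] at hlim
  rw [← hlim.limsup_eq]
  exact limsup_le_limsup (.of_forall
    (lintegral_mul_radialKernel_le hKc hKb hK0 hρ hp hF hom hC hDC h0 h1 hδ))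

theorem coneMass_le_liminf_lintegral_mul_radialKernel (hKc : Convex ℝ K)
    (hKb : Bornology.IsBounded K) (hK0 : K ∈ 𝓝 0) (hρ : IsMollifierSeq (finrank ℝ E) p ρ)
    (hp : 0 ≤ p) {D F : E → ℝ≥0∞} (hF : Measurable F) (hom : IsPosHomogeneous p F)
    (hFD : ∀ᶠ h in 𝓝 0, F h ≤ D h) :
    coneMass μ K p F ≤ liminf (fun n => ∫⁻ h, D h * radialKernel p (ρ n) (gauge K h) ∂μ) atTop := by
  obtain ⟨δ, h0, h1, hδ⟩ := exists_gauge_le_imp_of_eventually hKb hK0 hFD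
  have hlim := ENNReal.Tendsto.const_mul (a := coneMass μ K p F) (hρ.tendsto_mass_Ioc hp h0 h1)
    (Or.inl one_ne_zero)
  rw [mul_one] at hlim
  rw [← hlim.liminf_eq]
  refine liminf_le_liminf (.of_forall fun n => ?_)
  rw [← setLIntegral_inner_mul_radialKernel hKc hKb hK0 hρ hp hF hom]
  refine (setLIntegral_mono' ((continuous_gauge hKc hK0).measurable measurableSet_Iic)
    fun h hh => ?_).trans (setLIntegral_le_lintegral _ _)
  exact mul_le_mul_left (hδ h hh) _

theorem limsup_lintegral_mul_radialKernel_le_add (hKc : Convex ℝ K) (hKb : Bornology.IsBounded K)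
    (hK0 : K ∈ 𝓝 0) (hρ : IsMollifierSeq (finrank ℝ E) p ρ) (hp : 0 ≤ p) {D f : E → ℝ≥0∞}
    (hf : Measurable f) (hom : IsPosHomogeneous p f) {C : ℝ≥0∞} (hC : C ≠ ⊤) (hDC : ∀ h, D h ≤ C)
    {a : ℝ≥0∞} (hDf : ∀ᶠ h in 𝓝 0, D h ≤ f h + a * ‖h‖ₑ ^ p) :
    limsup (fun n => ∫⁻ h, D h * radialKernel p (ρ n) (gauge K h) ∂μ) atTop
      ≤ coneMass μ K p f + a * coneMass μ K p (fun h => ‖h‖ₑ ^ p) := by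
  rw [← coneMass_const_mul p a (by fun_prop), ← coneMass_add p hf]
  exact limsup_lintegral_mul_radialKernel_le hKc hKb hK0 hρ hp (by fun_prop)
    (hom.add ((IsPosHomogeneous.enorm_rpow hp).const_mul a)) hC hDC hDf

theorem coneMass_le_liminf_lintegral_mul_radialKernel_add (hKc : Convex ℝ K)
    (hKb : Bornology.IsBounded K) (hK0 : K ∈ 𝓝 0) (hρ : IsMollifierSeq (finrank ℝ E) p ρ)
    (hp : 0 ≤ p) {D f : E → ℝ≥0∞} (hf : Measurable f) (hom : IsPosHomogeneous p f) {a : ℝ≥0∞}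
    (hfD : ∀ᶠ h in 𝓝 0, f h ≤ D h + a * ‖h‖ₑ ^ p) :
    coneMass μ K p f ≤ liminf (fun n => ∫⁻ h, D h * radialKernel p (ρ n) (gauge K h) ∂μ) atTop
      + a * coneMass μ K p (fun h => ‖h‖ₑ ^ p) := by
  calc coneMass μ K p f ≤ coneMass μ K p (fun h => (f h - a * ‖h‖ₑ ^ p) + a * ‖h‖ₑ ^ p) :=
        coneMass_mono p fun h => le_tsub_add
    _ = coneMass μ K p (fun h => f h - a * ‖h‖ₑ ^ p) + a * coneMass μ K p (fun h => ‖h‖ₑ ^ p) := by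
        rw [coneMass_add p (by fun_prop), coneMass_const_mul p a (by fun_prop)]
    _ ≤ _ := by
        gcongr
        exact coneMass_le_liminf_lintegral_mul_radialKernel hKc hKb hK0 hρ hp (by fun_prop)
          (hom.sub ((IsPosHomogeneous.enorm_rpow hp).const_mul a))
          (hfD.mono fun h hh => tsub_le_iff_right.2 hh)

end RadialLimits

section LpNorms

variable {X Z ε V : Type*} [MeasurableSpace X] [MeasurableSpace Z] [ENorm ε] [NormedAddCommGroup V]
  {μ : Measure X} {κ : Measure Z} {p : ℝ}

theorem lintegral_rpow_le_of_isProbabilityMeasure [IsProbabilityMeasure κ] (hp : 1 ≤ p)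
    {f : Z → ℝ≥0∞} (hf : AEMeasurable f κ) : (∫⁻ z, f z ∂κ) ^ p ≤ ∫⁻ z, f z ^ p ∂κ := by
  have hmono := eLpNorm'_le_eLpNorm'_of_exponent_le one_pos hp κ hf.aestronglyMeasurable
  simp only [eLpNorm', enorm_eq_self, ENNReal.rpow_one, div_one] at hmono
  calc (∫⁻ z, f z ∂κ) ^ p ≤ ((∫⁻ z, f z ^ p ∂κ) ^ (1 / p)) ^ p := by gcongr
    _ = ∫⁻ z, f z ^ p ∂κ := by
      rw [← ENNReal.rpow_mul, one_div_mul_cancel (by positivity), ENNReal.rpow_one]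

theorem eLpNorm_ofReal_rpow (hp : 0 < p) (f : X → ε) :
    eLpNorm f (ENNReal.ofReal p) μ ^ p = ∫⁻ x, ‖f x‖ₑ ^ p ∂μ := by
  rw [eLpNorm_eq_lintegral_rpow_enorm_toReal (by simpa using hp) ENNReal.ofReal_ne_top,
    ENNReal.toReal_ofReal hp.le, ← ENNReal.rpow_mul, one_div_mul_cancel hp.ne', ENNReal.rpow_one]

theorem eLpNorm_const_mul_ennreal (hp : 0 < p) {c : ℝ≥0∞} (hc : c ≠ ⊤) (f : X → ℝ≥0∞) :
    eLpNorm (fun x => c * f x) (ENNReal.ofReal p) μ = c * eLpNorm f (ENNReal.ofReal p) μ := by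
  refine ENNReal.rpow_left_injective hp.ne' ?_
  simp only [ENNReal.mul_rpow_of_nonneg _ _ hp.le, eLpNorm_ofReal_rpow hp, enorm_eq_self]
  exact lintegral_const_mul' _ _ (ENNReal.rpow_ne_top_of_nonneg hp.le hc)

theorem eLpNorm_le_of_enorm_le_lintegral [SFinite μ] [IsProbabilityMeasure κ] (hp : 1 ≤ p)
    {F : X → ε} {H : X → Z → ℝ≥0∞} (hH : AEMeasurable (Function.uncurry H) (μ.prod κ))
    (hF : ∀ᵐ x ∂μ, ‖F x‖ₑ ≤ ∫⁻ z, H x z ∂κ) {M : ℝ≥0∞}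
    (hM : ∀ᵐ z ∂κ, eLpNorm (fun x => H x z) (ENNReal.ofReal p) μ ≤ M) :
    eLpNorm F (ENNReal.ofReal p) μ ≤ M := by
  have hp0 : 0 < p := one_pos.trans_le hp
  rw [← ENNReal.rpow_le_rpow_iff hp0, eLpNorm_ofReal_rpow hp0]
  calc ∫⁻ x, ‖F x‖ₑ ^ p ∂μ ≤ ∫⁻ x, ∫⁻ z, H x z ^ p ∂κ ∂μ := by
        refine lintegral_mono_ae ?_
        filter_upwards [hF, hH.aestronglyMeasurable.prodMk_left] with x hx hx_meas
        exact (ENNReal.rpow_le_rpow hx hp0.le).trans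
          (lintegral_rpow_le_of_isProbabilityMeasure hp hx_meas.aemeasurable)
    _ = ∫⁻ z, ∫⁻ x, H x z ^ p ∂μ ∂κ := lintegral_lintegral_swap (hH.pow_const p)
    _ = ∫⁻ z, eLpNorm (fun x => H x z) (ENNReal.ofReal p) μ ^ p ∂κ := by
        simp only [eLpNorm_ofReal_rpow hp0, enorm_eq_self]
    _ ≤ ∫⁻ _, M ^ p ∂κ :=
        lintegral_mono_ae (hM.mono fun z hz => ENNReal.rpow_le_rpow hz hp0.le)
    _ = M ^ p := by simp

variable {G : Type*} [AddGroup G] [MeasurableSpace G] {ν : Measure G} {f : G → V}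

theorem eLpNorm_comp_add_right [MeasurableAdd G] [ν.IsAddRightInvariant]
    (hf : AEStronglyMeasurable f ν) (q : ℝ≥0∞) (k : G) :
    eLpNorm (fun x => f (x + k)) q ν = eLpNorm f q ν :=
  eLpNorm_comp_measurePreserving hf (measurePreserving_add_right ν k)

theorem eLpNorm_comp_sub_right [MeasurableAdd G] [ν.IsAddRightInvariant]
    (hf : AEStronglyMeasurable f ν) (q : ℝ≥0∞) (k : G) :
    eLpNorm (fun x => f (x - k)) q ν = eLpNorm f q ν := by
  simpa only [sub_eq_add_neg] using eLpNorm_comp_add_right hf q (-k)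

end LpNorms

section Translation

open DomAddAct

variable {G V : Type*} [NormedAddCommGroup G] [MeasurableSpace G] [BorelSpace G]
  [NormedAddCommGroup V] {μ : Measure G} [IsLocallyFiniteMeasure μ] [μ.InnerRegularCompactLTTop]
  [μ.IsAddLeftInvariant]

theorem tendsto_eLpNorm_translate_sub {q : ℝ≥0∞} (hq : 1 ≤ q) (hq_top : q ≠ ⊤) {f : G → V}
    (hf : MemLp f q μ) :
    Tendsto (fun k => eLpNorm (fun x => f (x + k) - f x) q μ) (𝓝 0) (𝓝 0) := by
  have : Fact (1 ≤ q) := ⟨hq⟩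
  have : Fact (q ≠ ⊤) := ⟨hq_top⟩
  have hcont : Continuous fun k : G => edist (mk k +ᵥ hf.toLp f) (hf.toLp f) := by
    have : Continuous (mk : G → Gᵈᵃᵃ) := continuous_mk
    fun_prop
  have hdist : ∀ k : G, edist (mk k +ᵥ hf.toLp f) (hf.toLp f)
      = eLpNorm (fun x => f (x + k) - f x) q μ := fun k => by
    rw [mk_vadd_toLp, Lp.edist_toLp_toLp]
    simp only [vadd_eq_add, add_comm k]
    rfl
  simpa [hdist] using hcont.tendsto 0

end Translation

section Mollification

variable {E V : Type*} [NormedAddCommGroup E] [NormedSpace ℝ E] [FiniteDimensional ℝ E]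
  [MeasureSpace E] [NormedAddCommGroup V] (φ : ContDiffBump (0 : E))

/-- The probability measure with density the normalized bump `φ`. -/
def bumpMeasure : Measure E :=
  (volume : Measure E).withDensity fun z => ENNReal.ofReal (φ.normed volume z)

/-- The mollification of `f` by the normalized bump `φ`. -/
def moll [NormedSpace ℝ V] (f : E → V) : E → V :=
  convolution (φ.normed volume) f (ContinuousLinearMap.lsmul ℝ ℝ) volume

theorem moll_apply [NormedSpace ℝ V] (f : E → V) (x : E) :
    moll φ f x = ∫ z, φ.normed volume z • f (x - z) := rfl

theorem bumpMeasure_absolutelyContinuous : bumpMeasure φ ≪ volume :=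
  withDensity_absolutelyContinuous _ _

variable [BorelSpace E]

theorem measurable_ofReal_normed : Measurable fun z => ENNReal.ofReal (φ.normed volume z) :=
  φ.continuous_normed.measurable.ennreal_ofReal

theorem lintegral_normed_mul (f : E → ℝ≥0∞) :
    ∫⁻ z, ENNReal.ofReal (φ.normed volume z) * f z = ∫⁻ z, f z ∂bumpMeasure φ := by
  rw [bumpMeasure, lintegral_withDensity_eq_lintegral_mul_non_measurable _
    (measurable_ofReal_normed φ) (by simp)]
  rfl

theorem enorm_integral_normed_smul_le [NormedSpace ℝ V] (f : E → V) :
    ‖∫ z, φ.normed volume z • f z‖ₑ ≤ ∫⁻ z, ‖f z‖ₑ ∂bumpMeasure φ := by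
  refine (enorm_integral_le_lintegral_enorm _).trans ?_
  rw [← lintegral_normed_mul]
  gcongr with z
  rw [enorm_smul, Real.enorm_of_nonneg (φ.nonneg_normed z)]

variable [(volume : Measure E).IsAddHaarMeasure]

instance : IsProbabilityMeasure (bumpMeasure φ) := by
  constructor
  rw [bumpMeasure, withDensity_apply _ .univ, Measure.restrict_univ,
    ← ofReal_integral_eq_lintegral_ofReal φ.integrable_normed (.of_forall φ.nonneg_normed),
    φ.integral_normed, ENNReal.ofReal_one]

theorem ae_bumpMeasure_norm_lt : ∀ᵐ z ∂bumpMeasure φ, ‖z‖ < φ.rOut := by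
  rw [bumpMeasure, ae_withDensity_iff (measurable_ofReal_normed φ)]
  refine .of_forall fun z hz => ?_
  have hsupp : z ∈ Function.support (φ.normed volume) := fun h => by simp [h] at hz
  rw [φ.support_normed_eq] at hsupp
  simpa using hsupp

/-- The mollification of `‖f‖`. -/
def eMoll (f : E → V) (x : E) : ℝ≥0∞ :=
  ∫⁻ z, ‖f (x - z)‖ₑ ∂bumpMeasure φ

theorem aestronglyMeasurable_comp_sub_prod_bumpMeasure {f : E → V}
    (hf : AEStronglyMeasurable f volume) :
    AEStronglyMeasurable (fun q : E × E => f (q.1 - q.2))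
      ((volume : Measure E).prod (bumpMeasure φ)) :=
  (hf.comp_quasiMeasurePreserving (quasiMeasurePreserving_sub volume volume)).mono_ac
    (Measure.AbsolutelyContinuous.rfl.prod (bumpMeasure_absolutelyContinuous φ))

theorem measurable_eMoll {f : E → V} (hf : StronglyMeasurable f) : Measurable (eMoll φ f) := by
  have : Measurable fun q : E × E => ‖f (q.1 - q.2)‖ₑ :=
    (hf.comp_measurable measurable_sub).enorm
  exact this.lintegral_prod_right'

variable {p : ℝ}

theorem eLpNorm_eMoll_le (hp : 1 ≤ p) {f : E → V} (hf : AEStronglyMeasurable f volume) :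
    eLpNorm (eMoll φ f) (ENNReal.ofReal p) volume ≤ eLpNorm f (ENNReal.ofReal p) volume := by
  refine eLpNorm_le_of_enorm_le_lintegral hp
    (aestronglyMeasurable_comp_sub_prod_bumpMeasure φ hf).enorm
    (.of_forall fun x => le_rfl) (.of_forall fun z => ?_)
  rw [eLpNorm_enorm, eLpNorm_comp_sub_right hf]

variable [NormedSpace ℝ V]

theorem moll_apply_swap (f : E → V) (x : E) :
    moll φ f x = ∫ y, φ.normed volume (x - y) • f y := by
  rw [moll, convolution_eq_swap]
  rfl

theorem eLpNorm_moll_le (hp : 1 ≤ p) {f : E → V} (hf : AEStronglyMeasurable f volume) :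
    eLpNorm (moll φ f) (ENNReal.ofReal p) volume ≤ eLpNorm f (ENNReal.ofReal p) volume :=
  (eLpNorm_mono_enorm fun _ => enorm_integral_normed_smul_le φ _).trans (eLpNorm_eMoll_le φ hp hf)

section LocallyIntegrable

variable {f : E → V}

theorem integrable_normed_smul (hf : LocallyIntegrable f volume) (x : E) :
    Integrable fun z => φ.normed volume z • f (x - z) :=
  (φ.hasCompactSupport_normed.convolutionExists_left (ContinuousLinearMap.lsmul ℝ ℝ)
    φ.continuous_normed hf) x

theorem contDiff_moll (hf : LocallyIntegrable f volume) (n : ℕ∞) : ContDiff ℝ n (moll φ f) :=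
  φ.hasCompactSupport_normed.contDiff_convolution_left _ φ.contDiff_normed hf

theorem continuous_moll (hf : LocallyIntegrable f volume) : Continuous (moll φ f) :=
  (contDiff_moll φ hf 0).continuous

theorem fderiv_moll (hf : LocallyIntegrable f volume) (x h : E) :
    fderiv ℝ (moll φ f) x h = ∫ y, fderiv ℝ (φ.normed volume) (x - y) h • f y := by
  have hderiv := φ.hasCompactSupport_normed (μ := volume) |>.hasFDerivAt_convolution_left
    (ContinuousLinearMap.lsmul ℝ ℝ) (φ.contDiff_normed (n := 1)) hf x
  have hexists := φ.hasCompactSupport_normed (μ := volume) |>.fderiv (𝕜 := ℝ)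
    |>.convolutionExists_left ((ContinuousLinearMap.lsmul ℝ ℝ).precompL E : _ →L[ℝ] V →L[ℝ] _)
      ((φ.contDiff_normed (μ := volume) (n := 1)).continuous_fderiv (by simp)) hf x
  rw [show fderiv ℝ (moll φ f) x = _ from hderiv.fderiv, convolution_eq_swap,
    ContinuousLinearMap.integral_apply hexists.integrable_swap]
  rfl

variable [CompleteSpace V]

theorem moll_sub_eq (hf : LocallyIntegrable f volume) (x : E) (v : V) :
    moll φ f x - v = ∫ z, φ.normed volume z • (f (x - z) - v) := by
  rw [moll_apply]
  simp_rw [smul_sub]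
  rw [integral_sub (integrable_normed_smul φ hf x) (φ.integrable_normed.smul_const v),
    φ.integral_normed_smul]

theorem eLpNorm_moll_sub_le (hf : LocallyIntegrable f volume) (hp : 1 ≤ p) {M : ℝ≥0∞}
    (hM : ∀ k : E, ‖k‖ < φ.rOut →
      eLpNorm (fun x => f (x + k) - f x) (ENNReal.ofReal p) volume ≤ M) :
    eLpNorm (fun x => moll φ f x - f x) (ENNReal.ofReal p) volume ≤ M := by
  refine eLpNorm_le_of_enorm_le_lintegral (κ := bumpMeasure φ) hp
    (H := fun x z => ‖f (x - z) - f x‖ₑ) ?_ (.of_forall fun x => ?_) ?_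
  · exact ((aestronglyMeasurable_comp_sub_prod_bumpMeasure φ hf.aestronglyMeasurable).sub
      hf.aestronglyMeasurable.comp_fst).enorm
  · rw [moll_sub_eq φ hf]
    exact enorm_integral_normed_smul_le φ _
  · filter_upwards [ae_bumpMeasure_norm_lt φ] with z hz
    rw [eLpNorm_enorm]
    simpa only [sub_eq_add_neg] using hM (-z) (by rwa [norm_neg])

end LocallyIntegrable

end Mollification

section Dot

variable {N : ℕ}

/-- The pairing `v ↦ v · h` as a continuous linear map on `ℂ^N`. -/
def cdotCLM (h : RN N) : CN N →L[ℝ] ℂ :=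
  (∑ j, (h j : ℂ) • (EuclideanSpace.proj j : CN N →L[ℂ] ℂ)).restrictScalars ℝ

@[simp]
theorem cdotCLM_apply (h : RN N) (v : CN N) : cdotCLM h v = cdot v h := by
  simp [cdotCLM, cdot, mul_comm]

theorem norm_toCN (h : RN N) : ‖toCN h‖ = ‖h‖ := by
  simp [toCN, EuclideanSpace.norm_eq]

theorem cdot_eq_inner (v : CN N) (h : RN N) : cdot v h = inner ℂ (toCN h) v := by
  simp [cdot, toCN, PiLp.inner_apply]

theorem norm_cdot_le (v : CN N) (h : RN N) : ‖cdot v h‖ ≤ ‖h‖ * ‖v‖ := by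
  rw [cdot_eq_inner, ← norm_toCN h]
  exact norm_inner_le_norm _ _

theorem enorm_cdot_le (v : CN N) (h : RN N) : ‖cdot v h‖ₑ ≤ ‖h‖ₑ * ‖v‖ₑ := by
  simp only [← ofReal_norm, ← ENNReal.ofReal_mul (norm_nonneg h)]
  exact ENNReal.ofReal_le_ofReal (norm_cdot_le v h)

theorem cdot_sub_left (v w : CN N) (h : RN N) : cdot (v - w) h = cdot v h - cdot w h := by
  simp [← cdotCLM_apply]

theorem cdot_smul_right (v : CN N) (t : ℝ) (h : RN N) : cdot v (t • h) = t * cdot v h := by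
  simp [cdot, Finset.mul_sum, mul_left_comm]

theorem cdot_toCN (a h : RN N) : cdot (toCN a) h = ((inner ℝ h a : ℝ) : ℂ) := by
  simp [cdot, toCN, PiLp.inner_apply]

theorem continuous_cdot : Continuous fun q : CN N × RN N => cdot q.1 q.2 := by
  unfold cdot
  fun_prop

theorem continuous_toCN : Continuous (toCN : RN N → CN N) := by
  unfold toCN
  fun_prop

end Dot

section MagneticShift

variable {N : ℕ} {A : RN N → RN N} {u : RN N → ℂ}

/-- The phase `h · A(x + h/2)` by which the potential `A` twists the translation by `h` at `x`. -/
def magPhase (A : RN N → RN N) (h x : RN N) : ℝ := inner ℝ h (A (x + (2 : ℝ)⁻¹ • h))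

/-- The magnetic translate `x ↦ exp(-i h · A(x + h/2)) u(x + h)`, which is `Ψ_u(x, x + h)`. -/
def magShift (A : RN N → RN N) (h : RN N) (u : RN N → ℂ) (x : RN N) : ℂ :=
  Complex.exp (((-magPhase A h x : ℝ) : ℂ) * Complex.I) * u (x + h)

theorem Psi_add_eq_magShift (A : RN N → RN N) (u : RN N → ℂ) (x h : RN N) :
    Psi A u x (x + h) = magShift A h u x := by
  have hmid : (2 : ℝ)⁻¹ • (x + (x + h)) = x + (2 : ℝ)⁻¹ • h := by module
  simp only [Psi, magShift, magPhase, hmid, sub_add_cancel_left, inner_neg_left]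
  rw [mul_comm Complex.I]

theorem Psi_self (A : RN N → RN N) (u : RN N → ℂ) (x : RN N) : Psi A u x x = u x := by
  simp [Psi]

theorem continuous_magPhase (hA : Continuous A) (h : RN N) : Continuous (magPhase A h) := by
  unfold magPhase
  fun_prop

theorem enorm_exp_mul_I (s : ℝ) : ‖Complex.exp ((s : ℂ) * Complex.I)‖ₑ = 1 := by
  rw [← ofReal_norm, Complex.norm_exp_ofReal_mul_I, ENNReal.ofReal_one]

theorem eLpNorm_magShift (hu : AEStronglyMeasurable u volume) (q : ℝ≥0∞) (h : RN N) :
    eLpNorm (magShift A h u) q volume = eLpNorm u q volume := by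
  rw [← eLpNorm_comp_add_right hu q h]
  refine eLpNorm_congr_enorm_ae (.of_forall fun x => ?_)
  simp only [magShift, enorm_mul, enorm_exp_mul_I, one_mul]

/-- The size `min(2, |h · A(x + h/2)|)` of the magnetic phase, which bounds the distance of the
phase factor to `1`. -/
def phaseSize (A : RN N → RN N) (h x : RN N) : ℝ≥0∞ := ENNReal.ofReal (min 2 |magPhase A h x|)

theorem phaseSize_le_two (A : RN N → RN N) (h x : RN N) : phaseSize A h x ≤ 2 :=
  (ENNReal.ofReal_le_ofReal (min_le_left _ _)).trans_eq (ENNReal.ofReal_ofNat 2)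

theorem measurable_phaseSize (hA : Continuous A) (h : RN N) : Measurable (phaseSize A h) := by
  have := continuous_magPhase hA h
  unfold phaseSize
  fun_prop

theorem tendsto_phaseSize_zero (hA : Continuous A) (x : RN N) :
    Tendsto (fun h => phaseSize A h x) (𝓝 0) (𝓝 0) := by
  have hcont : Continuous fun h : RN N => phaseSize A h x := by
    unfold phaseSize magPhase
    exact ENNReal.continuous_ofReal.comp (by fun_prop)
  simpa [phaseSize, magPhase] using hcont.tendsto 0

theorem norm_exp_mul_I_sub_one_le (s : ℝ) :
    ‖Complex.exp ((s : ℂ) * Complex.I) - 1‖ ≤ min 2 |s| := by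
  refine le_min ((norm_sub_le _ _).trans ?_) ?_
  · rw [Complex.norm_exp_ofReal_mul_I, norm_one, one_add_one_eq_two]
  · simpa only [mul_comm, Real.norm_eq_abs] using Real.norm_exp_I_mul_ofReal_sub_one_le (x := s)

theorem enorm_exp_magPhase_sub_one_le (h x : RN N) {t : ℝ} (ht : t ∈ Icc (0 : ℝ) 1) :
    ‖Complex.exp (((-(t * magPhase A h x) : ℝ) : ℂ) * Complex.I) - 1‖ₑ ≤ phaseSize A h x := by
  rw [← ofReal_norm]
  refine ENNReal.ofReal_le_ofReal ((norm_exp_mul_I_sub_one_le _).trans ?_)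
  rw [abs_neg, abs_mul, abs_of_nonneg ht.1]
  gcongr
  exact mul_le_of_le_one_left (abs_nonneg _) ht.2

theorem tendsto_eLpNorm_phaseSize_mul {V : Type*} [NormedAddCommGroup V] {p : ℝ} (hp : 0 < p)
    (hA : Continuous A) {G : RN N → V} (hG : MemLp G (ENNReal.ofReal p) volume) :
    Tendsto (fun h => eLpNorm (fun x => phaseSize A h x * ‖G x‖ₑ) (ENNReal.ofReal p) volume)
      (𝓝 0) (𝓝 0) := by
  have hpow : Tendsto (fun h : RN N => ∫⁻ x, (phaseSize A h x * ‖G x‖ₑ) ^ p) (𝓝 0)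
      (𝓝 (∫⁻ _ : RN N, 0)) := by
    refine tendsto_lintegral_filter_of_dominated_convergence' (fun x => (2 * ‖G x‖ₑ) ^ p)
      (.of_forall fun h => ?_) (.of_forall fun h => .of_forall fun x => ?_) ?_
      (.of_forall fun x => ?_)
    · exact ((measurable_phaseSize hA h).aemeasurable.mul hG.1.enorm).pow_const p
    · gcongr
      exact phaseSize_le_two A h x
    · simp_rw [ENNReal.mul_rpow_of_nonneg _ _ hp.le]
      rw [lintegral_const_mul' _ _ (by simp), ← eLpNorm_ofReal_rpow hp]
      exact ENNReal.mul_ne_top (by simp) (ENNReal.rpow_ne_top_of_nonneg hp.le hG.2.ne)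
    · simpa [ENNReal.zero_rpow_of_pos hp] using
        (ENNReal.Tendsto.mul_const (tendsto_phaseSize_zero hA x)
          (.inr (enorm_ne_top (x := G x)))).ennrpow_const p
  have heq : ∀ h, (∫⁻ x, (phaseSize A h x * ‖G x‖ₑ) ^ p) ^ p⁻¹
      = eLpNorm (fun x => phaseSize A h x * ‖G x‖ₑ) (ENNReal.ofReal p) volume := fun h => by
    rw [← ENNReal.rpow_rpow_inv hp.ne' (eLpNorm _ _ _), eLpNorm_ofReal_rpow hp]
    simp only [enorm_eq_self]
  simpa only [heq, lintegral_zero, ENNReal.zero_rpow_of_pos (inv_pos.2 hp)] using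
    hpow.ennrpow_const p⁻¹

theorem abs_inner_sub_magPhase_le {L : NNReal} (hA : LipschitzWith L A) (h x z : RN N) {t : ℝ}
    (ht : t ∈ Icc (0 : ℝ) 1) :
    |inner ℝ h (A (x + t • h - z)) - magPhase A h x| ≤ ‖h‖ * L * (‖z‖ + ‖h‖) := by
  have ht2 : ‖t - 2⁻¹‖ ≤ 1 := by
    rw [Real.norm_eq_abs, abs_le]
    constructor <;> linarith [ht.1, ht.2]
  have hdist : ‖x + t • h - z - (x + (2 : ℝ)⁻¹ • h)‖ ≤ ‖z‖ + ‖h‖ :=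
    calc ‖x + t • h - z - (x + (2 : ℝ)⁻¹ • h)‖ = ‖(t - 2⁻¹) • h - z‖ := by congr 1; module
      _ ≤ ‖t - 2⁻¹‖ * ‖h‖ + ‖z‖ := (norm_sub_le _ _).trans_eq (by rw [norm_smul])
      _ ≤ 1 * ‖h‖ + ‖z‖ := by gcongr
      _ = ‖z‖ + ‖h‖ := by ring
  calc |inner ℝ h (A (x + t • h - z)) - magPhase A h x|
      ≤ ‖h‖ * ‖A (x + t • h - z) - A (x + (2 : ℝ)⁻¹ • h)‖ := by
        rw [magPhase, ← inner_sub_right]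
        exact abs_real_inner_le_norm _ _
    _ ≤ ‖h‖ * (L * (‖z‖ + ‖h‖)) := by
        gcongr
        exact (hA.norm_sub_le _ _).trans (by gcongr)
    _ = ‖h‖ * L * (‖z‖ + ‖h‖) := (mul_assoc _ _ _).symm

end MagneticShift

section MagneticGradient

variable {N : ℕ} {A : RN N → RN N} {u : RN N → ℂ} (φ : ContDiffBump (0 : RN N))

/-- The mollified magnetic gradient `∇(φ * u) - i φ * (A u)`. -/
def magGrad (A : RN N → RN N) (u : RN N → ℂ) (y : RN N) : CN N :=
  WithLp.toLp 2 fun j => fderiv ℝ (moll φ u) y (EuclideanSpace.single j (1 : ℝ))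
    - Complex.I * moll φ (fun z => (A z j : ℂ) * u z) y

/-- The mollification of `(h · A - c) u`, i.e. the error made when the potential along `h` is
frozen at the value `c`. -/
def mollPhaseDefect (A : RN N → RN N) (u : RN N → ℂ) (h : RN N) (c : ℝ) : RN N → ℂ :=
  moll φ fun z => ((inner ℝ h (A z) - c : ℝ) : ℂ) * u z

theorem locallyIntegrable_ofReal_mul {f : RN N → ℝ} (hf : Continuous f)
    (hu : LocallyIntegrable u volume) : LocallyIntegrable (fun z => (f z : ℂ) * u z) volume :=
  hu.continuous_mul (Complex.continuous_ofReal.comp hf)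

theorem moll_inner_mul_eq_sum (hA : Continuous A) (hu : LocallyIntegrable u volume) (h y : RN N) :
    moll φ (fun z => ((inner ℝ h (A z) : ℝ) : ℂ) * u z) y
      = ∑ j, (h j : ℂ) * moll φ (fun z => (A z j : ℂ) * u z) y := by
  simp only [moll_apply, ← integral_const_mul]
  rw [← integral_finsetSum _ fun j _ => ((integrable_normed_smul φ
    (locallyIntegrable_ofReal_mul (f := fun z => A z j) (by fun_prop) hu) y).const_mul _)]
  congr 1 with z
  simp only [PiLp.inner_apply, Real.inner_apply, Complex.real_smul, Complex.ofReal_sum,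
    Complex.ofReal_mul, Finset.sum_mul, Finset.mul_sum]
  exact Finset.sum_congr rfl fun j _ => by ring

theorem fderiv_moll_eq_cdot_magGrad (hA : Continuous A) (hu : LocallyIntegrable u volume)
    (y h : RN N) :
    fderiv ℝ (moll φ u) y h = cdot (magGrad φ A u y) h
      + Complex.I * moll φ (fun z => ((inner ℝ h (A z) : ℝ) : ℂ) * u z) y := by
  have hh : h = ∑ j, h j • EuclideanSpace.single j (1 : ℝ) := by
    ext i
    simp [Finset.sum_apply, Pi.single_apply]
  rw [moll_inner_mul_eq_sum φ hA hu]
  conv_lhs => rw [hh]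
  simp only [map_sum, map_smul, cdot, magGrad, Finset.mul_sum, ← Finset.sum_add_distrib,
    Complex.real_smul]
  exact Finset.sum_congr rfl fun j _ => by ring

theorem continuous_magGrad (hA : Continuous A) (hu : LocallyIntegrable u volume) :
    Continuous (magGrad φ A u) := by
  refine (PiLp.continuous_toLp 2 _).comp (continuous_pi fun j => .sub ?_ ?_)
  · exact ((contDiff_moll φ hu 1).continuous_fderiv (by simp)).clm_apply continuous_const
  · exact continuous_const.mul
      (continuous_moll φ (locallyIntegrable_ofReal_mul (by fun_prop) hu))

theorem continuous_mollPhaseDefect (hA : Continuous A) (hu : LocallyIntegrable u volume)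
    (h : RN N) (c : ℝ) : Continuous (mollPhaseDefect φ A u h c) :=
  continuous_moll φ (locallyIntegrable_ofReal_mul (by fun_prop) hu)

theorem mollPhaseDefect_eq (hA : Continuous A) (hu : LocallyIntegrable u volume) (h : RN N) (c : ℝ)
    (y : RN N) :
    mollPhaseDefect φ A u h c y
      = moll φ (fun z => ((inner ℝ h (A z) : ℝ) : ℂ) * u z) y - c * moll φ u y := by
  simp only [mollPhaseDefect, moll_apply]
  rw [← integral_const_mul, ← integral_sub (integrable_normed_smul φ
    (locallyIntegrable_ofReal_mul (f := fun z => inner ℝ h (A z)) (by fun_prop) hu) y)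
    ((integrable_normed_smul φ hu y).const_mul _)]
  congr 1 with z
  simp only [Complex.real_smul]
  push_cast
  ring

theorem enorm_mollPhaseDefect_le {L : NNReal} (hA : LipschitzWith L A) (u : RN N → ℂ)
    (h x : RN N) {t : ℝ} (ht : t ∈ Icc (0 : ℝ) 1) :
    ‖mollPhaseDefect φ A u h (magPhase A h x) (x + t • h)‖ₑ
      ≤ ENNReal.ofReal (‖h‖ * L * (φ.rOut + ‖h‖)) * eMoll φ u (x + t • h) := by
  refine (enorm_integral_normed_smul_le φ _).trans ?_
  rw [eMoll, ← lintegral_const_mul' _ _ ENNReal.ofReal_ne_top]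
  refine lintegral_mono_ae ?_
  filter_upwards [ae_bumpMeasure_norm_lt φ] with z hz
  rw [enorm_mul, ← ofReal_norm, Complex.norm_real, Real.norm_eq_abs]
  gcongr
  exact (abs_inner_sub_magPhase_le hA h x z ht).trans (by gcongr)

theorem hasDerivAt_exp_mul_moll (hA : Continuous A) (hu : LocallyIntegrable u volume)
    (h x : RN N) (c t : ℝ) :
    HasDerivAt (fun t : ℝ => Complex.exp (((-(t * c) : ℝ) : ℂ) * Complex.I) * moll φ u (x + t • h))
      (Complex.exp (((-(t * c) : ℝ) : ℂ) * Complex.I) * (cdot (magGrad φ A u (x + t • h)) h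
        + Complex.I * mollPhaseDefect φ A u h c (x + t • h))) t := by
  have hexp := (((hasDerivAt_id t).mul_const c).neg.ofReal_comp.mul_const Complex.I).cexp
  have hline : HasDerivAt (fun t : ℝ => x + t • h) h t := by
    simpa using ((hasDerivAt_id t).smul_const h).const_add x
  have hmoll := ((contDiff_moll φ hu 1).differentiable (by simp) _).hasFDerivAt.comp_hasDerivAt t
    hline
  refine (hexp.mul hmoll).congr_deriv ?_
  rw [fderiv_moll_eq_cdot_magGrad φ hA hu, mollPhaseDefect_eq φ hA hu]
  simp only [Function.comp_apply, id_eq, Pi.neg_apply]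
  push_cast
  ring

theorem magShift_moll_sub_eq_integral (hA : Continuous A) (hu : LocallyIntegrable u volume)
    (h x : RN N) :
    magShift A h (moll φ u) x - moll φ u x = ∫ t in Ioc (0 : ℝ) 1,
      Complex.exp (((-(t * magPhase A h x) : ℝ) : ℂ) * Complex.I) *
        (cdot (magGrad φ A u (x + t • h)) h
          + Complex.I * mollPhaseDefect φ A u h (magPhase A h x) (x + t • h)) := by
  have hcdot : Continuous fun t : ℝ => cdot (magGrad φ A u (x + t • h)) h :=
    continuous_cdot.comp (((continuous_magGrad φ hA hu).comp (by fun_prop)).prodMk continuous_const)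
  have hdefect := continuous_mollPhaseDefect φ hA hu h (magPhase A h x)
  rw [← intervalIntegral.integral_of_le zero_le_one, intervalIntegral.integral_eq_sub_of_hasDerivAt
    (fun t _ => hasDerivAt_exp_mul_moll φ hA hu h x _ t)
    (Continuous.intervalIntegrable (by fun_prop) _ _)]
  simp [magShift]

end MagneticGradient

section ShrinkingBumps

/-- A sequence of bumps with outer radii `1 / (k + 1)`, used as an approximate identity. -/
def shrinkingBump (E : Type*) [NormedAddCommGroup E] (k : ℕ) : ContDiffBump (0 : E) where
  rIn := 1 / (2 * ((k : ℝ) + 1))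
  rOut := 1 / ((k : ℝ) + 1)
  rIn_pos := by positivity
  rIn_lt_rOut := by gcongr; linarith

theorem tendsto_rOut_shrinkingBump (E : Type*) [NormedAddCommGroup E] :
    Tendsto (fun k => (shrinkingBump E k).rOut) atTop (𝓝 0) :=
  tendsto_one_div_add_atTop_nhds_zero_nat

variable {E V : Type*} [NormedAddCommGroup E] [NormedSpace ℝ E] [FiniteDimensional ℝ E]
  [MeasureSpace E] [NormedAddCommGroup V]

theorem moll_comp_add_right [NormedSpace ℝ V] (φ : ContDiffBump (0 : E)) (f : E → V) (k x : E) :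
    moll φ (fun y => f (y + k)) x = moll φ f (x + k) := by
  simp only [moll_apply, sub_add_eq_add_sub]

variable [BorelSpace E] [(volume : Measure E).IsAddHaarMeasure] {p : ℝ} {f : E → V}

theorem measurable_eMoll_comp_add (φ : ContDiffBump (0 : E)) (hf : StronglyMeasurable f) (k : E) :
    Measurable fun x => eMoll φ f (x + k) :=
  (measurable_eMoll φ hf).comp (measurable_add_const k)

theorem eLpNorm_eMoll_comp_add_le (φ : ContDiffBump (0 : E)) (hp : 1 ≤ p)
    (hf : StronglyMeasurable f) (k : E) :
    eLpNorm (fun x => eMoll φ f (x + k)) (ENNReal.ofReal p) volume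
      ≤ eLpNorm f (ENNReal.ofReal p) volume :=
  (eLpNorm_comp_measurePreserving (measurable_eMoll φ hf).aestronglyMeasurable
    (measurePreserving_add_right volume k)).trans_le
    (eLpNorm_eMoll_le φ hp hf.aestronglyMeasurable)

variable [NormedSpace ℝ V]

theorem moll_sub (φ : ContDiffBump (0 : E)) {f g : E → V} (hf : LocallyIntegrable f volume)
    (hg : LocallyIntegrable g volume) (x : E) :
    moll φ (fun y => f y - g y) x = moll φ f x - moll φ g x := by
  simp only [moll_apply, smul_sub]
  exact integral_sub (integrable_normed_smul φ hf x) (integrable_normed_smul φ hg x)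

theorem eLpNorm_moll_translate_sub_le (φ : ContDiffBump (0 : E)) (hp : 1 ≤ p)
    (hf : MemLp f (ENNReal.ofReal p) volume) (k : E) :
    eLpNorm (fun x => moll φ f (x + k) - moll φ f x) (ENNReal.ofReal p) volume
      ≤ eLpNorm (fun x => f (x + k) - f x) (ENNReal.ofReal p) volume := by
  have hq : 1 ≤ ENNReal.ofReal p := by simpa using hp
  have hfk : MemLp (fun x => f (x + k)) (ENNReal.ofReal p) volume :=
    hf.comp_measurePreserving (measurePreserving_add_right volume k)
  have hmoll : (fun x => moll φ f (x + k) - moll φ f x) = moll φ (fun y => f (y + k) - f y) := by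
    ext x
    rw [moll_sub φ (hfk.locallyIntegrable hq) (hf.locallyIntegrable hq), moll_comp_add_right]
  rw [hmoll]
  exact eLpNorm_moll_le φ hp (hfk.1.sub hf.1)

theorem tendsto_eLpNorm_moll_sub [CompleteSpace V] {ι : Type*} {l : Filter ι}
    {φ : ι → ContDiffBump (0 : E)} (hφ : Tendsto (fun i => (φ i).rOut) l (𝓝 0)) (hp : 1 ≤ p)
    (hf : MemLp f (ENNReal.ofReal p) volume) :
    Tendsto (fun i => eLpNorm (fun x => moll (φ i) f x - f x) (ENNReal.ofReal p) volume) l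
      (𝓝 0) := by
  have hq : 1 ≤ ENNReal.ofReal p := by simpa using hp
  refine ENNReal.tendsto_nhds_zero.2 fun ε hε => ?_
  obtain ⟨δ, hδ, hclose⟩ := Metric.eventually_nhds_iff.1
    (ENNReal.tendsto_nhds_zero.1 (tendsto_eLpNorm_translate_sub hq ENNReal.ofReal_ne_top hf) ε hε)
  filter_upwards [hφ.eventually_lt_const hδ] with i hi
  exact eLpNorm_moll_sub_le _ (hf.locallyIntegrable hq) hp fun k hk =>
    hclose (by simpa using hk.trans hi)

end ShrinkingBumps

theorem eventually_forall_smul_of_eventually {V : Type*} [NormedAddCommGroup V] [NormedSpace ℝ V]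
    {P : V → Prop} (hP : ∀ᶠ v in 𝓝 0, P v) : ∀ᶠ v in 𝓝 0, ∀ t ∈ Ioc (0 : ℝ) 1, P (t • v) := by
  obtain ⟨δ, hδ, hball⟩ := Metric.eventually_nhds_iff.1 hP
  refine Metric.eventually_nhds_iff.2 ⟨δ, hδ, fun v hv t ht => hball ?_⟩
  rw [dist_zero_right] at hv ⊢
  rw [norm_smul, Real.norm_of_nonneg ht.1.le]
  exact (mul_le_of_le_one_left (norm_nonneg v) ht.2).trans_lt hv

section Remainder

variable {N : ℕ} {A : RN N → RN N} {u : RN N → ℂ} {G : RN N → CN N} {p : ℝ}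

/-- The remainder `x ↦ Ψ_u(x, x + h) - u(x) - G(x) · h` of the first-order expansion of the
magnetic shift with candidate gradient `G`. -/
def magRemainder (A : RN N → RN N) (u : RN N → ℂ) (G : RN N → CN N) (h x : RN N) : ℂ :=
  magShift A h u x - u x - cdot (G x) h

theorem enorm_exp_mul_sub_cdot_le (φ : ContDiffBump (0 : RN N)) {L : NNReal}
    (hA : LipschitzWith L A) (u : RN N → ℂ) (h x : RN N) {t : ℝ} (ht : t ∈ Icc (0 : ℝ) 1) :
    ‖Complex.exp (((-(t * magPhase A h x) : ℝ) : ℂ) * Complex.I) *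
        (cdot (magGrad φ A u (x + t • h)) h
          + Complex.I * mollPhaseDefect φ A u h (magPhase A h x) (x + t • h))
        - cdot (magGrad φ A u x) h‖ₑ ≤
      ‖h‖ₑ * ‖magGrad φ A u (x + t • h) - magGrad φ A u x‖ₑ
        + ENNReal.ofReal (‖h‖ * L * (φ.rOut + ‖h‖)) * eMoll φ u (x + t • h)
        + ‖h‖ₑ * (phaseSize A h x * ‖magGrad φ A u x‖ₑ) := by
  set e := Complex.exp (((-(t * magPhase A h x) : ℝ) : ℂ) * Complex.I)
  set d := mollPhaseDefect φ A u h (magPhase A h x) (x + t • h)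
  have hsplit : e * (cdot (magGrad φ A u (x + t • h)) h + Complex.I * d)
        - cdot (magGrad φ A u x) h
      = e * (cdot (magGrad φ A u (x + t • h) - magGrad φ A u x) h + Complex.I * d)
        + (e - 1) * cdot (magGrad φ A u x) h := by
    rw [cdot_sub_left]
    ring
  have hI : ‖Complex.I * d‖ₑ = ‖d‖ₑ := by simp [← ofReal_norm]
  rw [hsplit]
  refine (enorm_add_le _ _).trans (add_le_add ?_ ?_)
  · rw [enorm_mul, enorm_exp_mul_I, one_mul]
    exact (enorm_add_le _ _).trans (add_le_add (enorm_cdot_le _ _)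
      (hI.trans_le (enorm_mollPhaseDefect_le φ hA u h x ht)))
  · rw [enorm_mul, mul_left_comm]
    gcongr
    · exact enorm_exp_magPhase_sub_one_le h x ht
    · exact enorm_cdot_le _ _

theorem enorm_magRemainder_moll_le (φ : ContDiffBump (0 : RN N)) {L : NNReal}
    (hA : LipschitzWith L A) (hu : LocallyIntegrable u volume) (h x : RN N) :
    ‖magRemainder A (moll φ u) (magGrad φ A u) h x‖ₑ ≤ ∫⁻ t in Ioc (0 : ℝ) 1,
      (‖h‖ₑ * ‖magGrad φ A u (x + t • h) - magGrad φ A u x‖ₑ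
        + ENNReal.ofReal (‖h‖ * L * (φ.rOut + ‖h‖)) * eMoll φ u (x + t • h)
        + ‖h‖ₑ * (phaseSize A h x * ‖magGrad φ A u x‖ₑ)) := by
  have hcdot : Continuous fun t : ℝ => cdot (magGrad φ A u (x + t • h)) h :=
    continuous_cdot.comp (((continuous_magGrad φ hA.continuous hu).comp (by fun_prop)).prodMk
      continuous_const)
  have hdefect := continuous_mollPhaseDefect φ hA.continuous hu h (magPhase A h x)
  have hconst : cdot (magGrad φ A u x) h = ∫ _ in Ioc (0 : ℝ) 1, cdot (magGrad φ A u x) h := by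
    simp
  rw [magRemainder, magShift_moll_sub_eq_integral φ hA.continuous hu, hconst, ← integral_sub
    ((Continuous.integrableOn_Icc (by fun_prop)).mono_set Ioc_subset_Icc_self) (by simp)]
  exact (enorm_integral_le_lintegral_enorm _).trans (setLIntegral_mono' measurableSet_Ioc
    fun t ht => enorm_exp_mul_sub_cdot_le φ hA u h x (Ioc_subset_Icc_self ht))

instance : IsProbabilityMeasure ((volume : Measure ℝ).restrict (Ioc 0 1)) := ⟨by simp⟩

theorem eLpNorm_add_const_mul_le {X : Type*} [MeasurableSpace X] {μ : Measure X} (hp : 1 ≤ p)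
    {F H : X → ℝ≥0∞} (hF : Measurable F) (hH : Measurable H) {c : ℝ≥0∞} (hc : c ≠ ⊤)
    {m M : ℝ≥0∞} (hm : eLpNorm F (ENNReal.ofReal p) μ ≤ m)
    (hM : eLpNorm H (ENNReal.ofReal p) μ ≤ M) :
    eLpNorm (fun x => F x + c * H x) (ENNReal.ofReal p) μ ≤ m + c * M :=
  calc eLpNorm (fun x => F x + c * H x) (ENNReal.ofReal p) μ
      ≤ eLpNorm F (ENNReal.ofReal p) μ + eLpNorm (fun x => c * H x) (ENNReal.ofReal p) μ :=
        eLpNorm_add_le hF.aestronglyMeasurable (hH.const_mul c).aestronglyMeasurable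
          (by simpa using hp)
    _ ≤ m + c * M := by
        rw [eLpNorm_const_mul_ennreal (one_pos.trans_le hp) hc]
        gcongr

theorem eLpNorm_magRemainder_moll_le (φ : ContDiffBump (0 : RN N)) (hp : 1 ≤ p) {L : NNReal}
    (hA : LipschitzWith L A) (hum : StronglyMeasurable u) (hu : LocallyIntegrable u volume)
    (h : RN N) {M : ℝ≥0∞}
    (hM : ∀ t ∈ Ioc (0 : ℝ) 1, eLpNorm (fun x => magGrad φ A u (x + t • h) - magGrad φ A u x)
      (ENNReal.ofReal p) volume ≤ M) :
    eLpNorm (magRemainder A (moll φ u) (magGrad φ A u) h) (ENNReal.ofReal p) volume ≤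
      ‖h‖ₑ * M
        + ENNReal.ofReal (‖h‖ * L * (φ.rOut + ‖h‖)) * eLpNorm u (ENNReal.ofReal p) volume
        + ‖h‖ₑ * eLpNorm (fun x => phaseSize A h x * ‖magGrad φ A u x‖ₑ) (ENNReal.ofReal p)
          volume := by
  have hgrad := continuous_magGrad φ hA.continuous hu
  have hmoll := measurable_eMoll φ hum
  have hdiff : Measurable fun q : RN N × ℝ =>
      ‖magGrad φ A u (q.1 + q.2 • h) - magGrad φ A u q.1‖ₑ :=
    ((hgrad.comp (by fun_prop)).sub (hgrad.comp (by fun_prop))).measurable.enorm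
  have hlast : Measurable fun x => phaseSize A h x * ‖magGrad φ A u x‖ₑ :=
    (measurable_phaseSize hA.continuous h).mul hgrad.measurable.enorm
  refine eLpNorm_le_of_enorm_le_lintegral (κ := volume.restrict (Ioc (0 : ℝ) 1))
    (H := fun x t => ‖h‖ₑ * ‖magGrad φ A u (x + t • h) - magGrad φ A u x‖ₑ
      + ENNReal.ofReal (‖h‖ * L * (φ.rOut + ‖h‖)) * eMoll φ u (x + t • h)
      + ‖h‖ₑ * (phaseSize A h x * ‖magGrad φ A u x‖ₑ)) hp ?_
    (.of_forall (enorm_magRemainder_moll_le φ hA hu h)) ?_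
  · exact (((hdiff.const_mul _).add ((hmoll.comp (by fun_prop)).const_mul _)).add
      ((hlast.comp measurable_fst).const_mul _)).aemeasurable
  filter_upwards [ae_restrict_mem measurableSet_Ioc] with t ht
  have hdiff_t : Measurable fun x => ‖magGrad φ A u (x + t • h) - magGrad φ A u x‖ₑ :=
    ((hgrad.comp (by fun_prop)).sub hgrad).measurable.enorm
  have hmoll_t := measurable_eMoll_comp_add φ hum (t • h)
  refine eLpNorm_add_const_mul_le hp ((hdiff_t.const_mul _).add (hmoll_t.const_mul _)) hlast
    enorm_ne_top (eLpNorm_add_const_mul_le hp (hdiff_t.const_mul _) hmoll_t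
      ENNReal.ofReal_ne_top ?_ (eLpNorm_eMoll_comp_add_le φ hp hum _)) le_rfl
  rw [eLpNorm_const_mul_ennreal (one_pos.trans_le hp) enorm_ne_top, eLpNorm_enorm]
  gcongr
  exact hM t ht

theorem magRemainder_eq_add_magRemainder_sub (u v : RN N → ℂ) (G H : RN N → CN N) (h : RN N) :
    magRemainder A u G h = fun x => magRemainder A v H h x
      + magRemainder A (fun y => u y - v y) (fun y => G y - H y) h x := by
  ext x
  simp only [magRemainder, magShift, cdot_sub_left]
  ring

theorem aestronglyMeasurable_magShift (hA : Continuous A) (hu : AEStronglyMeasurable u volume)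
    (h : RN N) : AEStronglyMeasurable (magShift A h u) volume := by
  have hphase := continuous_magPhase hA h
  exact (Continuous.aestronglyMeasurable (by fun_prop)).mul
    (hu.comp_measurePreserving (measurePreserving_add_right volume h))

theorem aestronglyMeasurable_cdot (hG : AEStronglyMeasurable G volume) (h : RN N) :
    AEStronglyMeasurable (fun x => cdot (G x) h) volume :=
  (continuous_cdot.comp (Continuous.prodMk_left h)).comp_aestronglyMeasurable hG

theorem aestronglyMeasurable_magRemainder (hA : Continuous A)
    (hu : AEStronglyMeasurable u volume) (hG : AEStronglyMeasurable G volume) (h : RN N) :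
    AEStronglyMeasurable (magRemainder A u G h) volume :=
  ((aestronglyMeasurable_magShift hA hu h).sub hu).sub (aestronglyMeasurable_cdot hG h)

theorem eLpNorm_magRemainder_le (hp : 1 ≤ p) (hA : Continuous A)
    (hu : AEStronglyMeasurable u volume) (hG : AEStronglyMeasurable G volume) (h : RN N) :
    eLpNorm (magRemainder A u G h) (ENNReal.ofReal p) volume ≤
      eLpNorm u (ENNReal.ofReal p) volume + eLpNorm u (ENNReal.ofReal p) volume
        + ‖h‖ₑ * eLpNorm G (ENNReal.ofReal p) volume := by
  have hq : 1 ≤ ENNReal.ofReal p := by simpa using hp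
  have hshift := aestronglyMeasurable_magShift hA hu h
  refine (eLpNorm_sub_le (hshift.sub hu) (aestronglyMeasurable_cdot hG h) hq).trans
    (add_le_add ((eLpNorm_sub_le hshift hu hq).trans_eq (by rw [eLpNorm_magShift hu])) ?_)
  rw [← eLpNorm_enorm G, ← eLpNorm_const_mul_ennreal (one_pos.trans_le hp) enorm_ne_top]
  exact eLpNorm_mono_enorm fun x => enorm_cdot_le _ _

theorem eLpNorm_phaseSize_mul_le (hp : 1 ≤ p) (hA : Continuous A) {H : RN N → CN N}
    (hG : AEStronglyMeasurable G volume) (hH : AEStronglyMeasurable H volume) (h : RN N) :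
    eLpNorm (fun x => phaseSize A h x * ‖H x‖ₑ) (ENNReal.ofReal p) volume ≤
      eLpNorm (fun x => phaseSize A h x * ‖G x‖ₑ) (ENNReal.ofReal p) volume
        + 2 * eLpNorm (fun x => H x - G x) (ENNReal.ofReal p) volume := by
  have hphase := measurable_phaseSize hA h
  rw [← eLpNorm_enorm fun x => H x - G x,
    ← eLpNorm_const_mul_ennreal (one_pos.trans_le hp) ENNReal.ofNat_ne_top]
  refine (eLpNorm_mono_enorm fun x => ?_).trans (eLpNorm_add_le
    (hphase.aemeasurable.mul hG.enorm).aestronglyMeasurable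
    ((hH.sub hG).enorm.const_mul 2).aestronglyMeasurable (by simpa using hp))
  calc phaseSize A h x * ‖H x‖ₑ = phaseSize A h x * ‖G x + (H x - G x)‖ₑ := by
        rw [add_sub_cancel]
    _ ≤ phaseSize A h x * (‖G x‖ₑ + ‖H x - G x‖ₑ) := by gcongr; exact enorm_add_le _ _
    _ ≤ phaseSize A h x * ‖G x‖ₑ + 2 * ‖H x - G x‖ₑ := by
        rw [mul_add]
        gcongr
        exact phaseSize_le_two A h x

theorem eLpNorm_magRemainder_le_add_moll (φ : ContDiffBump (0 : RN N)) (hp : 1 ≤ p) {L : NNReal}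
    (hA : LipschitzWith L A) (hum : StronglyMeasurable u) (hu : MemLp u (ENNReal.ofReal p) volume)
    (hG : MemLp G (ENNReal.ofReal p) volume) (hGu : magGrad φ A u = moll φ G)
    (h : RN N) {M : ℝ≥0∞} (hM : ∀ t ∈ Ioc (0 : ℝ) 1,
      eLpNorm (fun x => G (x + t • h) - G x) (ENNReal.ofReal p) volume ≤ M) :
    eLpNorm (magRemainder A u G h) (ENNReal.ofReal p) volume ≤
      ‖h‖ₑ * M
        + ENNReal.ofReal (‖h‖ * L * (φ.rOut + ‖h‖)) * eLpNorm u (ENNReal.ofReal p) volume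
        + ‖h‖ₑ * (eLpNorm (fun x => phaseSize A h x * ‖G x‖ₑ) (ENNReal.ofReal p) volume
          + 2 * eLpNorm (fun x => moll φ G x - G x) (ENNReal.ofReal p) volume)
        + (eLpNorm (fun x => moll φ u x - u x) (ENNReal.ofReal p) volume
          + eLpNorm (fun x => moll φ u x - u x) (ENNReal.ofReal p) volume
          + ‖h‖ₑ * eLpNorm (fun x => moll φ G x - G x) (ENNReal.ofReal p) volume) := by
  have hq : 1 ≤ ENNReal.ofReal p := by simpa using hp
  have hul := hu.locallyIntegrable hq
  have hcu := (continuous_moll φ hul).aestronglyMeasurable (μ := volume)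
  have hcG := (continuous_moll φ (hG.locallyIntegrable hq)).aestronglyMeasurable (μ := volume)
  have hmain := eLpNorm_magRemainder_moll_le φ hp hA hum hul h (M := M) fun t ht => by
    rw [hGu]
    exact (eLpNorm_moll_translate_sub_le φ hp hG _).trans (hM t ht)
  rw [hGu] at hmain
  rw [magRemainder_eq_add_magRemainder_sub u (moll φ u) G (moll φ G) h]
  refine (eLpNorm_add_le (aestronglyMeasurable_magRemainder hA.continuous hcu hcG h)
    (aestronglyMeasurable_magRemainder hA.continuous (hu.1.sub hcu) (hG.1.sub hcG) h)
    hq).trans (add_le_add (hmain.trans ?_) ?_)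
  · gcongr
    exact eLpNorm_phaseSize_mul_le hp hA.continuous hG.1 hcG h
  · refine (eLpNorm_magRemainder_le hp hA.continuous (hu.1.sub hcu) (hG.1.sub hcG) h).trans_eq ?_
    rw [eLpNorm_sub_comm u, eLpNorm_sub_comm G]
    rfl

theorem eLpNorm_magRemainder_le_add (hp : 1 ≤ p) {L : NNReal} (hA : LipschitzWith L A)
    (hum : StronglyMeasurable u) (hu : MemLp u (ENNReal.ofReal p) volume)
    (hG : MemLp G (ENNReal.ofReal p) volume) (hGu : ∀ φ, magGrad φ A u = moll φ G)
    (h : RN N) {M : ℝ≥0∞} (hM : ∀ t ∈ Ioc (0 : ℝ) 1,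
      eLpNorm (fun x => G (x + t • h) - G x) (ENNReal.ofReal p) volume ≤ M) :
    eLpNorm (magRemainder A u G h) (ENNReal.ofReal p) volume ≤ ‖h‖ₑ * M
      + ENNReal.ofReal (‖h‖ * L * ‖h‖) * eLpNorm u (ENNReal.ofReal p) volume
      + ‖h‖ₑ * eLpNorm (fun x => phaseSize A h x * ‖G x‖ₑ) (ENNReal.ofReal p) volume := by
  set q := ENNReal.ofReal p
  set φ := shrinkingBump (RN N)
  have hrOut : Tendsto (fun k => (φ k).rOut) atTop (𝓝 0) := tendsto_rOut_shrinkingBump (RN N)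
  have hdu := tendsto_eLpNorm_moll_sub hrOut hp hu
  have hdG := tendsto_eLpNorm_moll_sub hrOut hp hG
  have hcoef : Tendsto (fun k => ENNReal.ofReal (‖h‖ * L * ((φ k).rOut + ‖h‖)) * eLpNorm u q volume)
      atTop (𝓝 (ENNReal.ofReal (‖h‖ * L * (0 + ‖h‖)) * eLpNorm u q volume)) :=
    ENNReal.Tendsto.mul_const (ENNReal.tendsto_ofReal ((hrOut.add_const _).const_mul _))
      (.inr hu.2.ne)
  have hdG2 := ENNReal.Tendsto.const_mul (a := 2) hdG (.inr ENNReal.ofNat_ne_top)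
  have hlim := (hcoef.const_add (‖h‖ₑ * M)).add (ENNReal.Tendsto.const_mul (hdG2.const_add
    (eLpNorm (fun x => phaseSize A h x * ‖G x‖ₑ) q volume)) (.inr (enorm_ne_top (x := h))))
  have herr := (hdu.add hdu).add (ENNReal.Tendsto.const_mul hdG (.inr (enorm_ne_top (x := h))))
  simpa using ge_of_tendsto' (hlim.add herr) fun k =>
    eLpNorm_magRemainder_le_add_moll (φ k) hp hA hum hu hG (hGu _) h hM

theorem eventually_eLpNorm_magRemainder_le (hp : 1 ≤ p) {L : NNReal} (hA : LipschitzWith L A)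
    (hum : StronglyMeasurable u) (hu : MemLp u (ENNReal.ofReal p) volume)
    (hG : MemLp G (ENNReal.ofReal p) volume) (hGu : ∀ φ, magGrad φ A u = moll φ G)
    {ε : ℝ≥0∞} (hε : ε ≠ 0) :
    ∀ᶠ h in 𝓝 0, eLpNorm (magRemainder A u G h) (ENNReal.ofReal p) volume ≤ ε * ‖h‖ₑ := by
  have hε3 : 0 < ε / 3 := ENNReal.div_pos hε ENNReal.ofNat_ne_top
  have htrans := ENNReal.tendsto_nhds_zero.1 (tendsto_eLpNorm_translate_sub
    (by simpa using hp : 1 ≤ ENNReal.ofReal p) ENNReal.ofReal_ne_top hG) _ hε3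
  have hphase := ENNReal.tendsto_nhds_zero.1
    (tendsto_eLpNorm_phaseSize_mul (one_pos.trans_le hp) hA.continuous hG) _ hε3
  have hlip : Tendsto (fun h : RN N => ENNReal.ofReal (L * ‖h‖)
      * eLpNorm u (ENNReal.ofReal p) volume) (𝓝 0) (𝓝 0) := by
    have hnorm : Tendsto (fun h : RN N => L * ‖h‖) (𝓝 0) (𝓝 0) :=
      Continuous.tendsto' (by fun_prop) _ _ (by simp)
    simpa using ENNReal.Tendsto.mul_const (ENNReal.tendsto_ofReal hnorm) (.inr hu.2.ne)
  filter_upwards [eventually_forall_smul_of_eventually htrans, hphase,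
    ENNReal.tendsto_nhds_zero.1 hlip _ hε3] with h hM hP hL
  calc eLpNorm (magRemainder A u G h) (ENNReal.ofReal p) volume
      ≤ _ := eLpNorm_magRemainder_le_add hp hA hum hu hG hGu h hM
    _ = ‖h‖ₑ * (ε / 3 + ENNReal.ofReal (L * ‖h‖) * eLpNorm u (ENNReal.ofReal p) volume
          + eLpNorm (fun x => phaseSize A h x * ‖G x‖ₑ) (ENNReal.ofReal p) volume) := by
        rw [mul_assoc ‖h‖, ENNReal.ofReal_mul (norm_nonneg _), ofReal_norm]
        ring
    _ ≤ ‖h‖ₑ * (ε / 3 + ε / 3 + ε / 3) := by gcongr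
    _ = ε * ‖h‖ₑ := by rw [ENNReal.add_thirds, mul_comm]

end Remainder

section WeakGradient

variable {N : ℕ} {A : RN N → RN N} {u : RN N → ℂ} {g : RN N → CN N}

/-- The magnetic gradient `g - i A u`, for `g` the weak gradient of `u`. -/
def magField (A : RN N → RN N) (u : RN N → ℂ) (g : RN N → CN N) (x : RN N) : CN N :=
  g x - (Complex.I * u x) • toCN (A x)

theorem IsWeakGradient.locallyIntegrable_magField (hA : Continuous A) (hw : IsWeakGradient u g) :
    LocallyIntegrable (magField A u g) volume :=
  hw.2.1.sub ((hw.1.continuous_mul (g := fun _ => Complex.I) continuous_const).smul_continuous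
    (continuous_toCN.comp hA))

theorem locallyIntegrable_coord {𝕜 : Type*} [RCLike 𝕜] {f : RN N → EuclideanSpace 𝕜 (Fin N)}
    (hf : LocallyIntegrable f volume) (j : Fin N) : LocallyIntegrable (fun z => f z j) volume :=
  hf.mono ((EuclideanSpace.proj (𝕜 := 𝕜) j).continuous.comp_aestronglyMeasurable
    hf.aestronglyMeasurable) (.of_forall fun z => PiLp.norm_apply_le (f z) j)

theorem moll_apply_coord {𝕜 : Type*} [RCLike 𝕜] (φ : ContDiffBump (0 : RN N))
    {f : RN N → EuclideanSpace 𝕜 (Fin N)} (hf : LocallyIntegrable f volume) (y : RN N)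
    (j : Fin N) :
    moll φ f y j = moll φ (fun z => f z j) y := by
  simp only [moll_apply]
  exact (((EuclideanSpace.proj j : EuclideanSpace 𝕜 (Fin N) →L[𝕜] 𝕜).restrictScalars
    ℝ).integral_comp_comm (integrable_normed_smul φ hf y)).symm

theorem moll_const_mul (φ : ContDiffBump (0 : RN N)) (c : ℂ) (f : RN N → ℂ) (y : RN N) :
    moll φ (fun z => c * f z) y = c * moll φ f y := by
  simp only [moll_apply, ← integral_const_mul, mul_smul_comm]

theorem fderiv_normed_comp_sub {E : Type*} [NormedAddCommGroup E] [NormedSpace ℝ E]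
    [FiniteDimensional ℝ E] [MeasureSpace E] (φ : ContDiffBump (0 : E)) (y z v : E) :
    fderiv ℝ (fun z => φ.normed volume (y - z)) z v = -fderiv ℝ (φ.normed volume) (y - z) v := by
  have hφ : HasFDerivAt (φ.normed volume) (fderiv ℝ (φ.normed volume) (y - z)) (y - z) :=
    ((φ.contDiff_normed (n := 1)).differentiable one_ne_zero _).hasFDerivAt
  have hcomp : HasFDerivAt (fun z => φ.normed volume (y - z)) _ z :=
    hφ.comp z ((hasFDerivAt_id z).const_sub y)
  rw [hcomp.fderiv]
  simp

theorem IsWeakGradient.fderiv_moll_single (hw : IsWeakGradient u g) (φ : ContDiffBump (0 : RN N))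
    (y : RN N) (j : Fin N) :
    fderiv ℝ (moll φ u) y (EuclideanSpace.single j 1) = moll φ (fun z => g z j) y := by
  have hibp := hw.2.2 (fun z => φ.normed volume (y - z))
    (φ.contDiff_normed.comp (contDiff_const.sub contDiff_id))
    (φ.hasCompactSupport_normed.comp_homeomorph (Homeomorph.subLeft y)) j
  simp only [fderiv_normed_comp_sub, Complex.ofReal_neg, neg_mul, integral_neg, neg_inj] at hibp
  rw [fderiv_moll φ hw.1, moll_apply_swap]
  simpa only [Complex.real_smul] using hibp

theorem IsWeakGradient.magGrad_eq_moll (hA : Continuous A) (hw : IsWeakGradient u g)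
    (φ : ContDiffBump (0 : RN N)) : magGrad φ A u = moll φ (magField A u g) := by
  ext y j
  have hAj : LocallyIntegrable (fun z => (A z j : ℂ) * u z) volume :=
    locallyIntegrable_ofReal_mul (by fun_prop) hw.1
  have hcoord : (fun z => magField A u g z j) = fun z => g z j - Complex.I * (A z j * u z) := by
    ext z
    simp only [magField, toCN, PiLp.sub_apply, PiLp.smul_apply, smul_eq_mul]
    ring
  rw [moll_apply_coord φ (hw.locallyIntegrable_magField hA), hcoord,
    moll_sub φ (locallyIntegrable_coord hw.2.1 j)
      (hAj.continuous_mul (g := fun _ => Complex.I) continuous_const),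
    moll_const_mul, ← hw.fderiv_moll_single]
  simp [magGrad]

theorem IsWeakGradient.ae_eq {g' : RN N → CN N} (hw : IsWeakGradient u g)
    (hw' : IsWeakGradient u g') : g =ᵐ[volume] g' := by
  have hcoord : ∀ j, (fun x => g x j) =ᵐ[volume] fun x => g' x j := fun j =>
    ae_eq_of_integral_contDiff_smul_eq (locallyIntegrable_coord hw.2.1 j)
      (locallyIntegrable_coord hw'.2.1 j) fun ψ hψ hψc => by
        simpa only [Complex.real_smul] using
          neg_injective ((hw.2.2 ψ hψ hψc j).symm.trans (hw'.2.2 ψ hψ hψc j))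
  filter_upwards [ae_all_iff.2 hcoord] with x hx
  exact PiLp.ext hx

theorem IsWeakGradient.congr {u' : RN N → ℂ} {g' : RN N → CN N} (hw : IsWeakGradient u g)
    (hu : u =ᵐ[volume] u') (hg : g =ᵐ[volume] g') : IsWeakGradient u' g' := by
  refine ⟨hw.1.congr hu, hw.2.1.congr hg, fun ψ hψ hψc j => ?_⟩
  have hleft : ∫ x, (fderiv ℝ ψ x (EuclideanSpace.single j (1 : ℝ)) : ℂ) * u' x
      = ∫ x, (fderiv ℝ ψ x (EuclideanSpace.single j (1 : ℝ)) : ℂ) * u x :=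
    integral_congr_ae (by filter_upwards [hu] with x hx; rw [hx])
  have hright : ∫ x, (ψ x : ℂ) * g' x j = ∫ x, (ψ x : ℂ) * g x j :=
    integral_congr_ae (by filter_upwards [hg] with x hx; rw [hx])
  rw [hleft, hright, hw.2.2 ψ hψ hψc j]

end WeakGradient

section Pow

/-- `|Re z|^p + |Im z|^p`, that is `|z|_p^p`, as an extended nonnegative real. -/
def ePow (p : ℝ) (z : ℂ) : ℝ≥0∞ := ‖z.re‖ₑ ^ p + ‖z.im‖ₑ ^ p

variable {p : ℝ}

theorem absP_nonneg (p : ℝ) (z : ℂ) : 0 ≤ absP p z := by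
  unfold absP
  positivity

theorem absP_rpow (hp : 0 < p) (z : ℂ) : absP p z ^ p = |z.re| ^ p + |z.im| ^ p := by
  rw [absP, ← Real.rpow_mul (by positivity), one_div_mul_cancel hp.ne', Real.rpow_one]

theorem ofReal_absP_rpow (hp : 0 < p) (z : ℂ) : ENNReal.ofReal (absP p z ^ p) = ePow p z := by
  rw [absP_rpow hp, ENNReal.ofReal_add (by positivity) (by positivity), ePow]
  simp only [← ofReal_norm, Real.norm_eq_abs, ENNReal.ofReal_rpow_of_nonneg (abs_nonneg _) hp.le]

theorem measurable_ePow (p : ℝ) : Measurable (ePow p) := by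
  unfold ePow
  fun_prop

theorem ePow_real_mul (hp : 0 ≤ p) (t : ℝ) (z : ℂ) :
    ePow p (t * z) = ‖t‖ₑ ^ p * ePow p z := by
  simp [ePow, ENNReal.mul_rpow_of_nonneg _ _ hp, mul_add]

theorem enorm_re_le (z : ℂ) : ‖z.re‖ₑ ≤ ‖z‖ₑ :=
  enorm_le_iff_norm_le.2 (Complex.abs_re_le_norm z)

theorem enorm_im_le (z : ℂ) : ‖z.im‖ₑ ≤ ‖z‖ₑ :=
  enorm_le_iff_norm_le.2 (Complex.abs_im_le_norm z)

theorem ePow_le (hp : 0 ≤ p) (z : ℂ) : ePow p z ≤ 2 * ‖z‖ₑ ^ p := by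
  rw [ePow, two_mul]
  gcongr
  · exact enorm_re_le z
  · exact enorm_im_le z

theorem eventually_forall_add_rpow_le (hp : 0 < p) {B a : ℝ≥0∞} (hB : B ≠ ⊤) (ha : a ≠ 0) :
    ∀ᶠ e in 𝓝 (0 : ℝ≥0∞), ∀ y ≤ B, (y + e) ^ p ≤ y ^ p + a := by
  suffices ∀ᶠ e in 𝓝 (0 : ℝ≥0∞), ∀ y ∈ Iic B, (y + e) ^ p < y ^ p + a from
    this.mono fun e he y hy => (he y hy).le
  refine isClosed_Iic.isCompact.eventually_forall_of_forall_eventually fun y hy => ?_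
  have hl : Continuous fun z : ℝ≥0∞ × ℝ≥0∞ => (z.2 + z.1) ^ p :=
    ENNReal.continuous_rpow_const.comp (continuous_snd.add continuous_fst)
  have hr : Continuous fun z : ℝ≥0∞ × ℝ≥0∞ => z.2 ^ p + a :=
    (ENNReal.continuous_rpow_const.comp continuous_snd).add continuous_const
  refine hl.continuousAt.eventually_lt hr.continuousAt ?_
  rw [add_zero]
  exact ENNReal.lt_add_right
    (ENNReal.rpow_ne_top_of_nonneg hp.le (ne_top_of_le_ne_top hB hy)) ha

theorem rpow_le_rpow_add_mul (hp : 0 < p) {B a e s x y : ℝ≥0∞}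
    (he : ∀ y ≤ B, (y + e) ^ p ≤ y ^ p + a) (hs : s ≠ ⊤) (hB : min x y ≤ B * s)
    (hxy : x ≤ y + e * s) : x ^ p ≤ y ^ p + a * s ^ p := by
  rcases le_total x y with h | h
  · exact (ENNReal.rpow_le_rpow h hp.le).trans le_self_add
  rw [min_eq_right h] at hB
  rcases eq_or_ne s 0 with rfl | hs0
  · rw [mul_zero, add_zero] at hxy
    exact (ENNReal.rpow_le_rpow hxy hp.le).trans le_self_add
  have hsp0 : s ^ p ≠ 0 := by simp [hs0, hs]
  have hspt : s ^ p ≠ ⊤ := ENNReal.rpow_ne_top_of_nonneg hp.le hs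
  calc x ^ p ≤ ((y / s + e) * s) ^ p := by
        rw [add_mul, ENNReal.div_mul_cancel hs0 hs]
        gcongr
    _ = (y / s + e) ^ p * s ^ p := ENNReal.mul_rpow_of_nonneg _ _ hp.le
    _ ≤ ((y / s) ^ p + a) * s ^ p := by
        gcongr
        exact he _ (ENNReal.div_le_of_le_mul hB)
    _ = y ^ p + a * s ^ p := by
        rw [add_mul, ENNReal.div_rpow_of_nonneg _ _ hp.le, ENNReal.div_mul_cancel hsp0 hspt]

variable {X : Type*} [MeasurableSpace X] {μ : Measure X}

theorem lintegral_ePow (hp : 0 < p) {f : X → ℂ} (hf : AEStronglyMeasurable f μ) :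
    ∫⁻ x, ePow p (f x) ∂μ = eLpNorm (fun x => (f x).re) (ENNReal.ofReal p) μ ^ p +
      eLpNorm (fun x => (f x).im) (ENNReal.ofReal p) μ ^ p := by
  have hre : AEMeasurable (fun x => ‖(f x).re‖ₑ ^ p) μ :=
    (Complex.continuous_re.comp_aestronglyMeasurable hf).enorm.pow_const p
  rw [eLpNorm_ofReal_rpow hp, eLpNorm_ofReal_rpow hp, ← lintegral_add_left' hre]
  rfl

theorem eLpNorm_comp_rpow_le_add_mul {E F : Type*} [NormedAddCommGroup E] [NormedSpace ℝ E]
    [NormedAddCommGroup F] [NormedSpace ℝ F] (hp : 1 ≤ p) {B a e s : ℝ≥0∞}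
    (he : ∀ y ≤ B, (y + e) ^ p ≤ y ^ p + a) (hs : s ≠ ⊤) {f g : X → E}
    (hf : AEStronglyMeasurable f μ) (hg : AEStronglyMeasurable g μ)
    (hB : min (eLpNorm f (ENNReal.ofReal p) μ) (eLpNorm g (ENNReal.ofReal p) μ) ≤ B * s)
    (hfg : eLpNorm (f - g) (ENNReal.ofReal p) μ ≤ e * s)
    (c : E →L[ℝ] F) (hc : ∀ z, ‖c z‖ₑ ≤ ‖z‖ₑ) :
    eLpNorm (fun x => c (f x)) (ENNReal.ofReal p) μ ^ p ≤
      eLpNorm (fun x => c (g x)) (ENNReal.ofReal p) μ ^ p + a * s ^ p := by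
  have hle (w : X → E) : eLpNorm (fun x => c (w x)) (ENNReal.ofReal p) μ ≤
      eLpNorm w (ENNReal.ofReal p) μ := eLpNorm_mono_enorm fun x => hc (w x)
  refine rpow_le_rpow_add_mul (by linarith) he hs ((min_le_min (hle f) (hle g)).trans hB) ?_
  have hsplit : (fun x => c (f x)) = (fun x => c (g x)) + fun x => c ((f - g) x) := by
    ext x
    simp
  rw [hsplit]
  refine (eLpNorm_add_le (c.continuous.comp_aestronglyMeasurable hg)
    (c.continuous.comp_aestronglyMeasurable (hf.sub hg)) (by simpa using hp)).trans ?_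
  gcongr
  exact (hle _).trans hfg

theorem lintegral_ePow_le_add_mul (hp : 1 ≤ p) {B a e s : ℝ≥0∞}
    (he : ∀ y ≤ B, (y + e) ^ p ≤ y ^ p + a) (hs : s ≠ ⊤) {f g : X → ℂ}
    (hf : AEStronglyMeasurable f μ) (hg : AEStronglyMeasurable g μ)
    (hB : min (eLpNorm f (ENNReal.ofReal p) μ) (eLpNorm g (ENNReal.ofReal p) μ) ≤ B * s)
    (hfg : eLpNorm (f - g) (ENNReal.ofReal p) μ ≤ e * s) :
    ∫⁻ x, ePow p (f x) ∂μ ≤ (∫⁻ x, ePow p (g x) ∂μ) + 2 * a * s ^ p := by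
  have hp0 : 0 < p := by linarith
  have hre := eLpNorm_comp_rpow_le_add_mul hp he hs hf hg hB hfg Complex.reCLM enorm_re_le
  have him := eLpNorm_comp_rpow_le_add_mul hp he hs hf hg hB hfg Complex.imCLM enorm_im_le
  rw [lintegral_ePow hp0 hf, lintegral_ePow hp0 hg]
  refine (add_le_add hre him).trans_eq ?_
  simp only [Complex.reCLM_apply, Complex.imCLM_apply]
  ring

end Pow

section Energy

variable {N : ℕ} {K : Set (RN N)} {A : RN N → RN N} {u : RN N → ℂ} {G : RN N → CN N} {p : ℝ}

/-- `∫ |Ψ_u(x, x + h) - Ψ_u(x, x)|_p^p dx`, the part of the nonlocal energy carried by the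
increment `h`. -/
def shiftEnergy (p : ℝ) (A : RN N → RN N) (u : RN N → ℂ) (h : RN N) : ℝ≥0∞ :=
  ∫⁻ x, ePow p (magShift A h u x - u x)

/-- `∫ |G(x) · h|_p^p dx`, the energy of the field `G` in the direction `h`. -/
def dirEnergy (p : ℝ) (G : RN N → CN N) (h : RN N) : ℝ≥0∞ := ∫⁻ x, ePow p (cdot (G x) h)

theorem measurable_magShift_prod (hA : Continuous A) (hum : StronglyMeasurable u) :
    Measurable fun q : RN N × RN N => magShift A q.2 u q.1 := by
  unfold magShift magPhase
  have hphase : Continuous fun q : RN N × RN N =>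
    Complex.exp (((-inner ℝ q.2 (A (q.1 + (2 : ℝ)⁻¹ • q.2)) : ℝ) : ℂ) * Complex.I) := by fun_prop
  have htranslate : Measurable fun q : RN N × RN N => u (q.1 + q.2) :=
    hum.measurable.comp (measurable_fst.add measurable_snd)
  exact hphase.measurable.mul htranslate

theorem measurable_magShift (hA : Continuous A) (hum : StronglyMeasurable u) (h : RN N) :
    Measurable (magShift A h u) :=
  (measurable_magShift_prod hA hum).comp (f := fun x => (x, h)) measurable_prodMk_right

theorem lintegral_prod_comp_sub {E : Type*} [AddCommGroup E] [MeasurableSpace E]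
    [MeasurableAdd₂ E] [MeasurableNeg E] {μ : Measure E} [SFinite μ] [μ.IsAddLeftInvariant]
    {F : E × E → ℝ≥0∞} (hF : AEMeasurable F (μ.prod μ)) :
    ∫⁻ z, F (z.1, z.2 - z.1) ∂μ.prod μ = ∫⁻ h, ∫⁻ x, F (x, h) ∂μ ∂μ := by
  have hshear := measurePreserving_prod_neg_add μ μ
  rw [← lintegral_prod_symm F hF]
  conv_rhs => rw [← hshear.map_eq]
  rw [lintegral_map' (by rwa [hshear.map_eq]) hshear.measurable.aemeasurable]
  simp only [neg_add_eq_sub]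

theorem ofReal_nonlocal_integrand (hp : 0 < p) (hKs : ∀ x ∈ K, -x ∈ K) (ρ : ℝ → ℝ) (x y : RN N) :
    ENNReal.ofReal (absP p (Psi A u x y - Psi A u x x) ^ p / gauge K (x - y) ^ p *
        ρ (gauge K (x - y))) =
      ePow p (magShift A (y - x) u x - u x) * radialKernel p ρ (gauge K (y - x)) := by
  have habs := absP_nonneg p (Psi A u x y - Psi A u x x)
  rw [← neg_sub y x, gauge_neg hKs, div_mul_eq_mul_div, mul_div_assoc,
    ENNReal.ofReal_mul (by positivity), ofReal_absP_rpow hp, ← Psi_add_eq_magShift, Psi_self,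
    radialKernel, add_sub_cancel]

theorem nonlocalEnergy_eq_lintegral (hp : 0 < p) (hKc : Convex ℝ K) (hKs : ∀ x ∈ K, -x ∈ K)
    (hKb : Bornology.IsBounded K) (hK0 : K ∈ 𝓝 0) [Nontrivial (RN N)] {ρ : ℝ → ℝ}
    (hρ : AEMeasurable (radialKernel p ρ) (volume.restrict (Ioi 0)))
    (hA : Continuous A) (hum : StronglyMeasurable u) :
    nonlocalEnergy p K A ρ u = ∫⁻ h, shiftEnergy p A u h * radialKernel p ρ (gauge K h) := by
  have hshift : Measurable fun q : RN N × RN N => ePow p (magShift A q.2 u q.1 - u q.1) :=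
    (measurable_ePow p).comp ((measurable_magShift_prod hA hum).sub
      (hum.measurable.comp measurable_fst))
  have hkernel : AEMeasurable (fun h => radialKernel p ρ (gauge K h)) (volume : Measure (RN N)) :=
    hρ.comp_quasiMeasurePreserving (quasiMeasurePreserving_gauge hKc hKb hK0)
  calc nonlocalEnergy p K A ρ u
      = ∫⁻ z : RN N × RN N, ePow p (magShift A (z.2 - z.1) u z.1 - u z.1) *
          radialKernel p ρ (gauge K (z.2 - z.1)) :=
        lintegral_congr fun z => ofReal_nonlocal_integrand hp hKs ρ z.1 z.2
    _ = ∫⁻ h, ∫⁻ x, ePow p (magShift A h u x - u x) * radialKernel p ρ (gauge K h) :=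
        lintegral_prod_comp_sub (hshift.aemeasurable.mul hkernel.comp_snd)
    _ = _ := lintegral_congr fun h => lintegral_mul_const _
        (hshift.comp (f := fun x => (x, h)) measurable_prodMk_right)

theorem measurable_ePow_cdot_prod (hG : StronglyMeasurable G) :
    Measurable fun q : RN N × RN N => ePow p (cdot (G q.1) q.2) :=
  (measurable_ePow p).comp <| continuous_cdot.measurable.comp <|
    (hG.measurable.comp measurable_fst).prodMk measurable_snd

theorem measurable_dirEnergy (hG : StronglyMeasurable G) : Measurable (dirEnergy p G) :=
  (measurable_ePow_cdot_prod hG).lintegral_prod_left'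

theorem isPosHomogeneous_dirEnergy (hp : 0 ≤ p) (G : RN N → CN N) :
    IsPosHomogeneous p (dirEnergy p G) := by
  intro t ht h
  unfold dirEnergy
  rw [← lintegral_const_mul' _ _ ENNReal.ofReal_ne_top]
  refine lintegral_congr fun x => ?_
  rw [cdot_smul_right, ePow_real_mul hp, Real.enorm_eq_ofReal ht.le,
    ENNReal.ofReal_rpow_of_nonneg ht.le hp]

theorem coneMass_dirEnergy (hG : StronglyMeasurable G) :
    coneMass volume K p (dirEnergy p G) =
      ∫⁻ x, coneMass volume K p fun h => ePow p (cdot (G x) h) := by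
  simp only [coneMass]
  rw [lintegral_const_mul' _ _ ENNReal.ofReal_ne_top]
  congr 1
  exact lintegral_lintegral_swap
    ((measurable_ePow_cdot_prod hG).comp measurable_swap).aemeasurable

theorem integrableOn_absP_cdot_rpow (hp : 0 < p) (hKb : Bornology.IsBounded K) (v : CN N) :
    IntegrableOn (fun x => absP p (cdot v x) ^ p) K := by
  have hcdot : Continuous fun x : RN N => cdot v x :=
    continuous_cdot.comp (continuous_const.prodMk continuous_id)
  have hcont : Continuous fun x : RN N => absP p (cdot v x) ^ p := by
    simp only [absP_rpow hp]
    exact ((Complex.continuous_re.comp hcdot).abs.rpow_const fun _ => Or.inr hp.le).add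
      ((Complex.continuous_im.comp hcdot).abs.rpow_const fun _ => Or.inr hp.le)
  obtain ⟨R, hR⟩ := hKb.subset_closedBall (0 : RN N)
  exact (hcont.continuousOn.integrableOn_compact (isCompact_closedBall _ _)).mono_set hR

theorem ofReal_polarMomentNorm_rpow (hp : 0 < p) (hKb : Bornology.IsBounded K) (v : CN N) :
    ENNReal.ofReal p * ENNReal.ofReal (polarMomentNorm p K v ^ p) =
      coneMass volume K p fun h => ePow p (cdot v h) := by
  have hnn (x : RN N) : 0 ≤ absP p (cdot v x) ^ p := Real.rpow_nonneg (absP_nonneg _ _) _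
  have hI : 0 ≤ ∫ x in K, absP p (cdot v x) ^ p := integral_nonneg hnn
  rw [polarMomentNorm, ← Real.rpow_mul (by positivity), one_div_mul_cancel hp.ne', Real.rpow_one,
    ENNReal.ofReal_mul (by positivity), ofReal_integral_eq_lintegral_ofReal
      (integrableOn_absP_cdot_rpow hp hKb v) (Eventually.of_forall hnn), ← mul_assoc,
    ← ENNReal.ofReal_mul hp.le, mul_div_cancel₀ _ hp.ne', coneMass, finrank_euclideanSpace_fin]
  simp only [ofReal_absP_rpow hp]

theorem ofReal_mul_lintegral_polarMomentNorm (hp : 0 < p) (hKb : Bornology.IsBounded K)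
    (hG : StronglyMeasurable G) :
    ENNReal.ofReal p * ∫⁻ x, ENNReal.ofReal (polarMomentNorm p K (G x) ^ p) =
      coneMass volume K p (dirEnergy p G) := by
  rw [← lintegral_const_mul' _ _ ENNReal.ofReal_ne_top, coneMass_dirEnergy hG]
  exact lintegral_congr fun x => ofReal_polarMomentNorm_rpow hp hKb (G x)

end Energy

section LowerBound

variable {V : Type*} [NormedAddCommGroup V] [InnerProductSpace ℝ V] {p : ℝ}

theorem quarter_mul_norm_le_inner {r : ℝ} (hr : 0 < r) {a h : V}
    (hh : h ∈ Metric.ball ((r / 2 / ‖a‖) • a) (r / 4)) : r / 4 * ‖a‖ ≤ inner ℝ h a := by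
  rcases eq_or_ne a 0 with rfl | ha
  · simp
  have hcenter : inner ℝ ((r / 2 / ‖a‖) • a) a = r / 2 * ‖a‖ := by
    rw [real_inner_smul_left, real_inner_self_eq_norm_sq]
    field_simp
  have hdiff : |inner ℝ (h - (r / 2 / ‖a‖) • a) a| ≤ r / 4 * ‖a‖ :=
    (abs_real_inner_le_norm _ _).trans (by gcongr; exact (mem_ball_iff_norm.1 hh).le)
  rw [inner_sub_left, hcenter] at hdiff
  linarith [neg_le_of_abs_le hdiff]

variable [MeasurableSpace V] [BorelSpace V] {μ : Measure V}
  [μ.IsAddHaarMeasure] {K : Set V}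

theorem exists_mul_enorm_rpow_le_setLIntegral_inner (hp : 0 ≤ p) (hK0 : K ∈ 𝓝 0) :
    ∃ c ≠ 0, ∀ a : V, c * ‖a‖ₑ ^ p ≤ ∫⁻ h in K, ‖(inner ℝ h a : ℝ)‖ₑ ^ p ∂μ := by
  obtain ⟨r, hr, hrK⟩ := Metric.mem_nhds_iff.1 hK0
  have hr4 : 0 < r / 4 := by positivity
  refine ⟨ENNReal.ofReal (r / 4) ^ p * μ (Metric.ball 0 (r / 4)),
    mul_ne_zero (by simp [ENNReal.rpow_eq_zero_iff, hr4]) (Metric.measure_ball_pos μ _ hr4).ne',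
    fun a => ?_⟩
  set w : V := (r / 2 / ‖a‖) • a
  have hw : ‖w‖ ≤ r / 2 := by
    rw [norm_smul, Real.norm_of_nonneg (by positivity), div_mul_comm]
    exact mul_le_of_le_one_left (by positivity) (div_self_le_one _)
  have hsub : Metric.ball w (r / 4) ⊆ K :=
    (Metric.ball_subset_ball' (by rw [dist_zero_right]; linarith)).trans hrK
  calc ENNReal.ofReal (r / 4) ^ p * μ (Metric.ball 0 (r / 4)) * ‖a‖ₑ ^ p
      = ∫⁻ _ in Metric.ball w (r / 4), (ENNReal.ofReal (r / 4) * ‖a‖ₑ) ^ p ∂μ := by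
        rw [setLIntegral_const, Measure.addHaar_ball_center μ w, ENNReal.mul_rpow_of_nonneg _ _ hp]
        ring
    _ ≤ ∫⁻ h in Metric.ball w (r / 4), ‖(inner ℝ h a : ℝ)‖ₑ ^ p ∂μ := by
        refine setLIntegral_mono' measurableSet_ball fun _ hh => ?_
        gcongr
        rw [← ofReal_norm, ← ENNReal.ofReal_mul hr4.le, Real.enorm_eq_ofReal_abs]
        exact ENNReal.ofReal_le_ofReal
          ((quarter_mul_norm_le_inner hr hh).trans (le_abs_self _))
    _ ≤ _ := lintegral_mono_set hsub

end LowerBound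

section CdotLowerBound

variable {N : ℕ} {K : Set (RN N)} {p : ℝ}

/-- The real vector `(c(v_j))_j`; for `c = Re, Im` these are the real and imaginary parts of `v`. -/
def part (c : ℂ →L[ℝ] ℝ) (v : CN N) : RN N := WithLp.toLp 2 fun j => c (v j)

theorem continuous_part (c : ℂ →L[ℝ] ℝ) : Continuous (part c : CN N → RN N) := by
  unfold part
  fun_prop

theorem apply_cdot (c : ℂ →L[ℝ] ℝ) (v : CN N) (h : RN N) :
    c (cdot v h) = inner ℝ h (part c v) := by
  simp only [cdot, map_sum, part, PiLp.inner_apply]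
  refine Finset.sum_congr rfl fun j _ => ?_
  rw [mul_comm, ← Complex.real_smul, map_smul]
  simp [mul_comm]

theorem ePow_cdot (v : CN N) (h : RN N) :
    ePow p (cdot v h) = ‖(inner ℝ h (part Complex.reCLM v) : ℝ)‖ₑ ^ p +
      ‖(inner ℝ h (part Complex.imCLM v) : ℝ)‖ₑ ^ p := by
  simp only [ePow, ← apply_cdot, Complex.reCLM_apply, Complex.imCLM_apply]

theorem enorm_le_enorm_part_add (v : CN N) :
    ‖v‖ₑ ≤ ‖part Complex.reCLM v‖ₑ + ‖part Complex.imCLM v‖ₑ := by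
  have hv : toCN (part Complex.reCLM v) + Complex.I • toCN (part Complex.imCLM v) = v := by
    ext j
    simp [toCN, part, mul_comm Complex.I]
  conv_lhs => rw [← hv]
  refine (enorm_add_le _ _).trans_eq ?_
  simp only [← ofReal_norm, norm_smul, norm_toCN, Complex.norm_I, one_mul]

theorem exists_mul_enorm_rpow_le_coneMass (hp : 1 ≤ p) (hK0 : K ∈ 𝓝 0) :
    ∃ c ≠ 0, ∀ v : CN N, c * ‖v‖ₑ ^ p ≤ coneMass volume K p fun h => ePow p (cdot v h) := by
  have hp0 : 0 < p := by linarith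
  obtain ⟨c, hc0, hc⟩ := exists_mul_enorm_rpow_le_setLIntegral_inner (μ := volume) hp0.le hK0
  have h2 : (2 : ℝ≥0∞) ^ (p - 1) ≠ ⊤ := ENNReal.rpow_ne_top_of_nonneg (by linarith) (by simp)
  refine ⟨ENNReal.ofReal (Module.finrank ℝ (RN N) + p) * (c / 2 ^ (p - 1)), mul_ne_zero
    (ENNReal.ofReal_pos.2 (by positivity)).ne' (ENNReal.div_ne_zero.2 ⟨hc0, h2⟩), fun v => ?_⟩
  rw [coneMass, mul_assoc]
  gcongr
  calc c / 2 ^ (p - 1) * ‖v‖ₑ ^ p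
      ≤ c / 2 ^ (p - 1) * (2 ^ (p - 1) *
          (‖part Complex.reCLM v‖ₑ ^ p + ‖part Complex.imCLM v‖ₑ ^ p)) := by
        gcongr
        exact (ENNReal.rpow_le_rpow (enorm_le_enorm_part_add v) hp0.le).trans
          (ENNReal.rpow_add_le_mul_rpow_add_rpow _ _ hp)
    _ = c * ‖part Complex.reCLM v‖ₑ ^ p + c * ‖part Complex.imCLM v‖ₑ ^ p := by
        rw [← mul_assoc, ENNReal.div_mul_cancel (by simp) h2, mul_add]
    _ ≤ _ := add_le_add (hc _) (hc _)
    _ = ∫⁻ h in K, ePow p (cdot v h) := by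
        simp only [ePow_cdot]
        exact (lintegral_add_left (by fun_prop) _).symm

end CdotLowerBound

theorem le_of_forall_le_add_mul {x y c : ℝ≥0∞} (hc : c ≠ ⊤)
    (h : ∀ a : ℝ≥0∞, a ≠ 0 → x ≤ y + a * c) : x ≤ y := by
  have hlim : Tendsto (fun a : ℝ≥0∞ => y + a * c) (𝓝[≠] 0) (𝓝 (y + 0 * c)) :=
    ((ENNReal.Tendsto.mul_const tendsto_id (Or.inr hc)).mono_left nhdsWithin_le_nhds).const_add y
  rw [zero_mul, add_zero] at hlim
  exact ge_of_tendsto hlim (eventually_mem_nhdsWithin.mono h)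

section SobolevLimit

variable {N : ℕ} {K : Set (RN N)} {A : RN N → RN N} {u : RN N → ℂ} {G : RN N → CN N} {p : ℝ}

theorem nonlocalEnergy_congr {u' : RN N → ℂ} (hu : u =ᵐ[volume] u') (ρ : ℝ → ℝ) :
    nonlocalEnergy p K A ρ u = nonlocalEnergy p K A ρ u' := by
  refine lintegral_congr_ae ?_
  filter_upwards [Measure.quasiMeasurePreserving_fst.ae hu,
    Measure.quasiMeasurePreserving_snd.ae hu] with z hz1 hz2
  simp only [Psi, hz1, hz2]

theorem magEnergy_congr {u' : RN N → ℂ} {g g' : RN N → CN N} (hu : u =ᵐ[volume] u')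
    (hg : g =ᵐ[volume] g') : magEnergy p K A u g = magEnergy p K A u' g' := by
  refine lintegral_congr_ae ?_
  filter_upwards [hu, hg] with x h1 h2
  rw [h1, h2]

theorem shiftEnergy_le (hp : 1 ≤ p) (hA : Continuous A) (hum : StronglyMeasurable u) (h : RN N) :
    shiftEnergy p A u h ≤ 2 * (2 * eLpNorm u (ENNReal.ofReal p) volume) ^ p := by
  have hms := (measurable_magShift hA hum h).aestronglyMeasurable (μ := volume)
  calc shiftEnergy p A u h ≤ ∫⁻ x, 2 * ‖(magShift A h u - u) x‖ₑ ^ p :=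
        lintegral_mono fun x => ePow_le (by linarith) _
    _ = 2 * eLpNorm (magShift A h u - u) (ENNReal.ofReal p) volume ^ p := by
        rw [eLpNorm_ofReal_rpow (by linarith), lintegral_const_mul' _ _ ENNReal.ofNat_ne_top]
    _ ≤ _ := by
        gcongr
        refine (eLpNorm_sub_le hms hum.aestronglyMeasurable (by simpa using hp)).trans ?_
        rw [eLpNorm_magShift hum.aestronglyMeasurable, two_mul]

theorem memLp_of_coneMass_dirEnergy_lt_top (hp : 1 ≤ p) (hK0 : K ∈ 𝓝 0)
    (hG : StronglyMeasurable G) (hfin : coneMass volume K p (dirEnergy p G) < ⊤) :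
    MemLp G (ENNReal.ofReal p) volume := by
  have hp0 : 0 < p := by linarith
  obtain ⟨c, hc0, hc⟩ := exists_mul_enorm_rpow_le_coneMass hp hK0
  have hle : c * eLpNorm G (ENNReal.ofReal p) volume ^ p ≤ coneMass volume K p (dirEnergy p G) := by
    rw [eLpNorm_ofReal_rpow hp0, ← lintegral_const_mul _ (hG.measurable.enorm.pow_const p),
      coneMass_dirEnergy hG]
    exact lintegral_mono fun x => hc (G x)
  refine ⟨hG.aestronglyMeasurable, lt_top_iff_ne_top.2 fun htop => ?_⟩
  rw [htop, ENNReal.top_rpow_of_pos hp0, ENNReal.mul_top hc0] at hle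
  exact hle.not_gt hfin

theorem eLpNorm_cdot_le (hp : 0 < p) (G : RN N → CN N) (h : RN N) :
    eLpNorm (fun x => cdot (G x) h) (ENNReal.ofReal p) volume ≤
      eLpNorm G (ENNReal.ofReal p) volume * ‖h‖ₑ := by
  calc _ ≤ eLpNorm (fun x => ‖h‖ₑ * ‖G x‖ₑ) (ENNReal.ofReal p) volume :=
        eLpNorm_mono_enorm fun x => by simpa using enorm_cdot_le _ _
    _ = _ := by rw [eLpNorm_const_mul_ennreal hp enorm_ne_top, eLpNorm_enorm, mul_comm]

theorem eventually_shiftEnergy_dirEnergy_close (hp : 1 ≤ p) {L : NNReal} (hA : LipschitzWith L A)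
    (hum : StronglyMeasurable u) (hu : MemLp u (ENNReal.ofReal p) volume)
    (hG : MemLp G (ENNReal.ofReal p) volume) (hGu : ∀ φ, magGrad φ A u = moll φ G)
    {a : ℝ≥0∞} (ha : a ≠ 0) :
    ∀ᶠ h in 𝓝 0, shiftEnergy p A u h ≤ dirEnergy p G h + a * ‖h‖ₑ ^ p ∧
      dirEnergy p G h ≤ shiftEnergy p A u h + a * ‖h‖ₑ ^ p := by
  have hp0 : 0 < p := by linarith
  obtain ⟨e, he, he0⟩ := ((eventually_forall_add_rpow_le hp0 hG.2.ne
    (ENNReal.half_pos ha).ne').filter_mono nhdsWithin_le_nhds |>.and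
      (eventually_mem_nhdsWithin (s := {0}ᶜ))).exists
  filter_upwards [eventually_eLpNorm_magRemainder_le hp hA hum hu hG hGu he0] with h hrem
  have hshift : AEStronglyMeasurable (fun x => magShift A h u x - u x) volume :=
    ((measurable_magShift hA.continuous hum h).sub hum.measurable).aestronglyMeasurable
  have hdir := aestronglyMeasurable_cdot hG.1 h
  have hB := eLpNorm_cdot_le hp0 G h
  have ha2 : 2 * (a / 2) = a := ENNReal.mul_div_cancel two_ne_zero ENNReal.ofNat_ne_top
  constructor
  · simpa only [shiftEnergy, dirEnergy, ha2] using
      lintegral_ePow_le_add_mul hp he enorm_ne_top hshift hdir ((min_le_right _ _).trans hB) hrem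
  · simpa only [shiftEnergy, dirEnergy, ha2] using
      lintegral_ePow_le_add_mul hp he enorm_ne_top hdir hshift ((min_le_left _ _).trans hB)
        (by rwa [eLpNorm_sub_comm])

theorem tendsto_lintegral_shiftEnergy [Nontrivial (RN N)] (hp : 1 ≤ p) (hKc : Convex ℝ K)
    (hKb : Bornology.IsBounded K) (hK0 : K ∈ 𝓝 0) {ρ : ℕ → ℝ → ℝ}
    (hρ : IsMollifierSeq N p ρ) {L : NNReal} (hA : LipschitzWith L A)
    (hum : StronglyMeasurable u) (hu : MemLp u (ENNReal.ofReal p) volume)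
    (hGm : StronglyMeasurable G) (hG : MemLp G (ENNReal.ofReal p) volume)
    (hGu : ∀ φ, magGrad φ A u = moll φ G) :
    Tendsto (fun n => ∫⁻ h, shiftEnergy p A u h * radialKernel p (ρ n) (gauge K h)) atTop
      (𝓝 (coneMass volume K p (dirEnergy p G))) := by
  have hp0 : 0 ≤ p := by linarith
  rw [← finrank_euclideanSpace_fin (𝕜 := ℝ) (n := N)] at hρ
  have hclose (a : ℝ≥0∞) (ha : a ≠ 0) :=
    eventually_shiftEnergy_dirEnergy_close hp hA hum hu hG hGu ha
  have hbound : 2 * (2 * eLpNorm u (ENNReal.ofReal p) volume) ^ p ≠ ⊤ :=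
    ENNReal.mul_ne_top ENNReal.ofNat_ne_top (ENNReal.rpow_ne_top_of_nonneg hp0
      (ENNReal.mul_ne_top ENNReal.ofNat_ne_top hu.2.ne))
  have hcone := (coneMass_enorm_rpow_lt_top (μ := (volume : Measure (RN N))) hKb hp0).ne
  refine tendsto_of_le_liminf_of_limsup_le
    (le_of_forall_le_add_mul hcone fun a ha => ?_) (le_of_forall_le_add_mul hcone fun a ha => ?_)
  · exact coneMass_le_liminf_lintegral_mul_radialKernel_add hKc hKb hK0 hρ hp0
      (measurable_dirEnergy hGm) (isPosHomogeneous_dirEnergy hp0 G)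
      ((hclose a ha).mono fun _ => And.right)
  · exact limsup_lintegral_mul_radialKernel_le_add hKc hKb hK0 hρ hp0
      (measurable_dirEnergy hGm) (isPosHomogeneous_dirEnergy hp0 G) hbound
      (shiftEnergy_le hp hA.continuous hum) ((hclose a ha).mono fun _ => And.left)

theorem stronglyMeasurable_magField (hA : Continuous A) (hum : StronglyMeasurable u)
    {g : RN N → CN N} (hg : StronglyMeasurable g) : StronglyMeasurable (magField A u g) := by
  unfold magField
  exact hg.sub ((stronglyMeasurable_const.mul hum).smul
    (continuous_toCN.comp hA).stronglyMeasurable)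

theorem tendsto_nonlocalEnergy_sobolev [Nontrivial (RN N)] (hp : 1 ≤ p) (hKc : Convex ℝ K)
    (hKs : ∀ x ∈ K, -x ∈ K) (hKb : Bornology.IsBounded K) (hK0 : K ∈ 𝓝 0)
    {ρ : ℕ → ℝ → ℝ} (hρ : IsMollifierSeq N p ρ) {L : NNReal} (hA : LipschitzWith L A)
    (hu : MemMagSobolev p K A u) {g : RN N → CN N} (hg : IsWeakGradient u g) :
    Tendsto (fun n => nonlocalEnergy p K A (ρ n) u) atTop
      (𝓝 (ENNReal.ofReal p * magEnergy p K A u g)) := by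
  have hp0 : 0 < p := by linarith
  obtain ⟨huL, g₀, hg₀, hfin⟩ := hu
  have hgm := hg.2.1.aestronglyMeasurable
  set v := huL.1.mk u
  set f := hgm.mk g
  have huv : u =ᵐ[volume] v := huL.1.ae_eq_mk
  have hgf : g =ᵐ[volume] f := hgm.ae_eq_mk
  have hvm : StronglyMeasurable v := huL.1.stronglyMeasurable_mk
  have hGm := stronglyMeasurable_magField hA.continuous hvm hgm.stronglyMeasurable_mk
  have hE : ENNReal.ofReal p * magEnergy p K A u g =
      coneMass volume K p (dirEnergy p (magField A v f)) := by
    rw [magEnergy_congr huv hgf]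
    exact ofReal_mul_lintegral_polarMomentNorm hp0 hKb hGm
  have hfin' : coneMass volume K p (dirEnergy p (magField A v f)) < ⊤ := by
    rw [← hE, magEnergy_congr (EventuallyEq.refl _ u) (hg.ae_eq hg₀)]
    exact ENNReal.mul_lt_top ENNReal.ofReal_lt_top hfin
  rw [hE]
  refine (tendsto_lintegral_shiftEnergy hp hKc hKb hK0 hρ hA hvm (huL.ae_eq huv) hGm
    (memLp_of_coneMass_dirEnergy_lt_top hp hK0 hGm hfin')
    ((hg.congr huv hgf).magGrad_eq_moll hA.continuous)).congr fun n => ?_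
  rw [nonlocalEnergy_congr huv, nonlocalEnergy_eq_lintegral hp0 hKc hKs hKb hK0
    (hρ.aemeasurable_radialKernel n) hA.continuous hvm]

end SobolevLimit

section Sign

theorem abs_sign_le_one (t : ℝ) : |(SignType.sign t : ℝ)| ≤ 1 := by
  rcases lt_trichotomy t 0 with h | rfl | h <;> simp [*]

theorem measurable_sign : Measurable fun t : ℝ => (SignType.sign t : ℝ) := by
  have hsign : (fun t : ℝ => (SignType.sign t : ℝ)) =
      fun t => if 0 < t then 1 else if t < 0 then -1 else 0 := by
    ext t
    rw [sign_apply]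
    split_ifs <;> simp
  rw [hsign]
  exact .ite measurableSet_Ioi measurable_const
    (.ite measurableSet_Iio measurable_const measurable_const)

end Sign

section Moment

variable {N : ℕ} {K : Set (RN N)}

/-- The restriction `(N + 1) ∫_K |h · w| dh` to real vectors of the norm `polarMomentNorm 1 K`. -/
def momentNorm (K : Set (RN N)) (w : RN N) : ℝ := ((N : ℝ) + 1) * ∫ h in K, |inner ℝ h w|

theorem polarMomentNorm_one_toCN (w : RN N) : polarMomentNorm 1 K (toCN w) = momentNorm K w := by
  simp [polarMomentNorm, momentNorm, absP, cdot_toCN]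

theorem momentNorm_nonneg (w : RN N) : 0 ≤ momentNorm K w :=
  mul_nonneg (by positivity) (integral_nonneg fun _ => abs_nonneg _)

theorem integrableOn_of_continuous (hKb : Bornology.IsBounded K) {F : Type*}
    [NormedAddCommGroup F] {f : RN N → F} (hf : Continuous f) : IntegrableOn f K := by
  obtain ⟨R, hR⟩ := hKb.subset_closedBall (0 : RN N)
  exact (hf.continuousOn.integrableOn_compact (isCompact_closedBall _ _)).mono_set hR

theorem ofReal_momentNorm (hKb : Bornology.IsBounded K) (w : RN N) :
    ENNReal.ofReal (momentNorm K w) =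
      coneMass volume K 1 fun h => ‖(inner ℝ h w : ℝ)‖ₑ := by
  rw [momentNorm, ENNReal.ofReal_mul (by positivity), ofReal_integral_eq_lintegral_ofReal
    (integrableOn_of_continuous hKb (by fun_prop)) (Eventually.of_forall fun _ => abs_nonneg _),
    coneMass, finrank_euclideanSpace_fin]
  simp only [Real.enorm_eq_ofReal_abs]

theorem measurable_momentNorm : Measurable (momentNorm K) := by
  have hjoint : StronglyMeasurable fun q : RN N × RN N => |(inner ℝ q.2 q.1 : ℝ)| :=
    Continuous.stronglyMeasurable (by fun_prop)
  exact (hjoint.integral_prod_right' (ν := volume.restrict K)).measurable.const_mul _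

theorem momentNorm_smul {t : ℝ} (ht : 0 ≤ t) (w : RN N) :
    momentNorm K (t • w) = t * momentNorm K w := by
  simp only [momentNorm, real_inner_smul_right, abs_mul, abs_of_nonneg ht, integral_const_mul]
  ring

theorem exists_mul_norm_le_momentNorm (hKb : Bornology.IsBounded K) (hK0 : K ∈ 𝓝 0) :
    ∃ c > 0, ∀ w, c * ‖w‖ ≤ momentNorm K w := by
  obtain ⟨c, hc0, hc⟩ :=
    exists_mul_enorm_rpow_le_setLIntegral_inner (μ := volume) zero_le_one hK0
  have hc1 : min c 1 ≠ ⊤ := ne_top_of_le_ne_top ENNReal.one_ne_top (min_le_right _ _)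
  refine ⟨(min c 1).toReal,
    ENNReal.toReal_pos (lt_min (pos_iff_ne_zero.2 hc0) one_pos).ne' hc1, fun w => ?_⟩
  rw [← ENNReal.ofReal_le_ofReal_iff (momentNorm_nonneg w), ofReal_momentNorm hKb,
    ENNReal.ofReal_mul (by positivity), ENNReal.ofReal_toReal hc1, ofReal_norm, coneMass]
  have hcw := hc w
  simp only [ENNReal.rpow_one] at hcw
  calc min c 1 * ‖w‖ₑ ≤ c * ‖w‖ₑ := by gcongr; exact min_le_left _ _
    _ ≤ ∫⁻ h in K, ‖(inner ℝ h w : ℝ)‖ₑ := hcw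
    _ ≤ _ := le_mul_of_one_le_left zero_le <| by
      rw [ENNReal.one_le_ofReal]
      exact le_add_of_nonneg_left (by positivity)

theorem bddAbove_inner_polarMomentNorm_le_one (hKb : Bornology.IsBounded K) (hK0 : K ∈ 𝓝 0)
    (v : RN N) :
    BddAbove {t : ℝ | ∃ w : RN N, polarMomentNorm 1 K (toCN w) ≤ 1 ∧ t = inner ℝ v w} := by
  obtain ⟨c, hc0, hc⟩ := exists_mul_norm_le_momentNorm hKb hK0
  refine ⟨‖v‖ * c⁻¹, ?_⟩
  rintro t ⟨w, hw, rfl⟩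
  rw [polarMomentNorm_one_toCN] at hw
  refine (real_inner_le_norm _ _).trans ?_
  gcongr
  rw [← one_div, le_div_iff₀ hc0, mul_comm]
  exact (hc w).trans hw

theorem dualMomentNorm_le_one_iff (hKb : Bornology.IsBounded K) (hK0 : K ∈ 𝓝 0) {v : RN N} :
    dualMomentNorm K v ≤ 1 ↔ ∀ w, inner ℝ v w ≤ momentNorm K w := by
  refine ⟨fun hv w => ?_, fun hv => Real.sSup_le ?_ zero_le_one⟩
  · obtain ⟨c, hc0, hc⟩ := exists_mul_norm_le_momentNorm hKb hK0
    rcases eq_or_ne w 0 with rfl | hw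
    · simpa using momentNorm_nonneg (K := K) (0 : RN N)
    have hpos : 0 < momentNorm K w := lt_of_lt_of_le (by positivity) (hc w)
    have hunit : inner ℝ v ((momentNorm K w)⁻¹ • w) ≤ dualMomentNorm K v := by
      refine le_csSup (bddAbove_inner_polarMomentNorm_le_one hKb hK0 v) ⟨_, ?_, rfl⟩
      rw [polarMomentNorm_one_toCN, momentNorm_smul (by positivity), inv_mul_cancel₀ hpos.ne']
    rw [real_inner_smul_right] at hunit
    simpa only [inv_mul_le_iff₀ hpos, mul_one] using hunit.trans hv
  · rintro t ⟨w, hw, rfl⟩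
    rw [polarMomentNorm_one_toCN] at hw
    exact (hv w).trans hw

/-- The vector `-(N + 1) ∫_K sign(h · w) h dh`. Among the vectors of dual norm at most `1` it
minimizes the pairing with `w`, the minimum being `-momentNorm K w`. -/
def signField (K : Set (RN N)) (w : RN N) : RN N :=
  -(((N : ℝ) + 1) • ∫ h in K, (SignType.sign (inner ℝ h w : ℝ) : ℝ) • h)

theorem norm_sign_smul_le (t : ℝ) (h : RN N) : ‖(SignType.sign t : ℝ) • h‖ ≤ ‖h‖ := by
  rw [norm_smul, Real.norm_eq_abs]
  exact mul_le_of_le_one_left (norm_nonneg _) (abs_sign_le_one t)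

theorem integrableOn_sign_smul (hKb : Bornology.IsBounded K) (w : RN N) :
    IntegrableOn (fun h : RN N => (SignType.sign (inner ℝ h w : ℝ) : ℝ) • h) K := by
  refine (integrableOn_of_continuous hKb continuous_norm).mono' ?_
    (Eventually.of_forall fun h => norm_sign_smul_le _ h)
  have hsign : Measurable fun h : RN N => (SignType.sign (inner ℝ h w : ℝ) : ℝ) :=
    measurable_sign.comp (by fun_prop)
  exact (hsign.smul measurable_id).aestronglyMeasurable

theorem inner_signField (hKb : Bornology.IsBounded K) (w v : RN N) :
    inner ℝ (signField K w) v =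
      -(((N : ℝ) + 1) * ∫ h in K, (SignType.sign (inner ℝ h w : ℝ) : ℝ) * inner ℝ h v) := by
  have hcomm := ((innerSL ℝ) v).integral_comp_comm (integrableOn_sign_smul hKb w)
  simp only [innerSL_apply_apply, real_inner_smul_right] at hcomm
  rw [signField, inner_neg_left, real_inner_smul_left, real_inner_comm, ← hcomm]
  simp only [real_inner_comm v]

theorem inner_signField_self (hKb : Bornology.IsBounded K) (w : RN N) :
    inner ℝ (signField K w) w = - momentNorm K w := by
  rw [inner_signField hKb, momentNorm]
  simp only [sign_mul_self]

theorem inner_signField_le (hKb : Bornology.IsBounded K) (w v : RN N) :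
    inner ℝ (signField K w) v ≤ momentNorm K v := by
  rw [inner_signField hKb, momentNorm, ← mul_neg]
  gcongr
  have hint : IntegrableOn (fun h : RN N => |(inner ℝ h v : ℝ)|) K :=
    integrableOn_of_continuous hKb (by fun_prop)
  refine (neg_le_abs _).trans ((Real.norm_eq_abs _).symm.trans_le
    (norm_integral_le_of_norm_le hint (Eventually.of_forall fun h => ?_)))
  rw [norm_mul, Real.norm_eq_abs, Real.norm_eq_abs]
  exact mul_le_of_le_one_left (abs_nonneg _) (abs_sign_le_one _)

theorem norm_signField_le (hKb : Bornology.IsBounded K) (w : RN N) :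
    ‖signField K w‖ ≤ ((N : ℝ) + 1) * ∫ h in K, ‖h‖ := by
  rw [signField, norm_neg, norm_smul, Real.norm_of_nonneg (by positivity)]
  gcongr
  exact norm_integral_le_of_norm_le (integrableOn_of_continuous hKb continuous_norm)
    (Eventually.of_forall fun h => norm_sign_smul_le _ h)

theorem stronglyMeasurable_signField : StronglyMeasurable (signField K) := by
  have hsign : Measurable fun q : RN N × RN N => (SignType.sign (inner ℝ q.2 q.1 : ℝ) : ℝ) :=
    measurable_sign.comp (by fun_prop)
  have hjoint := (hsign.smul measurable_snd).stronglyMeasurable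
  exact ((hjoint.integral_prod_right' (ν := volume.restrict K)).const_smul ((N : ℝ) + 1)).neg

theorem ofReal_polarMomentNorm_one (hKb : Bornology.IsBounded K) (v : CN N) :
    ENNReal.ofReal (polarMomentNorm 1 K v) =
      coneMass volume K 1 fun h => ePow 1 (cdot v h) := by
  simpa using ofReal_polarMomentNorm_rpow one_pos hKb v

theorem ofReal_polarMomentNorm_one_eq_add (hKb : Bornology.IsBounded K) (v : CN N) :
    ENNReal.ofReal (polarMomentNorm 1 K v) =
      ENNReal.ofReal (momentNorm K (part Complex.reCLM v)) +
        ENNReal.ofReal (momentNorm K (part Complex.imCLM v)) := by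
  simp only [ofReal_polarMomentNorm_one hKb, ePow_cdot, ENNReal.rpow_one, ofReal_momentNorm hKb]
  exact coneMass_add 1 (by fun_prop) _

theorem lintegral_polarMomentNorm_one (hKb : Bornology.IsBounded K) {G : RN N → CN N}
    (hG : StronglyMeasurable G) :
    ∫⁻ x, ENNReal.ofReal (polarMomentNorm 1 K (G x)) = coneMass volume K 1 (dirEnergy 1 G) := by
  simpa using ofReal_mul_lintegral_polarMomentNorm one_pos hKb hG

end Moment

section BoundedPairing

open scoped Pointwise

variable {E V : Type*} [NormedAddCommGroup E] [MeasurableSpace E]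
  [NormedAddCommGroup V] {μ : Measure E}

theorem locallyIntegrable_of_bound [IsLocallyFiniteMeasure μ] {F : E → V}
    (hF : AEStronglyMeasurable F μ) {C : ℝ} (hC : ∀ x, ‖F x‖ ≤ C) : LocallyIntegrable F μ :=
  (locallyIntegrable_const C).mono hF
    (Eventually.of_forall fun x => (hC x).trans (le_abs_self C))

variable [NormedSpace ℝ V] {F : E → ℝ} {w : E → V} {C : ℝ}

theorem integrable_smul_of_bound (hF : AEStronglyMeasurable F μ) (hC : ∀ x, ‖F x‖ ≤ C)
    (hFc : HasCompactSupport F) (hw : LocallyIntegrable w μ) :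
    Integrable (fun x => F x • w x) μ := by
  refine (integrableOn_iff_integrable_of_support_subset (s := tsupport F) ?_).1 <|
    (hw.integrableOn_isCompact hFc).bdd_smul C hF.restrict (Eventually.of_forall hC)
  exact (Function.support_smul_subset_left F w).trans (subset_tsupport F)

theorem integral_smul_integral_swap [CompleteSpace V] [BorelSpace E] [SFinite μ]
    [IsFiniteMeasureOnCompacts μ] [μ.IsAddLeftInvariant] [SecondCountableTopology E]
    {κ : E → ℝ} (hκ : Continuous κ) (hκc : HasCompactSupport κ)
    (hF : AEStronglyMeasurable F μ) (hC : ∀ x, ‖F x‖ ≤ C) (hFc : HasCompactSupport F)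
    (hw : LocallyIntegrable w μ) :
    ∫ x, F x • ∫ y, κ (x - y) • w y ∂μ ∂μ = ∫ y, (∫ x, κ (x - y) * F x ∂μ) • w y ∂μ := by
  have hS : IsCompact (tsupport F - tsupport κ) := by
    rw [← sub_image_prod]
    exact (IsCompact.prod hFc hκc).image continuous_sub
  have hwS : Integrable ((tsupport F - tsupport κ).indicator w) μ :=
    (hw.integrableOn_isCompact hS).integrable_indicator hS.measurableSet
  have hprod := (hwS.convolution_integrand (ContinuousLinearMap.lsmul ℝ ℝ).flip
    (hκ.integrable_of_hasCompactSupport (μ := μ) hκc)).bdd_smul C hF.comp_fst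
    (Eventually.of_forall fun q => hC q.1)
  have hint : Integrable (Function.uncurry fun x y => F x • κ (x - y) • w y) (μ.prod μ) := by
    refine hprod.congr (Eventually.of_forall fun ⟨x, y⟩ => ?_)
    by_cases hy : y ∈ tsupport F - tsupport κ
    · simp [hy]
    by_cases hx : F x = 0
    · simp [hx]
    have hxy : κ (x - y) = 0 := by
      by_contra hxy
      exact hy ⟨x, subset_tsupport F hx, x - y, subset_tsupport κ hxy, sub_sub_cancel x y⟩
    simp [hxy]
  calc ∫ x, F x • ∫ y, κ (x - y) • w y ∂μ ∂μ
      = ∫ x, ∫ y, F x • κ (x - y) • w y ∂μ ∂μ := by simp only [integral_smul]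
    _ = ∫ y, ∫ x, F x • κ (x - y) • w y ∂μ ∂μ := integral_integral_swap hint
    _ = _ := by simp only [smul_smul, mul_comm, integral_smul_const]

end BoundedPairing

section MollPairing

variable {E V : Type*} [NormedAddCommGroup E] [NormedSpace ℝ E] [FiniteDimensional ℝ E]
  [MeasureSpace E] [NormedAddCommGroup V] [NormedSpace ℝ V] (φ : ContDiffBump (0 : E))
  {F : E → ℝ} {w : E → V} {C : ℝ}

theorem fderiv_normed_neg (x h : E) :
    fderiv ℝ (φ.normed volume) (-x) h = -fderiv ℝ (φ.normed volume) x h := by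
  have hneg := fderiv_normed_comp_sub φ 0 x h
  simp only [zero_sub, φ.normed_neg] at hneg
  rw [hneg, neg_neg]

variable [BorelSpace E] [(volume : Measure E).IsAddHaarMeasure]

theorem integral_moll_smul [CompleteSpace V] (hF : AEStronglyMeasurable F volume)
    (hC : ∀ x, ‖F x‖ ≤ C) (hFc : HasCompactSupport F) (hw : LocallyIntegrable w volume) :
    ∫ x, moll φ F x • w x = ∫ x, F x • moll φ w x := by
  simp only [moll_apply_swap]
  rw [integral_smul_integral_swap φ.continuous_normed φ.hasCompactSupport_normed hF hC hFc hw]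
  refine integral_congr_ae (.of_forall fun y => congrArg (· • w y)
    (integral_congr_ae (.of_forall fun x => ?_)))
  dsimp only
  rw [← neg_sub x y, φ.normed_neg, smul_eq_mul]

theorem integral_fderiv_moll_smul [CompleteSpace V] (hF : AEStronglyMeasurable F volume)
    (hC : ∀ x, ‖F x‖ ≤ C) (hFc : HasCompactSupport F) (hw : LocallyIntegrable w volume) (h : E) :
    ∫ x, fderiv ℝ (moll φ F) x h • w x = -∫ x, F x • fderiv ℝ (moll φ w) x h := by
  have hκ : Continuous fun x => fderiv ℝ (φ.normed volume) x h :=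
    (φ.contDiff_normed.continuous_fderiv one_ne_zero).clm_apply continuous_const
  simp only [fderiv_moll φ (locallyIntegrable_of_bound hF hC), fderiv_moll φ hw]
  rw [integral_smul_integral_swap hκ (φ.hasCompactSupport_normed.fderiv_apply (𝕜 := ℝ) h) hF hC
    hFc hw, ← integral_neg]
  simp only [← neg_smul, ← integral_neg]
  refine integral_congr_ae (.of_forall fun y => congrArg (· • w y)
    (integral_congr_ae (.of_forall fun x => ?_)))
  dsimp only
  rw [← neg_sub x y, fderiv_normed_neg, smul_eq_mul, neg_mul]

theorem norm_moll_le {f : E → V} (hC : ∀ x, ‖f x‖ ≤ C) (x : E) : ‖moll φ f x‖ ≤ C := by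
  rw [moll_apply]
  refine (norm_integral_le_of_norm_le (φ.integrable_normed.mul_const C)
    (Eventually.of_forall fun z => ?_)).trans_eq ?_
  · rw [norm_smul, Real.norm_of_nonneg (φ.nonneg_normed z)]
    exact mul_le_mul_of_nonneg_left (hC _) (φ.nonneg_normed z)
  · rw [integral_mul_const, φ.integral_normed, one_mul]

theorem moll_eq_zero_of_notMem_cthickening [CompleteSpace V] {f : E → V} {r : ℝ}
    (hr : φ.rOut ≤ r) {x : E} (hx : x ∉ Metric.cthickening r (tsupport f)) : moll φ f x = 0 := by
  have hf : ∀ z ∈ Metric.ball x φ.rOut, f z = 0 := fun z hz => by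
    by_contra hne
    exact hx (Metric.mem_cthickening_of_dist_le _ _ _ _ (subset_tsupport f hne)
      ((dist_comm x z).trans_le (hz.le.trans hr)))
  have hfx := hf x (Metric.mem_ball_self φ.rOut_pos)
  exact (φ.normed_convolution_eq_right fun z hz => (hf z hz).trans hfx.symm).trans hfx

theorem tendsto_integral_moll_smul {φ : ℕ → ContDiffBump (0 : E)}
    (hφ : Tendsto (fun k => (φ k).rOut) atTop (𝓝 0)) (hF : Continuous F)
    (hFc : HasCompactSupport F) (hw : LocallyIntegrable w volume) :
    Tendsto (fun k => ∫ x, moll (φ k) F x • w x) atTop (𝓝 (∫ x, F x • w x)) := by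
  obtain ⟨C, hC⟩ := hFc.exists_bound_of_continuous hF
  have hS : IsCompact (Metric.cthickening 1 (tsupport F)) := hFc.isCompact.cthickening
  refine tendsto_integral_filter_of_dominated_convergence
    ((Metric.cthickening 1 (tsupport F)).indicator fun y => C * ‖w y‖) ?_ ?_ ?_ ?_
  · exact .of_forall fun k => (continuous_moll (φ k) hF.locallyIntegrable).aestronglyMeasurable.smul
      hw.aestronglyMeasurable
  · filter_upwards [hφ.eventually (gt_mem_nhds one_pos)] with k hk
    refine .of_forall fun x => ?_
    by_cases hx : x ∈ Metric.cthickening 1 (tsupport F)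
    · rw [indicator_of_mem hx, norm_smul]
      gcongr
      exact norm_moll_le (φ k) hC x
    · rw [indicator_of_notMem hx, moll_eq_zero_of_notMem_cthickening (φ k) hk.le hx, zero_smul,
        norm_zero]
  · exact IntegrableOn.integrable_indicator ((hw.integrableOn_isCompact hS).norm.const_mul C)
      hS.measurableSet
  · exact .of_forall fun x =>
      (ContDiffBump.convolution_tendsto_right_of_continuous hφ hF x).smul_const _

theorem fderiv_moll_of_contDiff (hF : ContDiff ℝ 1 F) (hFc : HasCompactSupport F) (x h : E) :
    fderiv ℝ (moll φ F) x h = moll φ (fun y => fderiv ℝ F y h) x := by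
  have hderiv := hFc.hasFDerivAt_convolution_right (μ := volume) (ContinuousLinearMap.lsmul ℝ ℝ)
    (φ.continuous_normed (μ := volume)).locallyIntegrable hF x
  have hfderiv : fderiv ℝ (moll φ F) x = _ := hderiv.fderiv
  rw [hfderiv, convolution_precompR_apply _ (φ.continuous_normed (μ := volume)).locallyIntegrable
    (hFc.fderiv (𝕜 := ℝ)) (hF.continuous_fderiv one_ne_zero)]
  rfl

end MollPairing

section Pairing

variable {N : ℕ} {K : Set (RN N)} {A : RN N → RN N} {u : RN N → ℂ} {ψ : RN N → RN N}

theorem cdot_eq_sum_smul (v : CN N) (h : RN N) : cdot v h = ∑ j, h j • v j := by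
  simp only [cdot, Complex.real_smul, mul_comm]

/-- The complex pairing `∫ (div ψ + i A · ψ) u`, whose real and imaginary parts are the functionals
maximized in the total magnetic variation. -/
def magPairing (A : RN N → RN N) (u : RN N → ℂ) (ψ : RN N → RN N) : ℂ :=
  ∑ j, ((∫ x, fderiv ℝ (fun y => ψ y j) x (EuclideanSpace.single j (1 : ℝ)) • u x) +
    Complex.I * ∫ x, ψ x j • ((A x j : ℂ) * u x))

theorem contDiff_coord {n : WithTop ℕ∞} (hψ : ContDiff ℝ n ψ) (j : Fin N) :
    ContDiff ℝ n fun y => ψ y j :=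
  (EuclideanSpace.proj j : RN N →L[ℝ] ℝ).contDiff.comp hψ

theorem hasCompactSupport_coord (hψ : HasCompactSupport ψ) (j : Fin N) :
    HasCompactSupport fun y => ψ y j :=
  hψ.comp_left (g := fun v : RN N => v j) rfl

theorem fderiv_coord (hψ : ContDiff ℝ 1 ψ) (j : Fin N) (x h : RN N) :
    fderiv ℝ (fun y => ψ y j) x h = (fderiv ℝ ψ x h) j := by
  have hderiv : HasFDerivAt (fun y => ψ y j) _ x :=
    (EuclideanSpace.proj j : RN N →L[ℝ] ℝ).hasFDerivAt.comp x
      (hψ.differentiable one_ne_zero x).hasFDerivAt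
  rw [hderiv.fderiv]
  rfl

theorem integrable_fderiv_coord_smul (hu : LocallyIntegrable u volume) (hψ : ContDiff ℝ 1 ψ)
    (hψc : HasCompactSupport ψ) (j : Fin N) (h : RN N) :
    Integrable fun x => fderiv ℝ (fun y => ψ y j) x h • u x :=
  hu.integrable_smul_left_of_hasCompactSupport
    (((contDiff_coord hψ j).continuous_fderiv one_ne_zero).clm_apply continuous_const)
    ((hasCompactSupport_coord hψc j).fderiv_apply (𝕜 := ℝ) _)

theorem integrable_coord_smul (hA : Continuous A) (hu : LocallyIntegrable u volume)
    (hψ : Continuous ψ) (hψc : HasCompactSupport ψ) (j : Fin N) :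
    Integrable fun x => ψ x j • ((A x j : ℂ) * u x) :=
  (locallyIntegrable_ofReal_mul (by fun_prop) hu).integrable_smul_left_of_hasCompactSupport
    (by fun_prop) (hasCompactSupport_coord hψc j)

/-- The integrand of `magPairing`, written with the divergence of the test field. -/
def magPairingIntegrand (A : RN N → RN N) (u : RN N → ℂ) (ψ : RN N → RN N) (x : RN N) : ℂ :=
  ((divergence ψ x : ℝ) : ℂ) * u x + Complex.I * (((inner ℝ (A x) (ψ x) : ℝ) : ℂ) * u x)

theorem magPairingIntegrand_eq_sum (hψ : ContDiff ℝ 1 ψ) : magPairingIntegrand A u ψ = fun x =>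
    ∑ j, (fderiv ℝ (fun y => ψ y j) x (EuclideanSpace.single j (1 : ℝ)) • u x +
      Complex.I * (ψ x j • ((A x j : ℂ) * u x))) := by
  ext x
  simp only [magPairingIntegrand, Finset.sum_add_distrib, fderiv_coord hψ, divergence,
    PiLp.inner_apply, Complex.real_smul, Complex.ofReal_sum, Finset.sum_mul, Finset.mul_sum]
  congr! 3 with j
  simp only [RCLike.inner_apply, conj_trivial, Complex.ofReal_mul]
  ring

theorem integrable_magPairingIntegrand (hA : Continuous A) (hu : LocallyIntegrable u volume)
    (hψ : ContDiff ℝ 1 ψ) (hψc : HasCompactSupport ψ) :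
    Integrable (magPairingIntegrand A u ψ) := by
  rw [magPairingIntegrand_eq_sum hψ]
  exact integrable_finsetSum _ fun j _ => (integrable_fderiv_coord_smul hu hψ hψc j _).add
    ((integrable_coord_smul hA hu hψ.continuous hψc j).const_mul _)

theorem magPairing_eq_integral (hA : Continuous A) (hu : LocallyIntegrable u volume)
    (hψ : ContDiff ℝ 1 ψ) (hψc : HasCompactSupport ψ) :
    magPairing A u ψ = ∫ x, magPairingIntegrand A u ψ x := by
  have hdiv := fun j => integrable_fderiv_coord_smul hu hψ hψc j (EuclideanSpace.single j 1)
  have hpot := fun j => (integrable_coord_smul hA hu hψ.continuous hψc j).const_mul Complex.I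
  have hsum : ∀ j, Integrable fun x =>
      fderiv ℝ (fun y => ψ y j) x (EuclideanSpace.single j (1 : ℝ)) • u x +
        Complex.I * (ψ x j • ((A x j : ℂ) * u x)) := fun j => (hdiv j).add (hpot j)
  simp only [magPairingIntegrand_eq_sum hψ, magPairing]
  rw [integral_finsetSum _ fun j _ => hsum j]
  exact Finset.sum_congr rfl fun j _ => by rw [integral_add (hdiv j) (hpot j), integral_const_mul]

/-- The supremum of `c (∫ (div ψ + i A · ψ) u)` over admissible fields, which for `c = Re` and
`c = Im` gives the two halves of the total magnetic variation. -/
def partVariation (c : ℂ →L[ℝ] ℝ) (K : Set (RN N)) (A : RN N → RN N) (u : RN N → ℂ) : ℝ≥0∞ :=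
  ⨆ (ψ : RN N → RN N) (_ : IsAdmissible K ψ), ENNReal.ofReal (c (magPairing A u ψ))

theorem variationRe_eq (hA : Continuous A) (hu : LocallyIntegrable u volume) :
    variationRe K A u = partVariation Complex.reCLM K A u := by
  refine iSup_congr fun ψ => iSup_congr fun ⟨hψ, hψc, _⟩ => ?_
  rw [magPairing_eq_integral hA hu hψ hψc,
    ← Complex.reCLM.integral_comp_comm (integrable_magPairingIntegrand hA hu hψ hψc)]
  congr! 3 with x
  simp [magPairingIntegrand]
  ring

theorem variationIm_eq (hA : Continuous A) (hu : LocallyIntegrable u volume) :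
    variationIm K A u = partVariation Complex.imCLM K A u := by
  refine iSup_congr fun ψ => iSup_congr fun ⟨hψ, hψc, _⟩ => ?_
  rw [magPairing_eq_integral hA hu hψ hψc,
    ← Complex.imCLM.integral_comp_comm (integrable_magPairingIntegrand hA hu hψ hψc)]
  congr! 3 with x
  simp [magPairingIntegrand]
  ring

variable (φ : ContDiffBump (0 : RN N)) {F : RN N → RN N} {C : ℝ}

theorem integrable_coord_smul_of_bound (hF : AEStronglyMeasurable F) (hC : ∀ x, ‖F x‖ ≤ C)
    (hFc : HasCompactSupport F) {w : RN N → ℂ} (hw : Continuous w) (j : Fin N) :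
    Integrable fun x => F x j • w x :=
  integrable_smul_of_bound (F := fun x => F x j)
    ((EuclideanSpace.proj j : RN N →L[ℝ] ℝ).continuous.comp_aestronglyMeasurable hF)
    (fun x => (PiLp.norm_apply_le (F x) j).trans (hC x)) (hasCompactSupport_coord hFc j)
    hw.locallyIntegrable

theorem integrable_cdot_magGrad (hA : Continuous A) (hu : LocallyIntegrable u volume)
    (hF : AEStronglyMeasurable F) (hC : ∀ x, ‖F x‖ ≤ C) (hFc : HasCompactSupport F) :
    Integrable fun x => cdot (magGrad φ A u x) (F x) := by
  simp only [cdot_eq_sum_smul]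
  exact integrable_finsetSum _ fun j _ => integrable_coord_smul_of_bound hF hC hFc
    ((EuclideanSpace.proj (𝕜 := ℂ) j).continuous.comp (continuous_magGrad φ hA hu)) j

-- Mollification is self-adjoint, so it can be moved from the field `F` onto `u` and `A u`.
theorem magPairing_moll (hA : Continuous A) (hu : LocallyIntegrable u volume)
    (hF : AEStronglyMeasurable F) (hC : ∀ x, ‖F x‖ ≤ C) (hFc : HasCompactSupport F) :
    magPairing A u (moll φ F) = -∫ x, cdot (magGrad φ A u x) (F x) := by
  have hG : ∀ j, Continuous fun x => magGrad φ A u x j := fun j =>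
    (EuclideanSpace.proj (𝕜 := ℂ) j).continuous.comp (continuous_magGrad φ hA hu)
  have hprod : ∀ {w : RN N → ℂ}, Continuous w → ∀ j, Integrable fun x => F x j • w x :=
    integrable_coord_smul_of_bound hF hC hFc
  simp only [cdot_eq_sum_smul]
  rw [integral_finsetSum _ fun j _ => hprod (hG j) j, ← Finset.sum_neg_distrib, magPairing]
  refine Finset.sum_congr rfl fun j _ => ?_
  have hFj : AEStronglyMeasurable (fun x => F x j) :=
    (EuclideanSpace.proj j : RN N →L[ℝ] ℝ).continuous.comp_aestronglyMeasurable hF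
  have hCj : ∀ x, ‖F x j‖ ≤ C := fun x => (PiLp.norm_apply_le (F x) j).trans (hC x)
  have hFjc := hasCompactSupport_coord hFc j
  have hAu : LocallyIntegrable (fun z => (A z j : ℂ) * u z) volume :=
    locallyIntegrable_ofReal_mul (by fun_prop) hu
  have hgrad : Continuous fun x => fderiv ℝ (moll φ u) x (EuclideanSpace.single j (1 : ℝ)) :=
    ((contDiff_moll φ hu 1).continuous_fderiv one_ne_zero).clm_apply continuous_const
  simp only [moll_apply_coord φ (locallyIntegrable_of_bound hF hC)]
  have hneg : Integrable fun x =>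
      -(F x j • fderiv ℝ (moll φ u) x (EuclideanSpace.single j (1 : ℝ))) := (hprod hgrad j).neg
  rw [integral_fderiv_moll_smul φ hFj hCj hFjc hu, integral_moll_smul φ hFj hCj hFjc hAu,
    ← integral_const_mul, ← integral_neg, ← integral_neg,
    ← integral_add hneg ((hprod (continuous_moll φ hAu) j).const_mul _)]
  congr 1 with x
  simp only [magGrad, Complex.real_smul]
  ring

theorem tendsto_magPairing_moll (hA : Continuous A) (hu : LocallyIntegrable u volume)
    {φ : ℕ → ContDiffBump (0 : RN N)} (hφ : Tendsto (fun k => (φ k).rOut) atTop (𝓝 0))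
    (hψ : ContDiff ℝ 1 ψ) (hψc : HasCompactSupport ψ) :
    Tendsto (fun k => magPairing A u (moll (φ k) ψ)) atTop (𝓝 (magPairing A u ψ)) := by
  refine tendsto_finsetSum _ fun j _ => ?_
  have hj := contDiff_coord hψ j
  have hjc := hasCompactSupport_coord hψc j
  simp only [moll_apply_coord _ hψ.continuous.locallyIntegrable, fderiv_moll_of_contDiff _ hj hjc]
  refine (tendsto_integral_moll_smul hφ ?_ (hjc.fderiv_apply (𝕜 := ℝ) _) hu).add
    ((tendsto_integral_moll_smul hφ hj.continuous hjc
      (locallyIntegrable_ofReal_mul (by fun_prop) hu)).const_mul _)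
  exact (hj.continuous_fderiv one_ne_zero).clm_apply continuous_const

end Pairing

section Variation

theorem ofReal_integral_le_lintegral_ofReal {X : Type*} [MeasurableSpace X] {μ : Measure X}
    {f : X → ℝ} (hf : Integrable f μ) :
    ENNReal.ofReal (∫ x, f x ∂μ) ≤ ∫⁻ x, ENNReal.ofReal (f x) ∂μ := by
  rw [integral_eq_lintegral_pos_part_sub_lintegral_neg_part hf]
  exact (ENNReal.ofReal_le_ofReal (sub_le_self _ ENNReal.toReal_nonneg)).trans
    ENNReal.ofReal_toReal_le

variable {N : ℕ} {K : Set (RN N)} {A : RN N → RN N} {u : RN N → ℂ}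

theorem momentNorm_neg (w : RN N) : momentNorm K (-w) = momentNorm K w := by
  simp [momentNorm]

theorem dualMomentNorm_moll_le_one (hKb : Bornology.IsBounded K) (hK0 : K ∈ 𝓝 0)
    (φ : ContDiffBump (0 : RN N)) {F : RN N → RN N} (hF : LocallyIntegrable F volume)
    (hF1 : ∀ x, dualMomentNorm K (F x) ≤ 1) (x : RN N) : dualMomentNorm K (moll φ F x) ≤ 1 := by
  refine (dualMomentNorm_le_one_iff hKb hK0).2 fun w => ?_
  have hint := integrable_normed_smul φ hF x
  have hinner : Integrable fun z => φ.normed volume z * inner ℝ w (F (x - z)) := by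
    simpa [inner_smul_right] using ((innerSL ℝ) w).integrable_comp hint
  calc inner ℝ (moll φ F x) w = ∫ z, φ.normed volume z * inner ℝ w (F (x - z)) := by
        rw [moll_apply, real_inner_comm]
        simpa [inner_smul_right] using (((innerSL ℝ) w).integral_comp_comm hint).symm
    _ ≤ ∫ z, φ.normed volume z * momentNorm K w := by
        refine integral_mono hinner (φ.integrable_normed.mul_const _) fun z => ?_
        refine mul_le_mul_of_nonneg_left ?_ (φ.nonneg_normed z)
        rw [real_inner_comm]
        exact (dualMomentNorm_le_one_iff hKb hK0).1 (hF1 _) w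
    _ = momentNorm K w := by rw [integral_mul_const, φ.integral_normed, one_mul]

theorem isAdmissible_moll (hKb : Bornology.IsBounded K) (hK0 : K ∈ 𝓝 0)
    (φ : ContDiffBump (0 : RN N)) {F : RN N → RN N} (hF : LocallyIntegrable F volume)
    (hFc : HasCompactSupport F) (hF1 : ∀ x, dualMomentNorm K (F x) ≤ 1) :
    IsAdmissible K (moll φ F) :=
  ⟨contDiff_moll φ hF 1, φ.hasCompactSupport_normed.convolution _ hFc,
    dualMomentNorm_moll_le_one hKb hK0 φ hF hF1⟩

/-- The field maximizing `-c (∫ G · F)` over the fields `F` supported in `s` with values in the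
unit ball of the dual moment norm. -/
def optimalField (c : ℂ →L[ℝ] ℝ) (K : Set (RN N)) (G : RN N → CN N) (s : Set (RN N)) :
    RN N → RN N :=
  s.indicator fun x => signField K (part c (G x))

section OptimalField

variable (c : ℂ →L[ℝ] ℝ) {G : RN N → CN N} {s : Set (RN N)}

theorem stronglyMeasurable_optimalField (hG : StronglyMeasurable G) (hs : MeasurableSet s) :
    StronglyMeasurable (optimalField c K G s) :=
  ((stronglyMeasurable_signField.comp_measurable (continuous_part c).measurable).comp_measurable
    hG.measurable).indicator hs

theorem norm_optimalField_le (hKb : Bornology.IsBounded K) (x : RN N) :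
    ‖optimalField c K G s x‖ ≤ ((N : ℝ) + 1) * ∫ h in K, ‖h‖ :=
  (norm_indicator_le_norm_self _ x).trans (norm_signField_le hKb _)

theorem hasCompactSupport_optimalField (hs : IsCompact s) :
    HasCompactSupport (optimalField c K G s) :=
  HasCompactSupport.intro hs fun _ hx => indicator_of_notMem hx _

theorem dualMomentNorm_optimalField_le_one (hKb : Bornology.IsBounded K) (hK0 : K ∈ 𝓝 0)
    (x : RN N) : dualMomentNorm K (optimalField c K G s x) ≤ 1 := by
  refine (dualMomentNorm_le_one_iff hKb hK0).2 fun w => ?_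
  by_cases hx : x ∈ s
  · rw [optimalField, indicator_of_mem hx]
    exact inner_signField_le hKb _ _
  · rw [optimalField, indicator_of_notMem hx, inner_zero_left]
    exact momentNorm_nonneg w

theorem neg_apply_cdot_optimalField (hKb : Bornology.IsBounded K) (x : RN N) :
    -c (cdot (G x) (optimalField c K G s x)) =
      s.indicator (fun x => momentNorm K (part c (G x))) x := by
  rw [apply_cdot]
  by_cases hx : x ∈ s
  · rw [optimalField, indicator_of_mem hx, indicator_of_mem hx, inner_signField_self hKb, neg_neg]
  · rw [optimalField, indicator_of_notMem hx, indicator_of_notMem hx, inner_zero_left, neg_zero]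

end OptimalField

variable (φ : ContDiffBump (0 : RN N)) (c : ℂ →L[ℝ] ℝ)

theorem setLIntegral_momentNorm_magGrad_le_partVariation (hKb : Bornology.IsBounded K)
    (hK0 : K ∈ 𝓝 0) (hA : Continuous A) (hu : LocallyIntegrable u volume) {s : Set (RN N)}
    (hs : IsCompact s) :
    ∫⁻ x in s, ENNReal.ofReal (momentNorm K (part c (magGrad φ A u x))) ≤
      partVariation c K A u := by
  set F := optimalField c K (magGrad φ A u) s
  have hF : AEStronglyMeasurable F volume := (stronglyMeasurable_optimalField c
    (continuous_magGrad φ hA hu).stronglyMeasurable hs.measurableSet).aestronglyMeasurable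
  have hC := norm_optimalField_le c (G := magGrad φ A u) (s := s) hKb
  have hFc := hasCompactSupport_optimalField c (K := K) (G := magGrad φ A u) hs
  have hint := integrable_cdot_magGrad φ hA hu hF hC hFc
  have hadm : IsAdmissible K (moll φ F) :=
    isAdmissible_moll hKb hK0 φ (locallyIntegrable_of_bound hF hC) hFc
      (dualMomentNorm_optimalField_le_one c hKb hK0)
  calc ∫⁻ x in s, ENNReal.ofReal (momentNorm K (part c (magGrad φ A u x)))
      = ∫⁻ x, ENNReal.ofReal (-c (cdot (magGrad φ A u x) (F x))) := by
        simp only [F, neg_apply_cdot_optimalField c hKb]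
        rw [← lintegral_indicator hs.measurableSet]
        refine lintegral_congr fun x => ?_
        exact congrFun (indicator_comp_of_zero ENNReal.ofReal_zero) x
    _ = ENNReal.ofReal (∫ x, -c (cdot (magGrad φ A u x) (F x))) := by
        refine (ofReal_integral_eq_lintegral_ofReal (c.integrable_comp hint).neg
          (.of_forall fun x => ?_)).symm
        simp only [F, Pi.zero_apply, Pi.neg_apply, neg_apply_cdot_optimalField c hKb]
        exact indicator_nonneg (fun _ _ => momentNorm_nonneg _) _
    _ = ENNReal.ofReal (c (magPairing A u (moll φ F))) := by
        rw [magPairing_moll φ hA hu hF hC hFc, map_neg, ← c.integral_comp_comm hint, integral_neg]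
    _ ≤ partVariation c K A u := le_iSup₂ (f := fun ψ (_ : IsAdmissible K ψ) =>
        ENNReal.ofReal (c (magPairing A u ψ))) (moll φ F) hadm

theorem lintegral_momentNorm_magGrad_le_partVariation (hKb : Bornology.IsBounded K)
    (hK0 : K ∈ 𝓝 0) (hA : Continuous A) (hu : LocallyIntegrable u volume) :
    ∫⁻ x, ENNReal.ofReal (momentNorm K (part c (magGrad φ A u x))) ≤ partVariation c K A u := by
  have hG : Measurable fun x => momentNorm K (part c (magGrad φ A u x)) :=
    (measurable_momentNorm.comp (continuous_part c).measurable).comp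
      (continuous_magGrad φ hA hu).measurable
  have hcover : AECover (volume : Measure (RN N)) atTop
      fun n : ℕ => Metric.closedBall (0 : RN N) n :=
    aecover_closedBall tendsto_natCast_atTop_atTop
  exact le_of_tendsto' (hcover.lintegral_tendsto_of_nat hG.ennreal_ofReal.aemeasurable) fun n =>
    setLIntegral_momentNorm_magGrad_le_partVariation φ c hKb hK0 hA hu (isCompact_closedBall _ _)

theorem ofReal_magPairing_moll_le (hKb : Bornology.IsBounded K) (hK0 : K ∈ 𝓝 0)
    (hA : Continuous A) (hu : LocallyIntegrable u volume) {ψ : RN N → RN N}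
    (hψ : IsAdmissible K ψ) :
    ENNReal.ofReal (c (magPairing A u (moll φ ψ))) ≤
      ∫⁻ x in tsupport ψ, ENNReal.ofReal (momentNorm K (part c (magGrad φ A u x))) := by
  obtain ⟨hψ1, hψc, hψK⟩ := hψ
  obtain ⟨C, hC⟩ := hψc.exists_bound_of_continuous hψ1.continuous
  have hψm := hψ1.continuous.aestronglyMeasurable (μ := volume)
  have hint := integrable_cdot_magGrad φ hA hu hψm hC hψc
  rw [magPairing_moll φ hA hu hψm hC hψc, map_neg, ← c.integral_comp_comm hint, ← integral_neg,
    ← lintegral_indicator (isClosed_tsupport ψ).measurableSet]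
  refine (ofReal_integral_le_lintegral_ofReal (c.integrable_comp hint).neg).trans
    (lintegral_mono fun x => ?_)
  rw [Pi.neg_apply, apply_cdot]
  by_cases hx : x ∈ tsupport ψ
  · rw [indicator_of_mem hx, ← inner_neg_right, ← momentNorm_neg]
    exact ENNReal.ofReal_le_ofReal ((dualMomentNorm_le_one_iff hKb hK0).1 (hψK x) _)
  · simp [image_eq_zero_of_notMem_tsupport hx]

variable {φ : ℕ → ContDiffBump (0 : RN N)}

theorem exists_isCompact_eventually_partVariation_le (hKb : Bornology.IsBounded K)
    (hK0 : K ∈ 𝓝 0) (hA : Continuous A) (hu : LocallyIntegrable u volume)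
    (hφ : Tendsto (fun k => (φ k).rOut) atTop (𝓝 0)) (hfin : partVariation c K A u ≠ ⊤)
    {e : ℝ≥0∞} (he : e ≠ 0) :
    ∃ s, IsCompact s ∧ ∀ᶠ k in atTop, partVariation c K A u ≤
      (∫⁻ x in s, ENNReal.ofReal (momentNorm K (part c (magGrad (φ k) A u x)))) + e := by
  rcases eq_or_ne (partVariation c K A u) 0 with h0 | h0
  · exact ⟨∅, isCompact_empty, .of_forall fun k => h0.trans_le zero_le⟩
  obtain ⟨ψ, hψ⟩ := lt_iSup_iff.1 (ENNReal.sub_lt_self hfin h0 he)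
  obtain ⟨hψ, hlt⟩ := lt_iSup_iff.1 hψ
  refine ⟨tsupport ψ, hψ.2.1, ?_⟩
  have hlim : Tendsto (fun k => ENNReal.ofReal (c (magPairing A u (moll (φ k) ψ)))) atTop
      (𝓝 (ENNReal.ofReal (c (magPairing A u ψ)))) :=
    ENNReal.tendsto_ofReal ((c.continuous.tendsto _).comp
      (tendsto_magPairing_moll hA hu hφ hψ.1 hψ.2.1))
  filter_upwards [hlim.eventually (lt_mem_nhds hlt)] with k hk
  exact tsub_le_iff_right.1 (hk.le.trans (ofReal_magPairing_moll_le (φ k) c hKb hK0 hA hu hψ))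

end Variation

section MagVariation

variable {N : ℕ} {K : Set (RN N)} {A : RN N → RN N} {u : RN N → ℂ}

theorem setLIntegral_polarMomentNorm_one (hKb : Bornology.IsBounded K) {G : RN N → CN N}
    (hG : Measurable G) (s : Set (RN N)) :
    ∫⁻ x in s, ENNReal.ofReal (polarMomentNorm 1 K (G x)) =
      (∫⁻ x in s, ENNReal.ofReal (momentNorm K (part Complex.reCLM (G x)))) +
        ∫⁻ x in s, ENNReal.ofReal (momentNorm K (part Complex.imCLM (G x))) := by
  simp only [ofReal_polarMomentNorm_one_eq_add hKb]
  exact lintegral_add_left ((measurable_momentNorm.comp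
    (continuous_part _).measurable).comp hG).ennreal_ofReal _

theorem exists_mul_enorm_le_polarMomentNorm (hKb : Bornology.IsBounded K) (hK0 : K ∈ 𝓝 0) :
    ∃ c ≠ 0, c ≠ ⊤ ∧ ∀ v : CN N, c * ‖v‖ₑ ≤ ENNReal.ofReal (polarMomentNorm 1 K v) := by
  obtain ⟨c, hc0, hc⟩ := exists_mul_enorm_rpow_le_coneMass (N := N) le_rfl hK0
  refine ⟨min c 1, by simp [hc0], by simp, fun v => ?_⟩
  rw [ofReal_polarMomentNorm_one hKb]
  refine le_trans ?_ (hc v)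
  rw [ENNReal.rpow_one]
  gcongr
  exact min_le_left _ _

theorem lintegral_polarMomentNorm_magGrad_le (hKb : Bornology.IsBounded K) (hK0 : K ∈ 𝓝 0)
    (hA : Continuous A) (hu : LocallyIntegrable u volume) (φ : ContDiffBump (0 : RN N)) :
    ∫⁻ x, ENNReal.ofReal (polarMomentNorm 1 K (magGrad φ A u x)) ≤ magVariation K A u := by
  have hsplit := setLIntegral_polarMomentNorm_one hKb (continuous_magGrad φ hA hu).measurable univ
  simp only [Measure.restrict_univ] at hsplit
  rw [hsplit, magVariation, variationRe_eq hA hu, variationIm_eq hA hu]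
  exact add_le_add (lintegral_momentNorm_magGrad_le_partVariation φ _ hKb hK0 hA hu)
    (lintegral_momentNorm_magGrad_le_partVariation φ _ hKb hK0 hA hu)

theorem exists_lintegral_enorm_magGrad_le (hKb : Bornology.IsBounded K) (hK0 : K ∈ 𝓝 0)
    (hA : Continuous A) (hu : LocallyIntegrable u volume) (hfin : magVariation K A u ≠ ⊤) :
    ∃ W ≠ ⊤, ∀ φ : ContDiffBump (0 : RN N), ∫⁻ x, ‖magGrad φ A u x‖ₑ ≤ W := by
  obtain ⟨c, hc0, hct, hc⟩ := exists_mul_enorm_le_polarMomentNorm hKb hK0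
  refine ⟨magVariation K A u / c, ENNReal.div_ne_top hfin hc0, fun φ => ?_⟩
  rw [ENNReal.le_div_iff_mul_le (.inl hc0) (.inl hct), mul_comm, ← lintegral_const_mul' _ _ hct]
  exact (lintegral_mono fun x => hc _).trans
    (lintegral_polarMomentNorm_magGrad_le hKb hK0 hA hu φ)

variable {φ : ℕ → ContDiffBump (0 : RN N)}

theorem exists_isCompact_eventually_magVariation_le (hKb : Bornology.IsBounded K)
    (hK0 : K ∈ 𝓝 0) (hA : Continuous A) (hu : LocallyIntegrable u volume)
    (hφ : Tendsto (fun k => (φ k).rOut) atTop (𝓝 0)) (hfin : magVariation K A u ≠ ⊤)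
    {e : ℝ≥0∞} (he : e ≠ 0) :
    ∃ s, IsCompact s ∧ ∀ᶠ k in atTop, magVariation K A u ≤
      (∫⁻ x in s, ENNReal.ofReal (polarMomentNorm 1 K (magGrad (φ k) A u x))) + e := by
  rw [magVariation, variationRe_eq hA hu, variationIm_eq hA hu] at hfin ⊢
  obtain ⟨hre, him⟩ := ENNReal.add_ne_top.1 hfin
  have he2 : e / 2 ≠ 0 := (ENNReal.half_pos he).ne'
  obtain ⟨s, hs, hsk⟩ := exists_isCompact_eventually_partVariation_le _ hKb hK0 hA hu hφ hre he2
  obtain ⟨t, ht, htk⟩ := exists_isCompact_eventually_partVariation_le _ hKb hK0 hA hu hφ him he2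
  refine ⟨s ∪ t, hs.union ht, ?_⟩
  filter_upwards [hsk, htk] with k hks hkt
  rw [setLIntegral_polarMomentNorm_one hKb (continuous_magGrad (φ k) hA hu).measurable]
  refine (add_le_add hks hkt).trans ?_
  rw [add_add_add_comm, ENNReal.add_halves]
  gcongr
  exacts [subset_union_left, subset_union_right]

theorem exists_isCompact_eventually_lintegral_compl_magGrad_le (hKb : Bornology.IsBounded K)
    (hK0 : K ∈ 𝓝 0) (hA : Continuous A) (hu : LocallyIntegrable u volume)
    (hφ : Tendsto (fun k => (φ k).rOut) atTop (𝓝 0)) (hfin : magVariation K A u ≠ ⊤)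
    {e : ℝ≥0∞} (he : e ≠ 0) :
    ∃ s, IsCompact s ∧ ∀ᶠ k in atTop, ∫⁻ x in sᶜ, ‖magGrad (φ k) A u x‖ₑ ≤ e := by
  obtain ⟨c, hc0, hct, hc⟩ := exists_mul_enorm_le_polarMomentNorm hKb hK0
  obtain ⟨s, hs, hsk⟩ := exists_isCompact_eventually_magVariation_le hKb hK0 hA hu hφ hfin
    (mul_ne_zero hc0 he)
  refine ⟨s, hs, ?_⟩
  filter_upwards [hsk] with k hk
  have hle := lintegral_polarMomentNorm_magGrad_le hKb hK0 hA hu (φ k)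
  rw [← lintegral_add_compl _ hs.measurableSet] at hle
  have htail : ∫⁻ x in sᶜ, ENNReal.ofReal (polarMomentNorm 1 K (magGrad (φ k) A u x)) ≤ c * e :=
    (ENNReal.add_le_add_iff_left (ne_top_of_le_ne_top hfin (le_self_add.trans hle))).1
      (hle.trans hk)
  rw [← ENNReal.mul_le_mul_iff_right hc0 hct, ← lintegral_const_mul' _ _ hct]
  exact (lintegral_mono fun x => hc _).trans htail

end MagVariation

section EPowOne

theorem ePow_one (z : ℂ) : ePow 1 z = ‖z.re‖ₑ + ‖z.im‖ₑ := by simp only [ePow, ENNReal.rpow_one]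

theorem ePow_one_le (z : ℂ) : ePow 1 z ≤ 2 * ‖z‖ₑ := by
  simpa only [ENNReal.rpow_one] using ePow_le zero_le_one z

theorem ePow_one_add_le (z w : ℂ) : ePow 1 (z + w) ≤ ePow 1 z + ePow 1 w := by
  simp only [ePow_one, Complex.add_re, Complex.add_im]
  rw [add_add_add_comm]
  exact add_le_add (enorm_add_le _ _) (enorm_add_le _ _)

theorem ePow_one_le_add_enorm_sub (z w : ℂ) : ePow 1 z ≤ ePow 1 w + 2 * ‖z - w‖ₑ :=
  calc ePow 1 z = ePow 1 (w + (z - w)) := by rw [add_sub_cancel]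
    _ ≤ ePow 1 w + ePow 1 (z - w) := ePow_one_add_le _ _
    _ ≤ _ := add_le_add_right (ePow_one_le _) _

theorem ePow_one_integral_le {X : Type*} [MeasurableSpace X] {μ : Measure X} (f : X → ℂ) :
    ePow 1 (∫ x, f x ∂μ) ≤ ∫⁻ x, ePow 1 (f x) ∂μ := by
  by_cases hf : Integrable f μ
  · have hre : ∫ x, (f x).re ∂μ = (∫ x, f x ∂μ).re := Complex.reCLM.integral_comp_comm hf
    have him : ∫ x, (f x).im ∂μ = (∫ x, f x ∂μ).im := Complex.imCLM.integral_comp_comm hf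
    simp only [ePow_one]
    rw [lintegral_add_left' (Complex.continuous_re.comp_aestronglyMeasurable hf.1).enorm,
      ← hre, ← him]
    exact add_le_add (enorm_integral_le_lintegral_enorm _) (enorm_integral_le_lintegral_enorm _)
  · simp [integral_undef hf, ePow_one]

end EPowOne

section BumpAverage

variable {E : Type*} [NormedAddCommGroup E] [NormedSpace ℝ E] [FiniteDimensional ℝ E]
  [MeasureSpace E] [BorelSpace E] (φ : ContDiffBump (0 : E))

theorem ePow_one_integral_normed_smul_le (f : E → ℂ) :
    ePow 1 (∫ z, φ.normed volume z • f z) ≤ ∫⁻ z, ePow 1 (f z) ∂bumpMeasure φ := by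
  refine (ePow_one_integral_le _).trans_eq ?_
  rw [← lintegral_normed_mul]
  refine lintegral_congr fun z => ?_
  rw [Complex.real_smul, ePow_real_mul zero_le_one, ENNReal.rpow_one,
    Real.enorm_of_nonneg (φ.nonneg_normed z)]

theorem lintegral_lintegral_bumpMeasure_sub [(volume : Measure E).IsAddHaarMeasure]
    {H : E → ℝ≥0∞} (hH : Measurable H) :
    ∫⁻ x, ∫⁻ z, H (x - z) ∂bumpMeasure φ = ∫⁻ x, H x := by
  have hprod : Measurable (Function.uncurry fun x z : E => H (x - z)) := hH.comp measurable_sub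
  rw [lintegral_lintegral_swap hprod.aemeasurable]
  simp only [lintegral_sub_right_eq_self, lintegral_const, measure_univ, mul_one]

end BumpAverage

section ShiftEnergyOne

variable {N : ℕ} {A : RN N → RN N} {u v : RN N → ℂ}

theorem measurable_ePow_magShift_sub {p : ℝ} (hA : Continuous A) (hum : StronglyMeasurable u)
    (h : RN N) : Measurable fun x => ePow p (magShift A h u x - u x) :=
  (measurable_ePow p).comp ((measurable_magShift hA hum h).sub hum.measurable)

theorem dirEnergy_one_le_shiftEnergy_add (hA : Continuous A) (hum : StronglyMeasurable u)
    (G : RN N → CN N) (h : RN N) :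
    dirEnergy 1 G h ≤ shiftEnergy 1 A u h + 2 * eLpNorm (magRemainder A u G h) 1 volume := by
  rw [eLpNorm_one_eq_lintegral_enorm, ← lintegral_const_mul' _ _ ENNReal.ofNat_ne_top, shiftEnergy,
    ← lintegral_add_left (measurable_ePow_magShift_sub hA hum h)]
  refine lintegral_mono fun x =>
    (ePow_one_le_add_enorm_sub _ (magShift A h u x - u x)).trans_eq ?_
  rw [magRemainder, ← enorm_neg, neg_sub]

theorem shiftEnergy_one_le_add (hA : Continuous A) (hum : StronglyMeasurable u)
    (hvm : StronglyMeasurable v) (h : RN N) :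
    shiftEnergy 1 A u h ≤ shiftEnergy 1 A v h +
      4 * eLpNorm (fun x => v x - u x) 1 volume := by
  have hdiff : shiftEnergy 1 A (u - v) h ≤ 4 * eLpNorm (fun x => v x - u x) 1 volume := by
    refine (shiftEnergy_le le_rfl hA (hum.sub hvm) h).trans_eq ?_
    rw [ENNReal.rpow_one, ENNReal.ofReal_one, ← mul_assoc, eLpNorm_sub_comm]
    norm_num
    rfl
  refine le_trans ?_ (add_le_add_right hdiff _)
  rw [shiftEnergy, shiftEnergy, shiftEnergy,
    ← lintegral_add_left (measurable_ePow_magShift_sub hA hvm h)]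
  refine lintegral_mono fun x => le_trans (le_of_eq ?_) (ePow_one_add_le _ _)
  simp only [magShift, Pi.sub_apply]
  ring_nf

theorem enorm_exp_magPhase_sub_exp_le {L : NNReal} (hA : LipschitzWith L A) (h x y : RN N) :
    ‖Complex.exp (((-magPhase A h x : ℝ) : ℂ) * Complex.I) -
      Complex.exp (((-magPhase A h y : ℝ) : ℂ) * Complex.I)‖ₑ ≤
      ENNReal.ofReal (‖h‖ * L * ‖x - y‖) := by
  have hfactor : Complex.exp (((-magPhase A h x : ℝ) : ℂ) * Complex.I) -
      Complex.exp (((-magPhase A h y : ℝ) : ℂ) * Complex.I) =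
      Complex.exp (((-magPhase A h y : ℝ) : ℂ) * Complex.I) *
        (Complex.exp (((magPhase A h y - magPhase A h x : ℝ) : ℂ) * Complex.I) - 1) := by
    rw [mul_sub, ← Complex.exp_add, mul_one]
    push_cast
    ring_nf
  rw [hfactor, enorm_mul, enorm_exp_mul_I, one_mul, ← ofReal_norm]
  refine ENNReal.ofReal_le_ofReal
    ((norm_exp_mul_I_sub_one_le _).trans ((min_le_right _ _).trans ?_))
  rw [magPhase, magPhase, ← inner_sub_right, mul_assoc]
  refine (abs_real_inner_le_norm _ _).trans ?_
  gcongr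
  simpa only [dist_eq_norm, add_sub_add_right_eq_sub, norm_sub_rev y x] using
    hA.dist_le_mul (y + (2 : ℝ)⁻¹ • h) (x + (2 : ℝ)⁻¹ • h)

variable (φ : ContDiffBump (0 : RN N))

theorem magShift_moll_sub_eq_integral_normed_smul (hu : LocallyIntegrable u volume) (h x : RN N) :
    magShift A h (moll φ u) x - moll φ u x = ∫ z, φ.normed volume z •
      (Complex.exp (((-magPhase A h x : ℝ) : ℂ) * Complex.I) * u (x - z + h) - u (x - z)) := by
  rw [magShift, moll_apply, moll_apply, ← integral_const_mul, ← integral_sub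
    ((integrable_normed_smul φ hu _).const_mul _) (integrable_normed_smul φ hu _)]
  congr 1 with z
  rw [smul_sub, mul_smul_comm, add_sub_right_comm]

theorem ePow_one_magShift_moll_sub_le_lintegral_bumpMeasure {L : NNReal} (hA : LipschitzWith L A)
    (hu : LocallyIntegrable u volume) (h x : RN N) :
    ePow 1 (magShift A h (moll φ u) x - moll φ u x) ≤
      ∫⁻ z, (ePow 1 (magShift A h u (x - z) - u (x - z)) +
        2 * (ENNReal.ofReal (‖h‖ * L * φ.rOut) * ‖u (x - z + h)‖ₑ)) ∂bumpMeasure φ := by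
  rw [magShift_moll_sub_eq_integral_normed_smul φ hu]
  refine (ePow_one_integral_normed_smul_le φ _).trans (lintegral_mono_ae ?_)
  filter_upwards [ae_bumpMeasure_norm_lt φ] with z hz
  refine (ePow_one_le_add_enorm_sub _ (magShift A h u (x - z) - u (x - z))).trans ?_
  rw [sub_sub_sub_cancel_right, magShift, ← sub_mul, enorm_mul]
  gcongr
  refine (enorm_exp_magPhase_sub_exp_le hA h x (x - z)).trans (ENNReal.ofReal_le_ofReal ?_)
  rw [sub_sub_cancel]
  gcongr

theorem shiftEnergy_one_moll_le {L : NNReal} (hA : LipschitzWith L A) (hum : StronglyMeasurable u)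
    (hu : LocallyIntegrable u volume) (h : RN N) :
    shiftEnergy 1 A (moll φ u) h ≤ shiftEnergy 1 A u h +
      2 * (ENNReal.ofReal (‖h‖ * L * φ.rOut) * eLpNorm u 1 volume) := by
  have hshift : Measurable fun x => ePow 1 (magShift A h u x - u x) :=
    measurable_ePow_magShift_sub hA.continuous hum h
  have htrans : Measurable fun x => ‖u (x + h)‖ₑ :=
    (hum.measurable.comp (measurable_add_const h)).enorm
  refine (lintegral_mono fun x =>
    ePow_one_magShift_moll_sub_le_lintegral_bumpMeasure φ hA hu h x).trans_eq ?_
  rw [lintegral_lintegral_bumpMeasure_sub φ (H := fun y => ePow 1 (magShift A h u y - u y) +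
      2 * (ENNReal.ofReal (‖h‖ * L * φ.rOut) * ‖u (y + h)‖ₑ))
      (hshift.add ((htrans.const_mul _).const_mul 2)),
    lintegral_add_left hshift, lintegral_const_mul _ (htrans.const_mul _),
    lintegral_const_mul _ htrans, lintegral_add_right_eq_self (fun x => ‖u x‖ₑ),
    eLpNorm_one_eq_lintegral_enorm]
  rfl

theorem ePow_one_exp_mul_le {L : NNReal} (hA : LipschitzWith L A) (u : RN N → ℂ) (h x : RN N)
    {t : ℝ} (ht : t ∈ Icc (0 : ℝ) 1) :
    ePow 1 (Complex.exp (((-(t * magPhase A h x) : ℝ) : ℂ) * Complex.I) *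
        (cdot (magGrad φ A u (x + t • h)) h
          + Complex.I * mollPhaseDefect φ A u h (magPhase A h x) (x + t • h))) ≤
      ePow 1 (cdot (magGrad φ A u (x + t • h)) h) +
        2 * (‖h‖ₑ * (phaseSize A h x * ‖magGrad φ A u (x + t • h)‖ₑ) +
          ENNReal.ofReal (‖h‖ * L * (φ.rOut + ‖h‖)) * eMoll φ u (x + t • h)) := by
  set e := Complex.exp (((-(t * magPhase A h x) : ℝ) : ℂ) * Complex.I)
  set d := cdot (magGrad φ A u (x + t • h)) h
  set r := mollPhaseDefect φ A u h (magPhase A h x) (x + t • h)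
  have hsplit : e * (d + Complex.I * r) - d = (e - 1) * d + e * (Complex.I * r) := by ring
  refine (ePow_one_le_add_enorm_sub _ d).trans ?_
  gcongr
  rw [hsplit]
  refine (enorm_add_le _ _).trans (add_le_add ?_ ?_)
  · rw [enorm_mul, mul_left_comm]
    exact mul_le_mul' (enorm_exp_magPhase_sub_one_le h x ht) (enorm_cdot_le _ _)
  · have hI : ‖Complex.I‖ₑ = 1 := by rw [← ofReal_norm, Complex.norm_I, ENNReal.ofReal_one]
    rw [enorm_mul, enorm_exp_mul_I, one_mul, enorm_mul, hI, one_mul]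
    exact enorm_mollPhaseDefect_le φ hA u h x ht

theorem lintegral_magGrad_translate_le (hA : Continuous A) (hum : StronglyMeasurable u)
    (hu : LocallyIntegrable u volume) (h k : RN N) (c : ℝ≥0∞) {M : ℝ≥0∞}
    (hM : ∫⁻ x, phaseSize A h x * ‖magGrad φ A u (x + k)‖ₑ ≤ M) :
    ∫⁻ x, (ePow 1 (cdot (magGrad φ A u (x + k)) h) +
        2 * (‖h‖ₑ * (phaseSize A h x * ‖magGrad φ A u (x + k)‖ₑ) + c * eMoll φ u (x + k))) ≤
      dirEnergy 1 (magGrad φ A u) h + 2 * (‖h‖ₑ * M + c * eLpNorm u 1 volume) := by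
  have hgrad := continuous_magGrad φ hA hu
  have hshift : Continuous fun x : RN N => x + k := continuous_add_const k
  have hdir : Measurable fun x : RN N => ePow 1 (cdot (magGrad φ A u (x + k)) h) :=
    (measurable_ePow 1).comp
      (continuous_cdot.comp ((hgrad.comp hshift).prodMk continuous_const)).measurable
  have hmoll := measurable_eMoll_comp_add φ hum k
  have heMoll : ∫⁻ x, eMoll φ u (x + k) ≤ eLpNorm u 1 volume := by
    simpa [eLpNorm_one_eq_lintegral_enorm] using eLpNorm_eMoll_comp_add_le φ le_rfl hum k
  rw [lintegral_add_left hdir, lintegral_const_mul' _ _ ENNReal.ofNat_ne_top,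
    lintegral_add_right _ (hmoll.const_mul c), lintegral_const_mul' _ _ enorm_ne_top,
    lintegral_const_mul _ hmoll,
    lintegral_add_right_eq_self (fun y => ePow 1 (cdot (magGrad φ A u y) h)) k]
  gcongr
  exact le_rfl

theorem shiftEnergy_one_moll_le_dirEnergy_add {L : NNReal} (hA : LipschitzWith L A)
    (hum : StronglyMeasurable u) (hu : LocallyIntegrable u volume) (h : RN N) {M : ℝ≥0∞}
    (hM : ∀ t ∈ Ioc (0 : ℝ) 1, ∫⁻ x, phaseSize A h x * ‖magGrad φ A u (x + t • h)‖ₑ ≤ M) :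
    shiftEnergy 1 A (moll φ u) h ≤ dirEnergy 1 (magGrad φ A u) h + 2 * (‖h‖ₑ * M +
      ENNReal.ofReal (‖h‖ * L * (φ.rOut + ‖h‖)) * eLpNorm u 1 volume) := by
  set c := ENNReal.ofReal (‖h‖ * L * (φ.rOut + ‖h‖))
  have hgrad := continuous_magGrad φ hA.continuous hu
  have hline : Continuous fun q : RN N × ℝ => q.1 + q.2 • h := by fun_prop
  set H : RN N → ℝ → ℝ≥0∞ := fun x t => ePow 1 (cdot (magGrad φ A u (x + t • h)) h) +
    2 * (‖h‖ₑ * (phaseSize A h x * ‖magGrad φ A u (x + t • h)‖ₑ) + c * eMoll φ u (x + t • h))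
  have hH : Measurable (Function.uncurry H) := by
    have hdir := (measurable_ePow 1).comp
      (continuous_cdot.comp ((hgrad.comp hline).prodMk (continuous_const (y := h)))).measurable
    have hnorm := (hgrad.comp hline).measurable.enorm
    have hmoll := (measurable_eMoll φ hum).comp hline.measurable
    have hphase := (measurable_phaseSize hA.continuous h).comp
      (measurable_fst : Measurable (Prod.fst : RN N × ℝ → RN N))
    exact hdir.add ((((hphase.mul hnorm).const_mul _).add (hmoll.const_mul _)).const_mul _)
  calc shiftEnergy 1 A (moll φ u) h ≤ ∫⁻ x, ∫⁻ t in Ioc (0 : ℝ) 1, H x t := by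
        refine lintegral_mono fun x => ?_
        rw [magShift_moll_sub_eq_integral φ hA.continuous hu]
        exact (ePow_one_integral_le _).trans (setLIntegral_mono' measurableSet_Ioc fun t ht =>
          ePow_one_exp_mul_le φ hA u h x (Ioc_subset_Icc_self ht))
    _ = ∫⁻ t in Ioc (0 : ℝ) 1, ∫⁻ x, H x t := lintegral_lintegral_swap hH.aemeasurable
    _ ≤ ∫⁻ _ in Ioc (0 : ℝ) 1, (dirEnergy 1 (magGrad φ A u) h +
          2 * (‖h‖ₑ * M + c * eLpNorm u 1 volume)) :=
        setLIntegral_mono' measurableSet_Ioc fun t ht =>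
          lintegral_magGrad_translate_le φ hA.continuous hum hu h (t • h) c (hM t ht)
    _ = _ := by simp only [lintegral_const, measure_univ, mul_one]

end ShiftEnergyOne

section PhaseTail

variable {N : ℕ} {A : RN N → RN N} {B : ℝ} {s : Set (RN N)} {h : RN N} {t : ℝ}

theorem phaseSize_le_of_mem (hB : ∀ y ∈ Metric.cthickening 1 s, ‖A y‖ ≤ B) (hh : ‖h‖ ≤ 1)
    (ht : t ∈ Icc (0 : ℝ) 1) {x : RN N} (hx : x + t • h ∈ s) :
    phaseSize A h x ≤ ‖h‖ₑ * ENNReal.ofReal B := by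
  have hmid : ‖A (x + (2 : ℝ)⁻¹ • h)‖ ≤ B := by
    refine hB _ (Metric.mem_cthickening_of_dist_le _ _ _ _ hx ?_)
    rw [dist_add_left, dist_eq_norm, ← sub_smul, norm_smul]
    refine mul_le_one₀ ?_ (norm_nonneg _) hh
    rw [Real.norm_eq_abs, abs_le]
    constructor <;> linarith [ht.1, ht.2]
  rw [phaseSize, ← ofReal_norm, ← ENNReal.ofReal_mul (norm_nonneg _)]
  refine ENNReal.ofReal_le_ofReal ((min_le_right _ _).trans ?_)
  exact (abs_real_inner_le_norm _ _).trans (by gcongr)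

theorem lintegral_phaseSize_mul_le (hs : MeasurableSet s)
    (hB : ∀ y ∈ Metric.cthickening 1 s, ‖A y‖ ≤ B) (hh : ‖h‖ ≤ 1) (ht : t ∈ Icc (0 : ℝ) 1)
    {F : RN N → ℝ≥0∞} (hF : Measurable F) :
    ∫⁻ x, phaseSize A h x * F (x + t • h) ≤
      ‖h‖ₑ * ENNReal.ofReal B * (∫⁻ x, F x) + 2 * ∫⁻ x in sᶜ, F x := by
  calc ∫⁻ x, phaseSize A h x * F (x + t • h)
      ≤ ∫⁻ x, (fun y => ‖h‖ₑ * ENNReal.ofReal B * F y + 2 * sᶜ.indicator F y) (x + t • h) := by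
        refine lintegral_mono fun x => ?_
        by_cases hx : x + t • h ∈ s
        · exact (mul_le_mul_left (phaseSize_le_of_mem hB hh ht hx) _).trans le_self_add
        · dsimp only
          rw [indicator_of_mem (mem_compl hx)]
          exact (mul_le_mul_left (phaseSize_le_two A h x) _).trans le_add_self
    _ = _ := by
        rw [lintegral_add_right_eq_self
            (fun y => ‖h‖ₑ * ENNReal.ofReal B * F y + 2 * sᶜ.indicator F y),
          lintegral_add_left (hF.const_mul _), lintegral_const_mul _ hF,
          lintegral_const_mul _ (hF.indicator hs.compl), lintegral_indicator hs.compl]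

end PhaseTail

theorem tendsto_enorm_mul_zero {E : Type*} [NormedAddCommGroup E] {C : ℝ≥0∞} (hC : C ≠ ⊤) :
    Tendsto (fun h : E => ‖h‖ₑ * C) (𝓝 0) (𝓝 0) := by
  simpa only [enorm_zero, zero_mul] using
    ENNReal.Tendsto.mul_const (continuous_enorm.tendsto (0 : E)) (Or.inr hC)

theorem le_liminf_add_of_tendsto {ι : Type*} {l : Filter ι} [NeBot l] {x c : ℝ≥0∞}
    {y e : ι → ℝ≥0∞} (h : ∀ᶠ i in l, x ≤ y i + e i) (he : Tendsto e l (𝓝 c)) (hc : c ≠ ⊤) :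
    x ≤ liminf y l + c := by
  rw [← tsub_le_iff_right, ← (ENNReal.Tendsto.sub tendsto_const_nhds he (Or.inr hc)).liminf_eq]
  exact liminf_le_liminf (h.mono fun i hi => tsub_le_iff_right.2 hi)

section ConeMassLiminf

variable {E : Type*} [NormedAddCommGroup E] [NormedSpace ℝ E] {f : ℕ → E → ℝ≥0∞} {q : ℝ}

theorem isPosHomogeneous_liminf (hf : ∀ k, IsPosHomogeneous q (f k)) :
    IsPosHomogeneous q fun h => liminf (fun k => f k h) atTop := by
  intro t ht h
  simp only [fun k => hf k t ht h]
  exact ENNReal.liminf_const_mul_of_ne_top ENNReal.ofReal_ne_top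

theorem coneMass_liminf_le [MeasurableSpace E] {μ : Measure E} {K : Set E}
    (hf : ∀ k, Measurable (f k)) :
    coneMass μ K q (fun h => liminf (fun k => f k h) atTop) ≤
      liminf (fun k => coneMass μ K q (f k)) atTop :=
  calc coneMass μ K q (fun h => liminf (fun k => f k h) atTop)
      ≤ ENNReal.ofReal (Module.finrank ℝ E + q) * liminf (fun k => ∫⁻ h in K, f k h ∂μ) atTop :=
        mul_le_mul_right (lintegral_liminf_le hf) _
    _ = _ := (ENNReal.liminf_const_mul_of_ne_top ENNReal.ofReal_ne_top).symm

end ConeMassLiminf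

section BVLimit

variable {N : ℕ} {K : Set (RN N)} {A : RN N → RN N} {u : RN N → ℂ} {L : NNReal}

theorem ofReal_norm_mul_mul_add {E : Type*} [NormedAddCommGroup E] (h : E) (L : NNReal) {r : ℝ}
    (hr : 0 ≤ r) :
    ENNReal.ofReal (‖h‖ * L * (r + ‖h‖)) = ‖h‖ₑ * (L * ENNReal.ofReal r + ‖h‖ₑ * L) := by
  rw [ENNReal.ofReal_mul (by positivity), ENNReal.ofReal_mul (norm_nonneg _),
    ENNReal.ofReal_add hr (norm_nonneg _), ENNReal.ofReal_coe_nnreal, ofReal_norm]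
  ring

theorem eventually_eLpNorm_magRemainder_moll_le {p : ℝ} (φ : ContDiffBump (0 : RN N)) (hp : 1 ≤ p)
    (hA : LipschitzWith L A) (hum : StronglyMeasurable u)
    (hu : MemLp u (ENNReal.ofReal p) volume)
    (hG : MemLp (magGrad φ A u) (ENNReal.ofReal p) volume) {a : ℝ≥0∞} (ha : a ≠ 0) :
    ∀ᶠ h in 𝓝 0, eLpNorm (magRemainder A (moll φ u) (magGrad φ A u) h) (ENNReal.ofReal p) volume ≤
      ‖h‖ₑ * (L * ENNReal.ofReal φ.rOut * eLpNorm u (ENNReal.ofReal p) volume + a) := by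
  have hp0 : 0 < p := by linarith
  have hp1 : 1 ≤ ENNReal.ofReal p := ENNReal.one_le_ofReal.2 hp
  have hlip : (L : ℝ≥0∞) * eLpNorm u (ENNReal.ofReal p) volume ≠ ⊤ :=
    ENNReal.mul_ne_top ENNReal.coe_ne_top hu.2.ne
  have ha3 : a / 3 ≠ 0 := ENNReal.div_ne_zero.2 ⟨ha, ENNReal.ofNat_ne_top⟩
  have hthirds : a / 3 + a / 3 + a / 3 = a := ENNReal.add_thirds a
  have hsmall {X : RN N → ℝ≥0∞} (hX : Tendsto X (𝓝 0) (𝓝 0)) : ∀ᶠ h in 𝓝 0, X h ≤ a / 3 :=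
    (hX.eventually_lt_const ha3.bot_lt).mono fun _ => le_of_lt
  filter_upwards [eventually_forall_smul_of_eventually
      (hsmall (tendsto_eLpNorm_translate_sub hp1 ENNReal.ofReal_ne_top hG)),
    hsmall (tendsto_eLpNorm_phaseSize_mul hp0 hA.continuous hG),
    hsmall (tendsto_enorm_mul_zero hlip)] with h htrans hphase hquad
  refine (eLpNorm_magRemainder_moll_le φ hp hA hum (hu.locallyIntegrable hp1) h htrans).trans ?_
  rw [ofReal_norm_mul_mul_add h L φ.rOut_pos.le]
  set U := eLpNorm u (ENNReal.ofReal p) volume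
  calc ‖h‖ₑ * (a / 3) + ‖h‖ₑ * (L * ENNReal.ofReal φ.rOut + ‖h‖ₑ * L) * U + ‖h‖ₑ * _
      ≤ ‖h‖ₑ * (a / 3) + ‖h‖ₑ * (L * ENNReal.ofReal φ.rOut * U + a / 3) + ‖h‖ₑ * (a / 3) := by
        rw [mul_assoc ‖h‖ₑ, add_mul, mul_assoc ‖h‖ₑ]
        gcongr
    _ = ‖h‖ₑ * (L * ENNReal.ofReal φ.rOut * U + (a / 3 + a / 3 + a / 3)) := by ring
    _ = _ := by rw [hthirds]

theorem eventually_dirEnergy_magGrad_le (φ : ContDiffBump (0 : RN N)) (hA : LipschitzWith L A)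
    (hum : StronglyMeasurable u) (hu : MemLp u 1 volume) (hG : MemLp (magGrad φ A u) 1 volume)
    {a : ℝ≥0∞} (ha : a ≠ 0) :
    ∀ᶠ h in 𝓝 0, dirEnergy 1 (magGrad φ A u) h ≤ shiftEnergy 1 A u h +
      (4 * (L * ENNReal.ofReal φ.rOut * eLpNorm u 1 volume) + a) * ‖h‖ₑ ^ (1 : ℝ) := by
  have hul := hu.locallyIntegrable le_rfl
  have hrem := eventually_eLpNorm_magRemainder_moll_le φ le_rfl hA hum
    (by rwa [ENNReal.ofReal_one]) (by rwa [ENNReal.ofReal_one]) (ENNReal.half_pos ha).ne'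
  simp only [ENNReal.ofReal_one] at hrem
  filter_upwards [hrem] with h hh
  have hoff : ENNReal.ofReal (‖h‖ * L * φ.rOut) = ‖h‖ₑ * (L * ENNReal.ofReal φ.rOut) := by
    rw [mul_assoc, ENNReal.ofReal_mul (norm_nonneg _), ENNReal.ofReal_mul L.coe_nonneg,
      ENNReal.ofReal_coe_nnreal, ofReal_norm]
  set P := L * ENNReal.ofReal φ.rOut * eLpNorm u 1 volume
  calc dirEnergy 1 (magGrad φ A u) h
      ≤ shiftEnergy 1 A (moll φ u) h
          + 2 * eLpNorm (magRemainder A (moll φ u) (magGrad φ A u) h) 1 volume :=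
        dirEnergy_one_le_shiftEnergy_add hA.continuous
          (continuous_moll φ hul).stronglyMeasurable _ h
    _ ≤ (shiftEnergy 1 A u h + 2 * (‖h‖ₑ * P)) + 2 * (‖h‖ₑ * (P + a / 2)) := by
        gcongr
        refine (shiftEnergy_one_moll_le φ hA hum hul h).trans_eq ?_
        rw [hoff, mul_assoc]
    _ = shiftEnergy 1 A u h + (4 * P + 2 * (a / 2)) * ‖h‖ₑ := by ring
    _ = _ := by rw [ENNReal.mul_div_cancel two_ne_zero ENNReal.ofNat_ne_top, ENNReal.rpow_one]

theorem magVariation_congr {v : RN N → ℂ} (h : u =ᵐ[volume] v) :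
    magVariation K A u = magVariation K A v := by
  unfold magVariation variationRe variationIm
  congr 1 <;>
  · refine iSup_congr fun ψ => iSup_congr fun _ => congrArg _ (integral_congr_ae ?_)
    filter_upwards [h] with x hx
    rw [hx]

variable {φ : ℕ → ContDiffBump (0 : RN N)}

theorem shiftEnergy_one_le_liminf_dirEnergy_add (hA : LipschitzWith L A)
    (hum : StronglyMeasurable u) (hu : MemLp u 1 volume)
    (hφ : Tendsto (fun k => (φ k).rOut) atTop (𝓝 0)) (h : RN N) {M : ℝ≥0∞} (hM0 : M ≠ ⊤)
    (hM : ∀ᶠ k in atTop, ∀ t ∈ Ioc (0 : ℝ) 1,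
      ∫⁻ x, phaseSize A h x * ‖magGrad (φ k) A u (x + t • h)‖ₑ ≤ M) :
    shiftEnergy 1 A u h ≤ liminf (fun k => dirEnergy 1 (magGrad (φ k) A u) h) atTop +
      2 * (‖h‖ₑ * M + ‖h‖ₑ * (‖h‖ₑ * L) * eLpNorm u 1 volume) := by
  have hul := hu.locallyIntegrable le_rfl
  set U := eLpNorm u 1 volume
  have hU : U ≠ ⊤ := hu.2.ne
  have hmoll : Tendsto (fun k => eLpNorm (fun x => moll (φ k) u x - u x) 1 volume) atTop (𝓝 0) := by
    simpa only [ENNReal.ofReal_one] using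
      tendsto_eLpNorm_moll_sub hφ le_rfl (by rwa [ENNReal.ofReal_one])
  have hphase : Tendsto (fun k => ENNReal.ofReal (‖h‖ * L * ((φ k).rOut + ‖h‖)) * U) atTop
      (𝓝 (‖h‖ₑ * (‖h‖ₑ * L) * U)) := by
    have hlim := ENNReal.tendsto_ofReal ((hφ.add_const ‖h‖).const_mul (‖h‖ * L))
    rw [ofReal_norm_mul_mul_add h L le_rfl, ENNReal.ofReal_zero, mul_zero, zero_add] at hlim
    exact ENNReal.Tendsto.mul_const hlim (Or.inr hU)
  have herror : Tendsto (fun k => 2 * (‖h‖ₑ * M +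
        ENNReal.ofReal (‖h‖ * L * ((φ k).rOut + ‖h‖)) * U) +
        4 * eLpNorm (fun x => moll (φ k) u x - u x) 1 volume) atTop
      (𝓝 (2 * (‖h‖ₑ * M + ‖h‖ₑ * (‖h‖ₑ * L) * U))) := by
    simpa using (ENNReal.Tendsto.const_mul (hphase.const_add (‖h‖ₑ * M))
      (Or.inr ENNReal.ofNat_ne_top)).add
        (ENNReal.Tendsto.const_mul hmoll (Or.inr ENNReal.ofNat_ne_top))
  refine le_liminf_add_of_tendsto ?_ herror (by finiteness)
  filter_upwards [hM] with k hk
  rw [← add_assoc]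
  exact (shiftEnergy_one_le_add hA.continuous hum
    (continuous_moll (φ k) hul).stronglyMeasurable h).trans (add_le_add_left
      (shiftEnergy_one_moll_le_dirEnergy_add (φ k) hA hum hul h hk) _)

theorem exists_eventually_lintegral_phaseSize_mul_magGrad_le (hKb : Bornology.IsBounded K)
    (hK0 : K ∈ 𝓝 0) (hA : Continuous A) (hu : LocallyIntegrable u volume)
    (hφ : Tendsto (fun k => (φ k).rOut) atTop (𝓝 0)) (hfin : magVariation K A u ≠ ⊤)
    {a : ℝ≥0∞} (ha : a ≠ 0) :
    ∃ C ≠ ⊤, ∀ᶠ k in atTop, ∀ h : RN N, ‖h‖ ≤ 1 → ∀ t ∈ Ioc (0 : ℝ) 1,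
      ∫⁻ x, phaseSize A h x * ‖magGrad (φ k) A u (x + t • h)‖ₑ ≤ ‖h‖ₑ * C + a := by
  obtain ⟨W, hW, hgrad⟩ := exists_lintegral_enorm_magGrad_le hKb hK0 hA hu hfin
  obtain ⟨s, hs, htail⟩ := exists_isCompact_eventually_lintegral_compl_magGrad_le hKb hK0 hA hu hφ
    hfin (ENNReal.half_pos ha).ne'
  obtain ⟨B, hB⟩ := (hs.cthickening (r := 1)).exists_bound_of_continuousOn hA.continuousOn
  refine ⟨ENNReal.ofReal B * W, by finiteness, htail.mono fun k hk h hh t ht => ?_⟩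
  calc _ ≤ ‖h‖ₑ * ENNReal.ofReal B * (∫⁻ x, ‖magGrad (φ k) A u x‖ₑ)
        + 2 * ∫⁻ x in sᶜ, ‖magGrad (φ k) A u x‖ₑ :=
        lintegral_phaseSize_mul_le hs.measurableSet hB hh (Ioc_subset_Icc_self ht)
          (continuous_magGrad (φ k) hA hu).measurable.enorm
    _ ≤ ‖h‖ₑ * ENNReal.ofReal B * W + 2 * (a / 2) := by
        gcongr
        exact hgrad (φ k)
    _ = _ := by
        rw [ENNReal.mul_div_cancel two_ne_zero ENNReal.ofNat_ne_top, mul_assoc]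

theorem eventually_shiftEnergy_one_le_liminf_dirEnergy_add (hKb : Bornology.IsBounded K)
    (hK0 : K ∈ 𝓝 0) (hA : LipschitzWith L A) (hum : StronglyMeasurable u) (hu : MemLp u 1 volume)
    (hφ : Tendsto (fun k => (φ k).rOut) atTop (𝓝 0)) (hfin : magVariation K A u ≠ ⊤)
    {a : ℝ≥0∞} (ha : a ≠ 0) :
    ∀ᶠ h in 𝓝 0, shiftEnergy 1 A u h ≤
      liminf (fun k => dirEnergy 1 (magGrad (φ k) A u) h) atTop + a * ‖h‖ₑ ^ (1 : ℝ) := by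
  obtain ⟨b, hb, hba⟩ := exists_between
    (ENNReal.div_ne_zero.2 ⟨ha, ENNReal.ofNat_ne_top (n := 4)⟩).bot_lt
  set U := eLpNorm u 1 volume
  have hU : U ≠ ⊤ := hu.2.ne
  obtain ⟨C, hC, hphase⟩ := exists_eventually_lintegral_phaseSize_mul_magGrad_le hKb hK0
    hA.continuous (hu.locallyIntegrable le_rfl) hφ hfin hb.ne'
  have hquad : Tendsto (fun h : RN N => ‖h‖ₑ * (C + L * U)) (𝓝 0) (𝓝 0) :=
    tendsto_enorm_mul_zero (by finiteness)
  filter_upwards [hquad.eventually_lt_const hb, Metric.closedBall_mem_nhds 0 one_pos]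
    with h hh hball
  have hb_top : b ≠ ⊤ := hba.ne_top
  refine (shiftEnergy_one_le_liminf_dirEnergy_add hA hum hu hφ h (M := ‖h‖ₑ * C + b)
    (by finiteness) (hphase.mono fun k hk => hk h (mem_closedBall_zero_iff.1 hball))).trans
      (add_le_add_right ?_ _)
  calc 2 * (‖h‖ₑ * (‖h‖ₑ * C + b) + ‖h‖ₑ * (‖h‖ₑ * L) * U)
      = 2 * (‖h‖ₑ * (C + L * U) + b) * ‖h‖ₑ := by ring
    _ ≤ 2 * (a / 4 + a / 4) * ‖h‖ₑ := by
        gcongr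
        exact (hh.trans hba).le
    _ = 4 * (a / 4) * ‖h‖ₑ := by ring
    _ = a * ‖h‖ₑ ^ (1 : ℝ) := by
        rw [ENNReal.mul_div_cancel (by simp) ENNReal.ofNat_ne_top, ENNReal.rpow_one]

theorem lintegral_polarMomentNorm_one_magGrad (hKb : Bornology.IsBounded K)
    (φ : ContDiffBump (0 : RN N)) (hA : Continuous A) (hu : LocallyIntegrable u volume) :
    ∫⁻ x, ENNReal.ofReal (polarMomentNorm 1 K (magGrad φ A u x)) =
      coneMass volume K 1 (dirEnergy 1 (magGrad φ A u)) :=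
  lintegral_polarMomentNorm_one hKb (continuous_magGrad φ hA hu).stronglyMeasurable

theorem coneMass_dirEnergy_magGrad_le_magVariation (hKb : Bornology.IsBounded K) (hK0 : K ∈ 𝓝 0)
    (φ : ContDiffBump (0 : RN N)) (hA : Continuous A) (hu : LocallyIntegrable u volume) :
    coneMass volume K 1 (dirEnergy 1 (magGrad φ A u)) ≤ magVariation K A u :=
  (lintegral_polarMomentNorm_one_magGrad hKb φ hA hu).symm.trans_le
    (lintegral_polarMomentNorm_magGrad_le hKb hK0 hA hu φ)

theorem memLp_one_magGrad (hKb : Bornology.IsBounded K) (hK0 : K ∈ 𝓝 0)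
    (φ : ContDiffBump (0 : RN N)) (hA : Continuous A) (hu : LocallyIntegrable u volume)
    (hfin : magVariation K A u ≠ ⊤) : MemLp (magGrad φ A u) 1 volume := by
  simpa only [ENNReal.ofReal_one] using memLp_of_coneMass_dirEnergy_lt_top le_rfl hK0
    (continuous_magGrad φ hA hu).stronglyMeasurable
    ((coneMass_dirEnergy_magGrad_le_magVariation hKb hK0 φ hA hu).trans_lt hfin.lt_top)

variable [Nontrivial (RN N)] {ρ : ℕ → ℝ → ℝ}

theorem magVariation_le_liminf_lintegral_shiftEnergy (hKc : Convex ℝ K)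
    (hKb : Bornology.IsBounded K) (hK0 : K ∈ 𝓝 0) (hρ : IsMollifierSeq N 1 ρ)
    (hA : LipschitzWith L A) (hum : StronglyMeasurable u) (hu : MemLp u 1 volume)
    (hfin : magVariation K A u ≠ ⊤) :
    magVariation K A u ≤
      liminf (fun n => ∫⁻ h, shiftEnergy 1 A u h * radialKernel 1 (ρ n) (gauge K h)) atTop := by
  rw [← finrank_euclideanSpace_fin (𝕜 := ℝ) (n := N)] at hρ
  have hul := hu.locallyIntegrable le_rfl
  set c := coneMass (volume : Measure (RN N)) K 1 fun h => ‖h‖ₑ ^ (1 : ℝ)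
  have hc : c ≠ ⊤ := (coneMass_enorm_rpow_lt_top hKb zero_le_one).ne
  have hradius : Tendsto (fun k => 4 * (L * ENNReal.ofReal (shrinkingBump (RN N) k).rOut *
      eLpNorm u 1 volume)) atTop (𝓝 0) := by
    have hU : eLpNorm u 1 volume ≠ ⊤ := hu.2.ne
    simpa using ENNReal.Tendsto.const_mul (ENNReal.Tendsto.mul_const (ENNReal.Tendsto.const_mul
      (ENNReal.tendsto_ofReal (tendsto_rOut_shrinkingBump (RN N))) (Or.inr ENNReal.coe_ne_top))
      (Or.inr hU)) (Or.inr ENNReal.ofNat_ne_top)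
  refine le_of_forall_le_add_mul (c := 1 + 2 * c) (by finiteness) fun a ha => ?_
  obtain ⟨s, -, hs⟩ := exists_isCompact_eventually_magVariation_le hKb hK0 hA.continuous hul
    (tendsto_rOut_shrinkingBump (RN N)) hfin ha
  obtain ⟨k, hk, hk_radius⟩ := (hs.and (hradius.eventually_lt_const ha.bot_lt)).exists
  set φ := shrinkingBump (RN N) k
  have hGm := (continuous_magGrad φ hA.continuous hul).stronglyMeasurable
  have hlow := coneMass_le_liminf_lintegral_mul_radialKernel_add (μ := volume) hKc hKb hK0 hρ
    zero_le_one (measurable_dirEnergy hGm) (isPosHomogeneous_dirEnergy zero_le_one _)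
    (a := a + a) (D := shiftEnergy 1 A u)
    ((eventually_dirEnergy_magGrad_le φ hA hum hu
      (memLp_one_magGrad hKb hK0 φ hA.continuous hul hfin) ha).mono fun h hh =>
        hh.trans (by gcongr))
  calc magVariation K A u
      ≤ (∫⁻ x, ENNReal.ofReal (polarMomentNorm 1 K (magGrad φ A u x))) + a :=
        hk.trans (add_le_add_left (setLIntegral_le_lintegral _ _) _)
    _ ≤ _ := by
        rw [lintegral_polarMomentNorm_one_magGrad hKb φ hA.continuous hul]
        exact (add_le_add_left hlow _).trans_eq (by ring)

theorem limsup_lintegral_shiftEnergy_le_magVariation (hKc : Convex ℝ K)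
    (hKb : Bornology.IsBounded K) (hK0 : K ∈ 𝓝 0) (hρ : IsMollifierSeq N 1 ρ)
    (hA : LipschitzWith L A) (hum : StronglyMeasurable u) (hu : MemLp u 1 volume)
    (hfin : magVariation K A u ≠ ⊤) :
    limsup (fun n => ∫⁻ h, shiftEnergy 1 A u h * radialKernel 1 (ρ n) (gauge K h)) atTop ≤
      magVariation K A u := by
  rw [← finrank_euclideanSpace_fin (𝕜 := ℝ) (n := N)] at hρ
  have hul := hu.locallyIntegrable le_rfl
  set φ := shrinkingBump (RN N)
  have hmeas (k : ℕ) : Measurable (dirEnergy 1 (magGrad (φ k) A u)) :=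
    measurable_dirEnergy (continuous_magGrad (φ k) hA.continuous hul).stronglyMeasurable
  have hbound : 2 * (2 * eLpNorm u (ENNReal.ofReal 1) volume) ^ (1 : ℝ) ≠ ⊤ := by
    have hU : eLpNorm u 1 volume ≠ ⊤ := hu.2.ne
    rw [ENNReal.ofReal_one]
    finiteness
  have hcone : coneMass volume K 1
      (fun h => liminf (fun k => dirEnergy 1 (magGrad (φ k) A u) h) atTop) ≤ magVariation K A u :=
    (coneMass_liminf_le hmeas).trans ((liminf_le_liminf (.of_forall fun k =>
      coneMass_dirEnergy_magGrad_le_magVariation hKb hK0 (φ k) hA.continuous hul)).trans_eq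
        (liminf_const _))
  refine le_of_forall_le_add_mul
    (coneMass_enorm_rpow_lt_top (μ := (volume : Measure (RN N))) hKb zero_le_one).ne
    fun a ha => ?_
  refine (limsup_lintegral_mul_radialKernel_le_add hKc hKb hK0 hρ zero_le_one (.liminf hmeas)
    (isPosHomogeneous_liminf fun k => isPosHomogeneous_dirEnergy zero_le_one _) hbound
    (shiftEnergy_le le_rfl hA.continuous hum)
    (eventually_shiftEnergy_one_le_liminf_dirEnergy_add hKb hK0 hA hum hu
      (tendsto_rOut_shrinkingBump (RN N)) hfin ha)).trans (add_le_add_left hcone _)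

theorem tendsto_nonlocalEnergy_bv (hKc : Convex ℝ K) (hKs : ∀ x ∈ K, -x ∈ K)
    (hKb : Bornology.IsBounded K) (hK0 : K ∈ 𝓝 0) (hρ : IsMollifierSeq N 1 ρ)
    (hA : LipschitzWith L A) (hu : MemMagBV K A u) :
    Tendsto (fun n => nonlocalEnergy 1 K A (ρ n) u) atTop (𝓝 (magVariation K A u)) := by
  obtain ⟨huL, hfin⟩ := hu
  have huv := huL.1.ae_eq_mk
  have hvm := huL.1.stronglyMeasurable_mk
  have hv := huL.ae_eq huv
  rw [magVariation_congr huv] at hfin ⊢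
  refine (tendsto_of_le_liminf_of_limsup_le
    (magVariation_le_liminf_lintegral_shiftEnergy hKc hKb hK0 hρ hA hvm hv hfin.ne)
    (limsup_lintegral_shiftEnergy_le_magVariation hKc hKb hK0 hρ hA hvm hv hfin.ne)).congr
      fun n => ?_
  rw [nonlocalEnergy_congr huv, nonlocalEnergy_eq_lintegral one_pos hKc hKs hKb hK0
    ((finrank_euclideanSpace_fin (𝕜 := ℝ) (n := N)).symm ▸ hρ |>.aemeasurable_radialKernel n)
    hA.continuous hvm]

end BVLimit

section PowerProfiles

theorem setLIntegral_Ioi_rpow {a : ℝ} (ha : a < -1) {δ : ℝ} (hδ : 0 < δ) :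
    ∫⁻ r in Ioi δ, ENNReal.ofReal (r ^ a) = ENNReal.ofReal (-δ ^ (a + 1) / (a + 1)) := by
  rw [← ofReal_integral_eq_lintegral_ofReal (integrableOn_Ioi_rpow_of_lt ha hδ),
    integral_Ioi_rpow_of_lt ha hδ]
  filter_upwards [ae_restrict_mem measurableSet_Ioi] with r hr
  exact Real.rpow_nonneg (hδ.trans hr).le _

theorem setLIntegral_ofReal_mul_rpow_mul_rpow {s : Set ℝ} (hs : MeasurableSet s) (hpos : s ⊆ Ioi 0)
    {c : ℝ} (hc : 0 ≤ c) (a b : ℝ) :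
    ∫⁻ r in s, ENNReal.ofReal (c * r ^ a * r ^ b) =
      ENNReal.ofReal c * ∫⁻ r in s, ENNReal.ofReal (r ^ (a + b)) := by
  rw [← lintegral_const_mul' _ _ ENNReal.ofReal_ne_top]
  refine setLIntegral_congr_fun hs fun r hr => ?_
  rw [mul_assoc, ← Real.rpow_add (hpos hr), ENNReal.ofReal_mul hc]

theorem isMollifierSeq_rpow {p : ℝ} (hp : 0 < p) (N : ℕ) {s : ℕ → ℝ}
    (hs : ∀ n, 0 < s n ∧ s n < 1) (hlim : Tendsto s atTop (𝓝 1)) :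
    IsMollifierSeq N p fun n r => p * (1 - s n) * r ^ (p - (N : ℝ) - p * s n) := by
  have hpos (n : ℕ) : 0 < p * (1 - s n) := mul_pos hp (sub_pos.2 (hs n).2)
  refine ⟨fun n => by fun_prop, fun n r hr => ?_, fun δ hδ => ?_, fun n => ?_⟩
  · have := hpos n
    positivity
  · have htail (n : ℕ) : ∫⁻ r in Ioi δ, ENNReal.ofReal
        (p * (1 - s n) * r ^ (p - (N : ℝ) - p * s n) * r ^ ((N : ℝ) - 1 - p)) =
          ENNReal.ofReal ((1 - s n) / s n * δ ^ (-(p * s n))) := by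
      have hsn := (hs n).1
      have hexp : p - (N : ℝ) - p * s n + (N - 1 - p) = -(p * s n) - 1 := by ring
      rw [setLIntegral_ofReal_mul_rpow_mul_rpow measurableSet_Ioi (Ioi_subset_Ioi hδ.le)
        (hpos n).le, hexp, setLIntegral_Ioi_rpow (by linarith [mul_pos hp hsn]) hδ,
        ← ENNReal.ofReal_mul (hpos n).le, sub_add_cancel]
      congr 1
      field_simp
    have hzero : Tendsto (fun n => (1 - s n) / s n * δ ^ (-(p * s n))) atTop
        (𝓝 ((1 - 1) / 1 * δ ^ (-(p * 1)))) :=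
      ((hlim.const_sub 1).div hlim one_ne_zero).mul
        (tendsto_const_nhds.rpow (hlim.const_mul p).neg (Or.inl hδ.ne'))
    simpa only [htail, sub_self, zero_div, zero_mul, ENNReal.ofReal_zero] using
      ENNReal.tendsto_ofReal hzero
  · have hexp : p - (N : ℝ) - p * s n + (N - 1) = p * (1 - s n) - 1 := by ring
    rw [setLIntegral_ofReal_mul_rpow_mul_rpow measurableSet_Ioo Ioo_subset_Ioi_self (hpos n).le,
      hexp, setLIntegral_Ioo_rpow (by linarith [hpos n]) one_pos, ← ENNReal.ofReal_mul (hpos n).le,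
      sub_add_cancel, Real.one_rpow, mul_one_div_cancel (hpos n).ne', ENNReal.ofReal_one]

end PowerProfiles

section Fractional

variable {N : ℕ} {K : Set (RN N)} {p : ℝ}

theorem Psi_zero (u : RN N → ℂ) (x y : RN N) : Psi 0 u x y = u y := by
  simp [Psi]

theorem absP_ofReal_rpow (hp : 0 < p) (t : ℝ) : absP p (t : ℂ) ^ p = |t| ^ p := by
  rw [absP_rpow hp, Complex.ofReal_re, Complex.ofReal_im, abs_zero, Real.zero_rpow hp.ne', add_zero]

theorem nonlocalEnergy_rpow (hp : 0 < p) (hKb : Bornology.IsBounded K) (hK0 : K ∈ 𝓝 0)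
    (u : RN N → ℝ) {s : ℝ} (hs : s ≤ 1) :
    nonlocalEnergy p K 0 (fun r => p * (1 - s) * r ^ (p - (N : ℝ) - p * s)) (fun x => (u x : ℂ)) =
      ENNReal.ofReal p * (ENNReal.ofReal (1 - s) * fractionalEnergy p s K u) := by
  have hc : 0 ≤ p * (1 - s) := mul_nonneg hp.le (sub_nonneg.2 hs)
  rw [← mul_assoc, ← ENNReal.ofReal_mul hp.le, nonlocalEnergy, fractionalEnergy,
    ← lintegral_const_mul' _ _ ENNReal.ofReal_ne_top]
  refine lintegral_congr fun z => ?_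
  rw [← ENNReal.ofReal_mul hc, Psi_zero, Psi_zero, ← Complex.ofReal_sub, absP_ofReal_rpow hp,
    abs_sub_comm]
  congr 1
  rcases eq_or_ne z.1 z.2 with hz | hz
  · simp [hz, Real.zero_rpow hp.ne']
  · have hg : 0 < gauge K (z.1 - z.2) := (gauge_pos_iff_ne_zero hKb hK0).2 (sub_ne_zero.2 hz)
    have hpow : gauge K (z.1 - z.2) ^ (p - (N : ℝ) - p * s) =
        gauge K (z.1 - z.2) ^ p / gauge K (z.1 - z.2) ^ ((N : ℝ) + p * s) := by
      rw [← Real.rpow_sub hg, sub_sub]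
    have hgp := (Real.rpow_pos_of_pos hg p).ne'
    rw [hpow]
    field_simp

theorem tendsto_fractionalEnergy (hp : 0 < p) (hKb : Bornology.IsBounded K) (hK0 : K ∈ 𝓝 0)
    (u : RN N → ℝ) {E : ℝ≥0∞}
    (hE : ∀ ρ : ℕ → ℝ → ℝ, IsMollifierSeq N p ρ →
      Tendsto (fun n => nonlocalEnergy p K 0 (ρ n) (fun x => (u x : ℂ))) atTop
        (𝓝 (ENNReal.ofReal p * E))) :
    Tendsto (fun s : ℝ => ENNReal.ofReal (1 - s) * fractionalEnergy p s K u) (𝓝[<] 1) (𝓝 E) := by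
  have hp0 : ENNReal.ofReal p ≠ 0 := (ENNReal.ofReal_pos.2 hp).ne'
  refine tendsto_of_seq_tendsto fun s hs => ?_
  obtain ⟨hs_one, hs_lt⟩ := tendsto_nhdsWithin_iff.1 hs
  -- Only the tail of `s` is known to lie in `(0, 1)`.
  set s' : ℕ → ℝ := fun n => if 0 < s n ∧ s n < 1 then s n else 1 / 2 with hs'
  have heq : s' =ᶠ[atTop] s := by
    filter_upwards [hs_one.eventually (lt_mem_nhds one_pos), hs_lt] with n hpos hlt
    exact if_pos ⟨hpos, hlt⟩
  have hmem (n : ℕ) : 0 < s' n ∧ s' n < 1 := by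
    simp only [hs']
    split_ifs with h
    · exact h
    · norm_num
  have hlim := hE _ (isMollifierSeq_rpow hp N hmem (hs_one.congr' heq.symm))
  simp only [nonlocalEnergy_rpow hp hKb hK0 u (hmem _).2.le] at hlim
  have hcancel := ENNReal.Tendsto.const_mul (a := (ENNReal.ofReal p)⁻¹) hlim
    (Or.inr (ENNReal.inv_ne_top.2 hp0))
  simp only [← mul_assoc (ENNReal.ofReal p)⁻¹, ENNReal.inv_mul_cancel hp0 ENNReal.ofReal_ne_top,
    one_mul] at hcancel
  exact hcancel.congr' (heq.mono fun n hn => by simp only [Function.comp_apply, hn])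

theorem toCN_zero : toCN (0 : RN N) = 0 := by
  ext
  simp [toCN]

theorem magEnergy_zero (u : RN N → ℂ) (g : RN N → CN N) :
    magEnergy p K 0 u g = ∫⁻ x, ENNReal.ofReal (polarMomentNorm p K (g x) ^ p) := by
  simp [magEnergy, toCN_zero]

theorem ofReal_polarMomentNorm_rpow_le (hp : 0 < p) (hKb : Bornology.IsBounded K) (v : CN N) :
    ENNReal.ofReal p * ENNReal.ofReal (polarMomentNorm p K v ^ p) ≤
      2 * ‖v‖ₑ ^ p * coneMass volume K p fun h => ‖h‖ₑ ^ p := by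
  rw [ofReal_polarMomentNorm_rpow hp hKb, ← coneMass_const_mul _ _ (by fun_prop)]
  refine coneMass_mono _ fun h => (ePow_le hp.le _).trans ?_
  rw [mul_assoc, mul_comm (‖v‖ₑ ^ p), ← ENNReal.mul_rpow_of_nonneg _ _ hp.le]
  gcongr
  exact enorm_cdot_le v h

theorem lintegral_polarMomentNorm_lt_top (hp : 0 < p) (hKb : Bornology.IsBounded K)
    {g : RN N → CN N} (hg : MemLp g (ENNReal.ofReal p) volume) :
    ∫⁻ x, ENNReal.ofReal (polarMomentNorm p K (g x) ^ p) < ⊤ := by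
  set c := coneMass (volume : Measure (RN N)) K p fun h => ‖h‖ₑ ^ p
  have hc : c ≠ ⊤ := (coneMass_enorm_rpow_lt_top hKb hp.le).ne
  have hle : ENNReal.ofReal p * ∫⁻ x, ENNReal.ofReal (polarMomentNorm p K (g x) ^ p) ≤
      2 * c * eLpNorm g (ENNReal.ofReal p) volume ^ p := by
    rw [← lintegral_const_mul' _ _ ENNReal.ofReal_ne_top, eLpNorm_ofReal_rpow hp,
      ← lintegral_const_mul' _ _ (by finiteness)]
    exact lintegral_mono fun x =>
      (ofReal_polarMomentNorm_rpow_le hp hKb (g x)).trans_eq (mul_right_comm _ _ _)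
  have hfin : 2 * c * eLpNorm g (ENNReal.ofReal p) volume ^ p < ⊤ :=
    ENNReal.mul_lt_top (by finiteness) (ENNReal.rpow_lt_top_of_nonneg hp.le hg.2.ne)
  exact ENNReal.lt_top_of_mul_ne_top_right (hle.trans_lt hfin).ne (ENNReal.ofReal_pos.2 hp).ne'

end Fractional

end AnisotropicBBM

end

theorem theorem2 (N : ℕ) (hN : 1 ≤ N) (p : ℝ) (hp : 1 ≤ p)
    (K : Set (AnisotropicBBM.RN N)) (hKconv : Convex ℝ K) (hKsymm : ∀ x ∈ K, -x ∈ K)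
    (hKbdd : Bornology.IsBounded K) (hKint : (0 : AnisotropicBBM.RN N) ∈ interior K) :
    -- the anisotropic magnetic formula, for Sobolev and for BV functions
    (∀ A : AnisotropicBBM.RN N → AnisotropicBBM.RN N, (∃ L, LipschitzWith L A) →
      ∀ ρ : ℕ → ℝ → ℝ, AnisotropicBBM.IsMollifierSeq N p ρ →
        (∀ u : AnisotropicBBM.RN N → ℂ, AnisotropicBBM.MemMagSobolev p K A u →
          ∀ g : AnisotropicBBM.RN N → AnisotropicBBM.CN N, AnisotropicBBM.IsWeakGradient u g →
            Tendsto (fun n => AnisotropicBBM.nonlocalEnergy p K A (ρ n) u) atTop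
              (𝓝 (ENNReal.ofReal p * AnisotropicBBM.magEnergy p K A u g))) ∧
        (p = 1 → ∀ u : AnisotropicBBM.RN N → ℂ, AnisotropicBBM.MemMagBV K A u →
          Tendsto (fun n => AnisotropicBBM.nonlocalEnergy p K A (ρ n) u) atTop
            (𝓝 (AnisotropicBBM.magVariation K A u)))) ∧
    -- the power-type profiles are admissible
    (∀ s : ℕ → ℝ, (∀ n, 0 < s n ∧ s n < 1) → Tendsto s atTop (𝓝 1) →
      AnisotropicBBM.IsMollifierSeq N p
        (fun n r => p * (1 - s n) * r ^ (p - (N : ℝ) - p * s n))) ∧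
    -- Ludwig's formula for `u ∈ W^{1,p}(ℝ^N)` real-valued
    (∀ u : AnisotropicBBM.RN N → ℝ, MemLp u (ENNReal.ofReal p) volume →
      ∀ g : AnisotropicBBM.RN N → AnisotropicBBM.CN N,
        AnisotropicBBM.IsWeakGradient (fun x => (u x : ℂ)) g →
        MemLp g (ENNReal.ofReal p) volume →
          Tendsto (fun s : ℝ =>
              ENNReal.ofReal (1 - s) * AnisotropicBBM.fractionalEnergy p s K u) (𝓝[<] 1)
            (𝓝 (∫⁻ x, ENNReal.ofReal (AnisotropicBBM.polarMomentNorm p K (g x) ^ p)))) ∧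
    -- Ludwig's formula for real-valued functions of bounded variation
    (p = 1 → ∀ u : AnisotropicBBM.RN N → ℝ,
      AnisotropicBBM.MemMagBV K 0 (fun x => (u x : ℂ)) →
        Tendsto (fun s : ℝ =>
            ENNReal.ofReal (1 - s) * AnisotropicBBM.fractionalEnergy p s K u) (𝓝[<] 1)
          (𝓝 (AnisotropicBBM.magVariation K 0 (fun x => (u x : ℂ))))) := by
  have hp0 : 0 < p := zero_lt_one.trans_le hp
  have hK0 : K ∈ 𝓝 0 := mem_interior_iff_mem_nhds.1 hKint
  have : Nontrivial (AnisotropicBBM.RN N) :=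
    Module.nontrivial_of_finrank_pos (R := ℝ) (by rwa [finrank_euclideanSpace_fin])
  refine ⟨fun A ⟨L, hL⟩ ρ hρ => ⟨fun u hu g hg => ?_, fun hp1 u hu => ?_⟩,
    fun s hs hlim => AnisotropicBBM.isMollifierSeq_rpow hp0 N hs hlim,
    fun u hu g hg hgL => ?_, fun hp1 u hu => ?_⟩
  · exact AnisotropicBBM.tendsto_nonlocalEnergy_sobolev hp hKconv hKsymm hKbdd hK0 hρ hL hu hg
  · subst hp1
    exact AnisotropicBBM.tendsto_nonlocalEnergy_bv hKconv hKsymm hKbdd hK0 hρ hL hu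
  · have hfin := AnisotropicBBM.lintegral_polarMomentNorm_lt_top hp0 hKbdd hgL
    rw [← AnisotropicBBM.magEnergy_zero (fun x => (u x : ℂ)) g] at hfin ⊢
    exact AnisotropicBBM.tendsto_fractionalEnergy hp0 hKbdd hK0 u fun ρ hρ =>
      AnisotropicBBM.tendsto_nonlocalEnergy_sobolev hp hKconv hKsymm hKbdd hK0 hρ
        (LipschitzWith.const 0) ⟨hu.ofReal, g, hg, hfin⟩ hg
  · subst hp1
    refine AnisotropicBBM.tendsto_fractionalEnergy hp0 hKbdd hK0 u fun ρ hρ => ?_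
    rw [ENNReal.ofReal_one, one_mul]
    exact AnisotropicBBM.tendsto_nonlocalEnergy_bv hKconv hKsymm hKbdd hK0 hρ
      (LipschitzWith.const 0) hu
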